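/- **Setting.** There are $V$ nodes; node $v$ holds $D_v\ge 1$ data samples with differentiable losses $f_{v,i}:\mathbb R^d\to\mathbb R$. Put $D=\sum_v D_v$, $p_v=D_v/D$, $\rho=\sum_v p_v^2$, $f^v=\frac1{D_v}\sum_i f_{v,i}$ (local loss) and $f=\frac1D\sum_{v,i}f_{v,i}$ (global loss). Let $x_0\in\mathbb R^d$, $T\ge1$ and let $\eta>0$ be a constant learning rate. At every iteration $t<T$ every node $v$ draws one of its samples, $i^v_t$, uniformly and independently of everything else, and computes $g^v_t=\nabla f_{v,i^v_t}(x^v_t)$ at its local model $x^v_t$; this gradient is applied in slot $l^v_t\ge t$. All models start at $x_0$. The local update of slot $t$ is $y^v=x^v_t-\eta\sum_{z:\,l^v_z=t}g^v_z$. The completion times $l^v_t$ and the times at which nodes receive a global model are arbitrary but fixed (not depending on the samples). *Single-stream DIGEST.* One global model $\tilde x$ circulates; in each slot at most one node receives it. If no global model reaches $v$ in slot $t+1$, then $x^v_{t+1}=y^v$. If $v$ receives it in slot $t+1$, then $\tilde x\leftarrow\tilde x+p_v(y^v-x^v_{-1})$ and $x^v_{t+1},x^v_{-1}\leftarrow\tilde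 x$, where $x^v_{-1}$ is the model stored at the latest global update of $v$. *Multi-stream DIGEST.* A spanning rooted tree on the nodes, with root $r$, is given. The root, and every node with more than one child, creates one stream towards each of its children; a stream runs down the tree and ends at the next node with more than one child, or at a leaf. Each stream $m$ carries its own global model $\tilde x[m]$, received in each slot by at most one node of its range. When $v$ receives it, $\tilde x[m]\leftarrow\tilde x[m]+p_v(x^v-x^v_{-1})+(x^v_{-1}-\tilde x^v_{-1}[m])$, where $x^v$ is the current local model and $\tilde x^v_{-1}[m]$ is the value of $\tilde x[m]$ at its latest update at $v$; then $x^v,x^v_{-1},\tilde x^v_{-1}[m]\leftarrow\tilde x[m]$. Several streams at one node in one slot are processed one after the other. $P_v^r$ is the set of streams on the tree path from $v$ to $r$. **Assumptions**, with $L>0$, $\sigma,\zeta\ge0$: (1) every $\nabla f^v$ is $L$-Lipschitz; (2) at all iterates $x^v_t$, $t<T$, $\frac1{D_v}\sum_i\|\nabla f_{v,i}(x^v_t)-\nabla f^v(x^v_t)\|^2\le\sigma^2$; (3) at all these iterates $\|\nabla f^v(x^v_t)-\nabla f(x^v_t)\|^2\le\zeta^2$; (4) $t\le l^v_t\le t+E$;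 (5) counting slot $0$ as a synchronization, the gap between subsequent synchronizations of every node is at most $H$ up to time $T$ (single-stream), or for every stream $m$ and every node of its range at most $H_m$ (multi-stream). Let $H'=H$ for single-stream and $H'=\max_v\sum_{m\in P_v^r}H_m$ for multi-stream DIGEST, and $A=H'+E\ge1$. **Theorem 1.** There is an absolute constant $C>0$ such that the following holds for single- and for multi-stream DIGEST. Expectations are over the samples. * *Non-convex.* For every $F>0$ there is a constant learning rate $0<\eta\le\frac1{30LA}$ (depending only on the parameters, including $T$) such that, if $f(x_0)-f^*\le F$, where $f^*=\inf f>-\infty$, then with $\hat x_t=\sum_v p_v x^v_t$ $$\frac1T\sum_{t=0}^{T-1}\mathbb E\|\nabla f(\hat x_t)\|^2\le C\left(\frac{FLA}{T}+\sigma\sqrt{\frac{\rho LF}{T}}+\left(\frac{LF\sqrt{\sigma^2A+\zeta^2A^2}}{T}\right)^{2/3}\right).$$ * *Convex.* Let every $f^v$ be convex and let $x^*$ minimize $f$. For every $R>0$ there is $0<\eta\le\frac1{30LA}$ as above such that, if $\|x_0-x^*\|^2\le R$, then with $\hat x_T=\frac1T\sum_{t<T}\sum_v p_v x^v_t$ $$\mathbb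 E f(\hat x_T)-f(x^*)\le C\left(\frac{RLA}{T}+\sigma\sqrt{\frac{\rho R}{T}}+\left(\frac{R\sqrt{L(\sigma^2A+\zeta^2A^2)}}{T}\right)^{2/3}\right).$$ * *Strongly convex.* Let every $f^v$ be $\mu$-strongly convex, $\mu>0$, and let $x^*$ minimize $f$. For every $R\ge0$ there is $0<\eta\le\frac1{30LA}$ as above such that, if $\|x_0-x^*\|^2\le R$, then with $\omega_t=(1-\mu\eta)^{-(t+1)}$, $W_T=\sum_{t<T}\omega_t$ and $\hat x_T=\frac1{W_T}\sum_{t<T}\omega_t\sum_v p_v x^v_t$ $$\mathbb E f(\hat x_T)-f(x^*)\le C\left(RLA\,e^{-\frac{\mu T}{30LA}}+\frac{\rho\sigma^2}{\mu T}\,\ell+\frac{L(\sigma^2A+\zeta^2A^2)}{\mu^2T^2}\,\ell^2\right),$$ where $\ell=\log\max\left\{2,\ R\Big/\left(\frac{\rho\sigma^2}{\mu^2T^2}+\frac{L(\sigma^2A+\zeta^2A^2)}{\mu^3T^3}\right)\right\}$ is the logarithmic factor (if $\sigma=0$ and $\sigma^2A+\zeta^2A^2=0$, the last two terms are $0$).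 -/

import Mathlib

open scoped BigOperators RealInnerProductSpace

namespace Digest

noncomputable section

/-- The model space `ℝ^d` with its Euclidean norm. -/
abbrev Model (d : ℕ) : Type := EuclideanSpace ℝ (Fin d)

/-! ### Data weights and losses

There are `V` nodes; node `v` holds `D v` samples, and `loss v i` is the loss of its `i`-th sample. -/

/-- The total number of samples `D = ∑ v, D_v`. -/
def totalData {V : ℕ} (D : Fin V → ℕ) : ℝ := ∑ v, (D v : ℝ)

/-- The weight `D_v / D` of node `v`. -/
def weight {V : ℕ} (D : Fin V → ℕ) (v : Fin V) : ℝ := (D v : ℝ) / totalData D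

/-- The data concentration coefficient `ρ = ∑ v, (D_v / D)^2`. -/
def concentration {V : ℕ} (D : Fin V → ℕ) : ℝ := ∑ v, weight D v ^ 2

/-- The loss of node `v`: the average of the losses of its samples. -/
def localLoss {d V : ℕ} {D : Fin V → ℕ} (loss : (v : Fin V) → Fin (D v) → Model d → ℝ)
    (v : Fin V) (x : Model d) : ℝ :=
  (1 / (D v : ℝ)) * ∑ i, loss v i x

/-- The global loss: the average of the losses of all samples. -/
def globalLoss {d V : ℕ} {D : Fin V → ℕ} (loss : (v : Fin V) → Fin (D v) → Model d → ℝ)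
    (x : Model d) : ℝ :=
  (1 / totalData D) * ∑ v, ∑ i, loss v i x

/-- A sample path: the sample that every node draws at every iteration `t < T`.
The draws are independent and uniform, so the law on sample paths is the uniform one, and the
expectation of `X` is the average `𝔼 ω, X ω` over all sample paths. -/
abbrev Sampling {V : ℕ} (T : ℕ) (D : Fin V → ℕ) : Type := Fin T → (v : Fin V) → Fin (D v)

/-- The stochastic gradient `∇ f_{i^v_t}` at the point `x`, along the sample path `ω`
(the value for `t ≥ T` is irrelevant). -/
def stochGrad {d V T : ℕ} {D : Fin V → ℕ} (loss : (v : Fin V) → Fin (D v) → Model d → ℝ)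
    (ω : Sampling T D) (t : ℕ) (v : Fin V) (x : Model d) : Model d :=
  if h : t < T then gradient (loss v (ω ⟨t, h⟩ v)) x else 0

/-- The local update of one node at slot `t`: `x - ∑_{z ∈ U_t} η g_z`, where `U_t` is the set of the
iterations `z` whose gradient is delayed until slot `lag z = t`. -/
def localStep {d : ℕ} (η : ℝ) (lag : ℕ → ℕ) (t : ℕ) (g : ℕ → Model d) (x : Model d) : Model d :=
  x - ∑ z ∈ (Finset.range (t + 1)).filter (fun z => lag z = t), η • g z

/-! ### Single-stream DIGEST -/

/-- The variables of single-stream DIGEST at one slot. -/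
structure SingleState (d V : ℕ) where
  /-- the local models `x^v_t` -/
  x : Fin V → Model d
  /-- the local models `x^v_{-1}` stored at the latest global update of each node -/
  base : Fin V → Model d
  /-- the global model in circulation -/
  glob : Model d
  /-- the gradients `grad v z` computed so far -/
  grad : Fin V → ℕ → Model d

/-- The run of single-stream DIGEST with node weights `p`, initial model `x₀`, completion times
`lag v z` and gradient oracle `G`. At slot `t` the global model is received by the node
`visit t`, if there is one (that is, `s^v_t = 1` if and only if `visit t = some v`). -/
def singleRun {d V : ℕ} (p : Fin V → ℝ) (x₀ : Model d) (η : ℝ) (lag : Fin V → ℕ → ℕ)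
    (visit : ℕ → Option (Fin V)) (G : ℕ → Fin V → Model d → Model d) : ℕ → SingleState d V
  | 0 => { x := fun _ => x₀, base := fun _ => x₀, glob := x₀, grad := fun _ _ => 0 }
  | t + 1 =>
    let s := singleRun p x₀ η lag visit G t
    let grad : Fin V → ℕ → Model d := fun v => Function.update (s.grad v) t (G t v (s.x v))
    let y : Fin V → Model d := fun v => localStep η (lag v) t (grad v) (s.x v)
    match visit (t + 1) with
    | none => { x := y, base := s.base, glob := s.glob, grad := grad }
    | some v =>
      let glob : Model d := s.glob + p v • (y v - s.base v)
      { x := Function.update y v glob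
        base := Function.update s.base v glob
        glob := glob
        grad := grad }

/-! ### Rooted trees and their streams -/

/-- A rooted tree on the nodes, given by the parent map (the root is its own parent). -/
structure RootedTree (V : ℕ) where
  root : Fin V
  parent : Fin V → Fin V
  parent_root : parent root = root
  reaches_root : ∀ v, ∃ k : ℕ, parent^[k] v = root

namespace RootedTree

variable {V : ℕ} (τ : RootedTree V)

open Classical in
/-- The children of a node. -/
def children (v : Fin V) : Finset (Fin V) :=
  Finset.univ.filter (fun w => w ≠ τ.root ∧ τ.parent w = v)

/-- The nodes that create streams: the root, and every node with more than one child. -/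
def IsBranching (v : Fin V) : Prop := v = τ.root ∨ 1 < (τ.children v).card

/-- A branching node creates one stream towards each of its children. A stream is named after
this child, its first node below the node that creates it. -/
def IsStream (m : Fin V) : Prop := m ≠ τ.root ∧ τ.IsBranching (τ.parent m)

/-- The edge from `w` to its parent belongs to the stream `m`: going up from `w` one reaches `m`
through nodes none of which, above `w` and up to `m`, is branching. -/
def EdgeInStream (m w : Fin V) : Prop :=
  τ.IsStream m ∧ w ≠ τ.root ∧
    ∃ k : ℕ, τ.parent^[k] w = m ∧ ∀ j, 1 ≤ j → j ≤ k → ¬ τ.IsBranching (τ.parent^[j] w)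

/-- `v ∈ V_m`, equivalently `m ∈ M_v`: the stream `m` passes through the node `v`. Its range starts
at the branching node that creates it and ends at the next branching node or leaf below. -/
def InRange (m v : Fin V) : Prop :=
  τ.IsStream m ∧ (v = τ.parent m ∨ τ.EdgeInStream m v)

open Classical in
/-- `P_v^r`: the streams on the tree path from `v` to the root. -/
def pathStreams (v : Fin V) : Finset (Fin V) :=
  Finset.univ.filter (fun m => ∃ k : ℕ, τ.EdgeInStream m (τ.parent^[k] v))

end RootedTree

/-! ### Multi-stream DIGEST -/

/-- The variables of multi-stream DIGEST at one slot. -/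
structure MultiState (d V : ℕ) where
  /-- the local models `x^v_t` -/
  x : Fin V → Model d
  /-- the local models `x^v_{-1}` stored at the latest global update of each node -/
  base : Fin V → Model d
  /-- the global models in circulation, one for each stream -/
  glob : Fin V → Model d
  /-- `last m v`: the global model of stream `m` at its latest update at node `v` -/
  last : Fin V → Fin V → Model d
  /-- the gradients `grad v z` computed so far -/
  grad : Fin V → ℕ → Model d

/-- The global update of stream `m` at the node `o`, if there is one. -/
def streamStep {d V : ℕ} (p : Fin V → ℝ) (m : Fin V) (o : Option (Fin V))
    (s : MultiState d V) : MultiState d V :=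
  match o with
  | none => s
  | some v =>
    let g : Model d := s.glob m + p v • (s.x v - s.base v) + (s.base v - s.last m v)
    { x := Function.update s.x v g
      base := Function.update s.base v g
      glob := Function.update s.glob m g
      last := Function.update s.last m (Function.update (s.last m) v g)
      grad := s.grad }

/-- The run of multi-stream DIGEST: after the local updates of a slot, the streams that visit a node
in this slot are processed one after the other. At slot `t` the global model of stream `m` is
received by the node `visit m t`, if there is one (that is, `s^v_t[m] = 1` if and only if
`visit m t = some v`). -/
def multiRun {d V : ℕ} (p : Fin V → ℝ) (x₀ : Model d) (η : ℝ) (lag : Fin V → ℕ → ℕ)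
    (visit : Fin V → ℕ → Option (Fin V)) (G : ℕ → Fin V → Model d → Model d) :
    ℕ → MultiState d V
  | 0 => { x := fun _ => x₀, base := fun _ => x₀, glob := fun _ => x₀, last := fun _ _ => x₀,
           grad := fun _ _ => 0 }
  | t + 1 =>
    let s := multiRun p x₀ η lag visit G t
    let grad : Fin V → ℕ → Model d := fun v => Function.update (s.grad v) t (G t v (s.x v))
    let y : Fin V → Model d := fun v => localStep η (lag v) t (grad v) (s.x v)
    (List.finRange V).foldl (fun s m => streamStep p m (visit m (t + 1)) s)
      { x := y, base := s.base, glob := s.glob, last := s.last, grad := grad }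

/-! ### Schedules -/

/-- The synchronization schedule of either variant of DIGEST, with its synchronization bound `H`, or
`H m` for stream `m`. -/
inductive Schedule (V : ℕ) where
  | single (H : ℕ) (visit : ℕ → Option (Fin V))
  | multi (τ : RootedTree V) (H : Fin V → ℕ) (visit : Fin V → ℕ → Option (Fin V))

/-- Between slots `0` and `T` the gap between subsequent synchronizations is at most `H`: among any
`H` consecutive slots `t + 1, …, t + H ≤ T` there is a slot `u` with `s u`. (At slot `0` all nodes
hold the initial model, so the first gap starts there.) -/
def GapLE (T H : ℕ) (s : ℕ → Prop) : Prop :=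
  ∀ t, t + H ≤ T → ∃ u, t < u ∧ u ≤ t + H ∧ s u

namespace Schedule

variable {V : ℕ}

/-- The schedule is consistent and satisfies the bounds on the synchronization interval. -/
def Bounded (T : ℕ) : Schedule V → Prop
  | single H visit => ∀ v, GapLE T H (fun t => visit t = some v)
  | multi τ H visit =>
      (∀ m t v, visit m t = some v → τ.InRange m v) ∧
      ∀ m v, τ.InRange m v → GapLE T (H m) (fun t => visit m t = some v)

/-- `H'`, which is `H` for single-stream, and `max_v ∑_{m ∈ P_v^r} H_m` for multi-stream DIGEST. -/
def interval : Schedule V → ℕ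
  | single H _ => H
  | multi τ H _ => Finset.univ.sup (fun v => ∑ m ∈ τ.pathStreams v, H m)

end Schedule

/-! ### Instances, iterates and assumptions -/

/-- A decentralized learning problem together with an asynchronous execution of DIGEST. -/
structure Instance (d V T : ℕ) (D : Fin V → ℕ) where
  /-- the sample losses -/
  loss : (v : Fin V) → Fin (D v) → Model d → ℝ
  /-- the initial model -/
  x₀ : Model d
  /-- `lag v t`: the slot in which node `v` applies the gradient computed at iteration `t` -/
  lag : Fin V → ℕ → ℕ
  /-- the bound on the lag -/
  E : ℕ
  /-- the synchronization schedule, single- or multi-stream -/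
  schedule : Schedule V

namespace Instance

variable {d V T : ℕ} {D : Fin V → ℕ} (S : Instance d V T D)

/-- The local model `x^v_t` along the sample path `ω`, with constant learning rate `η`. -/
def iterate (η : ℝ) (ω : Sampling T D) (t : ℕ) (v : Fin V) : Model d :=
  match S.schedule with
  | .single _ visit => (singleRun (weight D) S.x₀ η S.lag visit (stochGrad S.loss ω) t).x v
  | .multi _ _ visit => (multiRun (weight D) S.x₀ η S.lag visit (stochGrad S.loss ω) t).x v

/-- The global loss `f`. -/
def f : Model d → ℝ := globalLoss S.loss

/-- `A = H' + E`. -/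
def A : ℕ := S.schedule.interval + S.E

/-- Smooth local losses, bounded local variance, bounded diversity, bounded lag and bounded
synchronization interval, for the run with learning rate `η`. -/
structure Assumptions (L σ ζ η : ℝ) : Prop where
  differentiable : ∀ v i, Differentiable ℝ (S.loss v i)
  smooth : ∀ v x y, ‖gradient (localLoss S.loss v) y - gradient (localLoss S.loss v) x‖
    ≤ L * ‖y - x‖
  variance : ∀ (ω : Sampling T D) (t : ℕ) (v : Fin V), t < T →
    (1 / (D v : ℝ)) * ∑ i, ‖gradient (S.loss v i) (S.iterate η ω t v)
      - gradient (localLoss S.loss v) (S.iterate η ω t v)‖ ^ 2 ≤ σ ^ 2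
  diversity : ∀ (ω : Sampling T D) (t : ℕ) (v : Fin V), t < T →
    ‖gradient (localLoss S.loss v) (S.iterate η ω t v)
      - gradient S.f (S.iterate η ω t v)‖ ^ 2 ≤ ζ ^ 2
  lag : ∀ v t, t < T → t ≤ S.lag v t ∧ S.lag v t ≤ t + S.E
  gap : S.schedule.Bounded T

/-- Every local loss is `μ`-(strongly) convex. -/
def Convex (μ : ℝ) : Prop :=
  ∀ v x y, localLoss S.loss v x + ⟪gradient (localLoss S.loss v) x, y - x⟫
    + μ / 2 * ‖y - x‖ ^ 2 ≤ localLoss S.loss v y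

/-- The data-weighted average `∑ v, (D_v / D) x^v_t` of the local models at slot `t`. -/
def nodeAverage (η : ℝ) (ω : Sampling T D) (t : ℕ) : Model d :=
  ∑ v, weight D v • S.iterate η ω t v

/-- The average `(1 / W_T) ∑_{t < T} w_t ∑ v, (D_v / D) x^v_t` over nodes and slots, with
`W_T = ∑_{t < T} w_t`. -/
def timeAverage (w : ℕ → ℝ) (η : ℝ) (ω : Sampling T D) : Model d :=
  (1 / ∑ t ∈ Finset.range T, w t) • ∑ t ∈ Finset.range T, w t • S.nodeAverage η ω t

end Instance

/-! ### The rates -/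

/-- The rate for non-convex losses. -/
def nonconvexRate (F L A σ ζ ρ T : ℝ) : ℝ :=
  F * L * A / T + σ * √(ρ * L * F / T)
    + (L * F * √(σ ^ 2 * A + ζ ^ 2 * A ^ 2) / T) ^ (2 / 3 : ℝ)

/-- The rate for convex losses. -/
def convexRate (R L A σ ζ ρ T : ℝ) : ℝ :=
  R * L * A / T + σ * √(ρ * R / T)
    + (R * √(L * (σ ^ 2 * A + ζ ^ 2 * A ^ 2)) / T) ^ (2 / 3 : ℝ)

/-- The logarithmic factor in the rate for strongly convex losses. -/
def logFactor (R L A σ ζ ρ μ T : ℝ) : ℝ :=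
  Real.log (max 2
    (R / (ρ * σ ^ 2 / (μ * T) ^ 2 + L * (σ ^ 2 * A + ζ ^ 2 * A ^ 2) / (μ * T) ^ 3)))

/-- The rate for strongly convex losses, with its logarithmic factors. -/
def stronglyConvexRate (R L A σ ζ ρ μ T : ℝ) : ℝ :=
  R * L * A * Real.exp (-(μ * T / (30 * L * A)))
    + ρ * σ ^ 2 / (μ * T) * logFactor R L A σ ζ ρ μ T
    + L * (σ ^ 2 * A + ζ ^ 2 * A ^ 2) / (μ ^ 2 * T ^ 2) * logFactor R L A σ ζ ρ μ T ^ 2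

end

end Digest

namespace Digest

open Finset

/-! ### Clock representations of the local models -/

/-! The local models are compared with a virtual sequence that subtracts, at iteration `t`, `η`
times the weighted mean of all stochastic gradients of that iteration, without any delay. This
sequence is SGD on `f` with a perturbed gradient. The noises of different nodes and iterations are
orthogonal in expectation, so the mean noise of a step has second moment at most `ρσ²`. By
smoothness, the squared bias of its gradient is at most `L²` times the weighted mean squared
distance of the local models to the virtual one.

What is special to DIGEST is the bound on this distance. Unrolling the protocol shows that every
local model is `x₀` minus the weighted updates of each node `u` up to some slot, minus the node's
own updates made since its base model was stored (`Instance.exists_clock`). These slots, the clocks,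
are determined by the schedule alone and never by the samples. In the single-stream case an update
reaches another node once the circulating model has visited both, hence after at most `2H` slots. In
the multi-stream case the point is that when two streams meet at `v`, every node `u` lies behind `v`
as seen from at least one of them (`RootedTree.nearest_eq_or`). So each update enters a stream at
one place only, and the correction `base - last` carries exactly the news from elsewhere, without
double counting (`clockStep_valid`, `streamStep_follows`). An update climbs the tree and then
descends; every stream used on the way costs at most `2 * H m`, which gives a total of `4H'`
(`known_ancestor`, `multiClock_delay`).

Together with the lag `E`, the difference between a local model and the virtual one is `η` times a
sum of recent stochastic gradients with deterministic coefficients (`Instance.exists_deviation`). In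
its second moment the noise contributes order `σ²A` by orthogonality, and everything else is bounded
by Jensen, where diversity contributes order `ζ²A²`. The remaining part involves earlier distances
and is absorbed because `ηLA ≤ 1/30` (`Instance.Assumptions.sum_consensus_le`).

This is inserted into the one-step inequalities `Instance.Assumptions.descent` (non-convex) and
`Instance.Convex.contraction` (convex), which are telescoped. The result has the form `q/η + bη +
cη²`, with an exponentially damped first term under strong convexity, and `exists_rate` and
`exists_rate_exp` choose `η`. -/

/-- The sum of the local updates in the slots before `t`. -/
noncomputable def progress {d : ℕ} (η : ℝ) (lag : ℕ → ℕ) (g : ℕ → Model d) (t : ℕ) : Model d :=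
  ∑ s ∈ range t, ∑ z ∈ (range (s + 1)).filter (fun z => lag z = s), η • g z

theorem localStep_eq_sub {d : ℕ} (η : ℝ) (lag : ℕ → ℕ) (t : ℕ) (g : ℕ → Model d) (x : Model d) :
    localStep η lag t g x = x - (progress η lag g (t + 1) - progress η lag g t) := by
  simp [localStep, progress, sum_range_succ]

theorem localStep_congr {d : ℕ} (η : ℝ) (lag : ℕ → ℕ) (t : ℕ) {g g' : ℕ → Model d} (x : Model d)
    (h : ∀ z ≤ t, g z = g' z) : localStep η lag t g x = localStep η lag t g' x := by
  unfold localStep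
  congr 1
  refine sum_congr rfl fun z hz => ?_
  rw [h z (by simp at hz; omega)]

/-- Exchanging the sums turns the sum over slots of application into one over iterations of
computation. As no gradient is applied before it is computed, iterations `z ≥ c` contribute nothing,
so the range may be any `t ≥ c`; this gives all clocks a common index set. -/
theorem progress_eq_sum {d : ℕ} (η : ℝ) {lag : ℕ → ℕ} (g : ℕ → Model d) {T t c : ℕ}
    (hlag : ∀ z < T, z ≤ lag z) (ht : t ≤ T) (hc : c ≤ t) :
    progress η lag g c = ∑ z ∈ range t, if lag z < c then η • g z else 0 := by
  have h1 : progress η lag g c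
      = ∑ s ∈ range c, ∑ z ∈ range t, if lag z = s then η • g z else 0 := by
    refine sum_congr rfl fun s hs => ?_
    rw [← sum_filter]
    refine sum_congr ?_ fun _ _ => rfl
    ext z
    simp only [mem_filter, mem_range] at hs ⊢
    constructor
    · rintro ⟨h1, h2⟩
      exact ⟨by omega, h2⟩
    · rintro ⟨h1, h2⟩
      have := hlag z (by omega)
      exact ⟨by omega, h2⟩
  rw [h1, sum_comm]
  refine sum_congr rfl fun z _ => ?_
  rw [sum_ite_eq]
  simp

/-- The model that contains the updates of every node `u` in the slots before `c u`, with
weight `p u`. -/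
noncomputable def mix {d V : ℕ} (p : Fin V → ℝ) (x₀ : Model d) (Q : Fin V → ℕ → Model d)
    (c : Fin V → ℕ) : Model d :=
  x₀ - ∑ u, p u • Q u (c u)

/-! #### Single-stream DIGEST -/

/-- The slots up to which the base model of each node, and the circulating model, contain the
updates of each node. -/
def singleClock {V : ℕ} (visit : ℕ → Option (Fin V)) : ℕ → (Fin V → Fin V → ℕ) × (Fin V → ℕ)
  | 0 => (fun _ _ => 0, fun _ => 0)
  | t + 1 =>
    let s := singleClock visit t
    match visit (t + 1) with
    | none => s
    | some v => (Function.update s.1 v (Function.update s.2 v (t + 1)),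
        Function.update s.2 v (t + 1))

theorem mix_update {d V : ℕ} (p : Fin V → ℝ) (x₀ : Model d) (Q : Fin V → ℕ → Model d)
    (c : Fin V → ℕ) (v : Fin V) (n : ℕ) :
    mix p x₀ Q (Function.update c v n) = mix p x₀ Q c - p v • (Q v n - Q v (c v)) := by
  have : ∑ u, p u • Q u (Function.update c v n u)
      = ∑ u, p u • Q u (c u) + p v • (Q v n - Q v (c v)) := by
    rw [← sub_eq_iff_eq_add', ← sum_sub_distrib, sum_eq_single v]
    · simp [smul_sub]
    · intro u _ hu
      simp [Function.update_of_ne hu]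
    · simp
  unfold mix
  rw [this]
  abel

theorem singleRun_grad {d V : ℕ} (p : Fin V → ℝ) (x₀ : Model d) (η : ℝ) (lag : Fin V → ℕ → ℕ)
    (visit : ℕ → Option (Fin V)) (G : ℕ → Fin V → Model d → Model d) (t : ℕ) (v : Fin V) :
    ∀ z < t, (singleRun p x₀ η lag visit G t).grad v z
      = G z v ((singleRun p x₀ η lag visit G z).x v) := by
  induction t with
  | zero => simp
  | succ t ih =>
    intro z hz
    have : (singleRun p x₀ η lag visit G (t + 1)).grad v z = Function.update
        ((singleRun p x₀ η lag visit G t).grad v) t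
        (G t v ((singleRun p x₀ η lag visit G t).x v)) z := by
      rw [singleRun]
      rcases visit (t + 1) <;> rfl
    rw [this]
    rcases eq_or_ne z t with rfl | h
    · simp
    · rw [Function.update_of_ne h, ih z (by omega)]

/-- The invariant behind the single-stream clocks. The last clause holds because the circulating
model changes its entry for `v` only at visits to `v`, when the base of `v` is reset to it; hence a
visit adds exactly the updates of `v` that are still missing. -/
theorem singleRun_invariant {d V : ℕ} (p : Fin V → ℝ) (x₀ : Model d) (η : ℝ)
    (lag : Fin V → ℕ → ℕ) (visit : ℕ → Option (Fin V)) (G : ℕ → Fin V → Model d → Model d)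
    (Q : Fin V → ℕ → Model d)
    (hQ : ∀ v, Q v = progress η (lag v) fun z => G z v ((singleRun p x₀ η lag visit G z).x v))
    (t : ℕ) :
    let s := singleRun p x₀ η lag visit G t
    let k := singleClock visit t
    (∀ v, s.base v = mix p x₀ Q (k.1 v)) ∧ s.glob = mix p x₀ Q k.2 ∧
      (∀ v, s.x v = s.base v - (Q v t - Q v (k.1 v v))) ∧ ∀ v, k.1 v v = k.2 v := by
  induction t with
  | zero =>
    have h0 : ∀ v, Q v 0 = 0 := fun v => by rw [hQ]; simp [progress]
    simp [singleRun, singleClock, mix, h0]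
  | succ t ih =>
    obtain ⟨hb, hg, hx, hk⟩ := ih
    have hy : ∀ v, localStep η (lag v) t (Function.update
        ((singleRun p x₀ η lag visit G t).grad v) t (G t v ((singleRun p x₀ η lag visit G t).x v)))
        ((singleRun p x₀ η lag visit G t).x v)
        = (singleRun p x₀ η lag visit G t).base v
          - (Q v (t + 1) - Q v ((singleClock visit t).1 v v)) := by
      intro v
      rw [localStep_congr (g' := fun z => G z v ((singleRun p x₀ η lag visit G z).x v)),
        localStep_eq_sub, ← hQ, hx v]
      · abel
      · intro z hz
        rcases eq_or_ne z t with rfl | h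
        · simp
        · rw [Function.update_of_ne h, singleRun_grad _ _ _ _ _ _ _ _ _ (by omega)]
    rw [singleRun, singleClock]
    rcases visit (t + 1) with _ | v
    · exact ⟨hb, hg, hy, hk⟩
    · have hglob : (singleRun p x₀ η lag visit G t).glob
          + p v • ((singleRun p x₀ η lag visit G t).base v
          - (Q v (t + 1) - Q v ((singleClock visit t).1 v v))
            - (singleRun p x₀ η lag visit G t).base v)
          = mix p x₀ Q (Function.update (singleClock visit t).2 v (t + 1)) := by
        -- The base model cancels from the increment, and by `hk` the update of the entry of `v`
        -- starts from the slot at which its base clock stands.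
        rw [hg, mix_update, hk]
        module
      simp only [hy, hglob]
      refine ⟨fun w => ?_, trivial, fun w => ?_, fun w => ?_⟩
      · rcases eq_or_ne w v with rfl | h
        · simp
        · simp [Function.update_of_ne h, hb]
      · rcases eq_or_ne w v with rfl | h
        · simp
        · simp [Function.update_of_ne h]
      · rcases eq_or_ne w v with rfl | h
        · simp
        · simp [Function.update_of_ne h, hk]

theorem singleClock_le {V : ℕ} (visit : ℕ → Option (Fin V)) (t : ℕ) :
    (∀ v u, (singleClock visit t).1 v u ≤ t) ∧ ∀ u, (singleClock visit t).2 u ≤ t := by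
  induction t with
  | zero => simp [singleClock]
  | succ t ih =>
    rw [singleClock]
    rcases visit (t + 1) with _ | v
    · exact ⟨fun v u => (ih.1 v u).trans (by omega), fun u => (ih.2 u).trans (by omega)⟩
    · have h2 : ∀ u, Function.update (singleClock visit t).2 v (t + 1) u ≤ t + 1 := by
        intro u
        rcases eq_or_ne u v with rfl | h
        · simp
        · rw [Function.update_of_ne h]; exact (ih.2 u).trans (by omega)
      refine ⟨fun w u => ?_, h2⟩
      rcases eq_or_ne w v with rfl | h
      · simpa using h2 u
      · simp only [Function.update_of_ne h]; exact (ih.1 w u).trans (by omega)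

theorem singleClock_mono {V : ℕ} (visit : ℕ → Option (Fin V)) (u : Fin V) :
    Monotone fun t => (singleClock visit t).2 u := by
  refine monotone_nat_of_le_succ fun t => ?_
  have := (singleClock_le visit t).2 u
  rw [singleClock]
  rcases visit (t + 1) with _ | v
  · exact le_rfl
  · rcases eq_or_ne u v with rfl | h
    · simp only [Function.update_self]; omega
    · simp [Function.update_of_ne h]

theorem singleClock_visit {V : ℕ} {visit : ℕ → Option (Fin V)} {t : ℕ} {v : Fin V} (ht : 0 < t)
    (hv : visit t = some v) :
    (singleClock visit t).1 v = (singleClock visit t).2 ∧ (singleClock visit t).2 v = t := by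
  obtain ⟨t, rfl⟩ := Nat.exists_eq_succ_of_ne_zero ht.ne'
  rw [singleClock, hv]
  simp

theorem singleClock_base_mono {V : ℕ} (visit : ℕ → Option (Fin V)) (v u : Fin V) :
    (∀ t, (singleClock visit t).1 v u ≤ (singleClock visit t).2 u) ∧
    Monotone fun t => (singleClock visit t).1 v u := by
  have h1 : ∀ t, (singleClock visit t).1 v u ≤ (singleClock visit t).2 u := by
    intro t
    induction t with
    | zero => simp [singleClock]
    | succ t ih =>
      have := (singleClock_le visit t).2 u
      rw [singleClock]
      rcases visit (t + 1) with _ | w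
      · exact ih
      · rcases eq_or_ne v w with rfl | h
        · simp
        · simp only [Function.update_of_ne h]
          rcases eq_or_ne u w with rfl | h'
          · simp only [Function.update_self]; omega
          · simpa [Function.update_of_ne h'] using ih
  refine ⟨h1, monotone_nat_of_le_succ fun t => ?_⟩
  have := h1 t
  have := (singleClock_le visit t).2 u
  rw [singleClock]
  rcases visit (t + 1) with _ | w
  · exact le_rfl
  · rcases eq_or_ne v w with rfl | h
    · rcases eq_or_ne u v with rfl | h'
      · simp only [Function.update_self]; omega
      · simpa [Function.update_of_ne h']
    · simp [Function.update_of_ne h]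

theorem GapLE.exists_visit {T H : ℕ} {s : ℕ → Prop} (h : GapLE T H s) {t : ℕ} (ht : t ≤ T)
    (hH : H ≤ t) : ∃ u, t < u + H ∧ u ≤ t ∧ 0 < u ∧ s u := by
  obtain ⟨u, h1, h2, h3⟩ := h (t - H) (by omega)
  exact ⟨u, by omega, by omega, by omega, h3⟩

/-- At its latest visit to `v`, at most `H` slots ago, the circulating model had itself visited `u`
at most `H` slots earlier. Before slot `H` there need not have been any visit, but then the bound is
trivial. -/
theorem singleClock_delay {V T H : ℕ} {visit : ℕ → Option (Fin V)}
    (h : ∀ v, GapLE T H (fun t => visit t = some v)) {t : ℕ} (ht : t ≤ T) (v u : Fin V) :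
    t ≤ (singleClock visit t).1 v u + 2 * H ∧ t ≤ (singleClock visit t).1 v v + H := by
  have hJ : ∀ s ≤ T, s ≤ (singleClock visit s).2 u + H := by
    intro s hs
    rcases le_total s H with hH | hH
    · omega
    · obtain ⟨a, h1, h2, h3, h4⟩ := (h u).exists_visit hs hH
      have := (singleClock_visit h3 h4).2
      have := singleClock_mono visit u h2
      simp only at this
      omega
  rcases le_total t H with hH | hH
  · omega
  obtain ⟨a, h1, h2, h3, h4⟩ := (h v).exists_visit ht hH
  have e := singleClock_visit h3 h4
  have m1 := (singleClock_base_mono visit v u).2 h2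
  have m2 := (singleClock_base_mono visit v v).2 h2
  have := hJ a (by omega)
  simp only [e.1, e.2] at m1 m2
  omega

/-! ### Streams of a rooted tree -/

namespace RootedTree

variable {V : ℕ} (τ : RootedTree V)

open Classical in
/-- The distance of a node to the root. -/
noncomputable def depth (v : Fin V) : ℕ := Nat.find (τ.reaches_root v)

theorem depth_eq_zero {v : Fin V} : τ.depth v = 0 ↔ v = τ.root := by
  simp [depth]

theorem depth_parent (v : Fin V) : τ.depth (τ.parent v) = τ.depth v - 1 := by
  classical
  rcases eq_or_ne v τ.root with rfl | h
  · rw [τ.parent_root, τ.depth_eq_zero.2 rfl]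
  · have hpos : τ.depth v ≠ 0 := fun h0 => h (τ.depth_eq_zero.1 h0)
    obtain ⟨n, hn⟩ := Nat.exists_eq_succ_of_ne_zero hpos
    rw [hn]
    have h1 : τ.parent^[n + 1] v = τ.root := by
      have := Nat.find_spec (τ.reaches_root v)
      rw [show Nat.find (τ.reaches_root v) = n + 1 from hn] at this
      exact this
    simp only [Nat.succ_eq_add_one, Nat.add_sub_cancel]
    unfold depth
    rw [Nat.find_eq_iff]
    refine ⟨by rwa [Function.iterate_succ_apply] at h1, fun k hk hk' => ?_⟩
    rw [← Function.iterate_succ_apply] at hk'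
    exact Nat.find_min (τ.reaches_root v) (m := k + 1)
      (by change k + 1 < τ.depth v; omega) hk'

theorem depth_iterate (k : ℕ) (v : Fin V) : τ.depth (τ.parent^[k] v) = τ.depth v - k := by
  induction k with
  | zero => simp
  | succ k ih => rw [Function.iterate_succ_apply', depth_parent, ih]; omega

theorem depth_pos {v : Fin V} (h : v ≠ τ.root) : 0 < τ.depth v :=
  Nat.pos_of_ne_zero fun h0 => h (τ.depth_eq_zero.1 h0)

variable {τ} {m m' u v w : Fin V}

/-- The stream of an edge is named after the last node before the first branching one on the way up,
and this node is determined by the edge. -/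
theorem EdgeInStream.unique (h : τ.EdgeInStream m w) (h' : τ.EdgeInStream m' w) : m = m' := by
  obtain ⟨⟨_, hm⟩, _, k, hk, hj⟩ := h
  obtain ⟨⟨_, hm'⟩, _, k', hk', hj'⟩ := h'
  rcases lt_trichotomy k k' with hlt | rfl | hlt
  · refine absurd hm ?_
    rw [← hk, ← Function.iterate_succ_apply' τ.parent]
    exact hj' _ (by omega) (by omega)
  · rw [← hk, ← hk']
  · refine absurd hm' ?_
    rw [← hk', ← Function.iterate_succ_apply' τ.parent]
    exact hj _ (by omega) (by omega)

theorem exists_edgeInStream (h : w ≠ τ.root) : ∃ m, τ.EdgeInStream m w := by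
  classical
  have hex : ∃ k, τ.IsBranching (τ.parent^[k + 1] w) := by
    refine ⟨τ.depth w, Or.inl ?_⟩
    rw [← depth_eq_zero, depth_iterate]
    omega
  refine ⟨τ.parent^[Nat.find hex] w, ⟨?_, ?_⟩, h, Nat.find hex, rfl, fun j h1 hj => ?_⟩
  · intro h0
    rcases Nat.eq_zero_or_pos (Nat.find hex) with h1 | h1
    · rw [h1] at h0; exact h h0
    · refine Nat.find_min hex (m := Nat.find hex - 1) (by omega) (Or.inl ?_)
      rw [Nat.sub_add_cancel h1, h0]
  · rw [← Function.iterate_succ_apply' τ.parent]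
    exact Nat.find_spec hex
  · have := Nat.find_min hex (m := j - 1) (by omega)
    rwa [Nat.sub_add_cancel h1] at this

theorem IsStream.edgeInStream (h : τ.IsStream m) : τ.EdgeInStream m m :=
  ⟨h, h.1, 0, rfl, fun j h1 h2 => by omega⟩

/-- Going up from an edge of a stream, one stays in the range of the stream. -/
theorem EdgeInStream.inRange_parent (h : τ.EdgeInStream m w) : τ.InRange m (τ.parent w) := by
  obtain ⟨hm, hw, k, hk, hj⟩ := h
  rcases Nat.eq_zero_or_pos k with rfl | hpos
  · exact ⟨hm, Or.inl (by rw [← hk]; rfl)⟩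
  · refine ⟨hm, Or.inr ⟨hm, fun h0 => ?_, k - 1, ?_, fun j h1 h2 => ?_⟩⟩
    · exact hj 1 le_rfl hpos (Or.inl (by simpa using h0))
    · rw [← Function.iterate_succ_apply, Nat.succ_eq_add_one, Nat.sub_add_cancel hpos, hk]
    · rw [← Function.iterate_succ_apply]
      exact hj _ (by omega) (by omega)

/-- An inner node of a stream is not branching. -/
theorem EdgeInStream.not_isBranching (h : τ.EdgeInStream m w) {j : ℕ} (hj : 1 ≤ j)
    (h' : τ.EdgeInStream m (τ.parent^[j] w)) : ¬ τ.IsBranching (τ.parent^[j] w) := by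
  obtain ⟨hm, hw, k, hk, hb⟩ := h
  obtain ⟨_, hw', i, hi, _⟩ := h'
  have h1 := τ.depth_pos hm.1
  rw [← Function.iterate_add_apply] at hi
  have h2 := τ.depth_iterate k w
  have h3 := τ.depth_iterate (i + j) w
  rw [hk] at h2
  rw [hi] at h3
  exact hb j hj (by omega)

theorem not_edgeInStream_above (hm : τ.IsStream m) (k : ℕ) :
    ¬ τ.EdgeInStream m (τ.parent^[k] (τ.parent m)) := by
  rintro ⟨_, _, i, hi, _⟩
  have h1 := τ.depth_pos hm.1
  have h2 := τ.depth_iterate (i + k + 1) m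
  rw [Function.iterate_add_apply, Function.iterate_add_apply, Function.iterate_one, hi] at h2
  omega

open Classical in
/-- The node of the range of the stream `m` that is nearest to `u`. -/
noncomputable def nearest (τ : RootedTree V) (m u : Fin V) : Fin V :=
  if h : ∃ k : ℕ, τ.EdgeInStream m (τ.parent^[k] u) then τ.parent^[Nat.find h] u else τ.parent m

theorem nearest_of_inRange (h : τ.InRange m u) : τ.nearest m u = u := by
  classical
  unfold nearest
  rcases h with ⟨hm, rfl | h⟩
  · rw [dif_neg]
    rintro ⟨k, hk⟩
    exact not_edgeInStream_above hm k hk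
  · have hex : ∃ k : ℕ, τ.EdgeInStream m (τ.parent^[k] u) := ⟨0, h⟩
    rw [dif_pos hex, (Nat.find_eq_zero hex).2 h]
    rfl

/-- Here `m` ends at `v` and `m'` starts there. A node below an edge of `m'` has `v` on its way to
the root and meets `m` first at `v`; any other node is seen by `m'` at its top, which is `v`. -/
theorem nearest_eq_of_edgeInStream (h : τ.EdgeInStream m v) (h' : τ.IsStream m')
    (hv : v = τ.parent m') (u : Fin V) : τ.nearest m u = v ∨ τ.nearest m' u = v := by
  classical
  by_cases hex' : ∃ k : ℕ, τ.EdgeInStream m' (τ.parent^[k] u)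
  · left
    obtain ⟨k, _, _, i, hi, _⟩ := hex'
    have hu : τ.parent^[i + k + 1] u = v := by
      rw [add_comm, Function.iterate_add_apply, Function.iterate_add_apply, hi, hv,
        Function.iterate_one]
    have hex : ∃ k : ℕ, τ.EdgeInStream m (τ.parent^[k] u) := ⟨_, by rw [hu]; exact h⟩
    unfold nearest
    rw [dif_pos hex]
    have hle : Nat.find hex ≤ i + k + 1 := Nat.find_min' hex (by rw [hu]; exact h)
    rcases hle.eq_or_lt with heq | hlt
    · rw [heq, hu]
    · exfalso
      have e : τ.parent^[i + k + 1 - Nat.find hex] (τ.parent^[Nat.find hex] u) = v := by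
        rw [← Function.iterate_add_apply, Nat.sub_add_cancel hle, hu]
      -- Entering `m` strictly below `v` would make `v` an inner node of `m`, yet `v` creates `m'`
      -- and is therefore branching.
      refine (Nat.find_spec hex).not_isBranching (j := i + k + 1 - Nat.find hex) (by omega) ?_ ?_
      · rw [e]; exact h
      · rw [e, hv]; exact h'.2
  · right
    unfold nearest
    rw [dif_neg hex', hv]

/-- If two streams meet at `v`, then every node is, seen from one of them, behind `v`. -/
theorem nearest_eq_or (h : τ.InRange m v) (h' : τ.InRange m' v) (hne : m ≠ m') (u : Fin V) :
    τ.nearest m u = v ∨ τ.nearest m' u = v := by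
  classical
  obtain ⟨hm, h | h⟩ := h
  · obtain ⟨hm', h' | h'⟩ := h'
    · by_contra hcon
      push Not at hcon
      have key : ∀ n, v = τ.parent n → τ.nearest n u ≠ v →
          ∃ k, τ.parent^[k] u = n := by
        intro n hn hcon
        by_cases hex : ∃ k : ℕ, τ.EdgeInStream n (τ.parent^[k] u)
        · obtain ⟨k, _, _, i, hi, _⟩ := hex
          exact ⟨i + k, by rw [Function.iterate_add_apply, hi]⟩
        · unfold nearest at hcon
          rw [dif_neg hex] at hcon
          exact absurd hn.symm hcon
      obtain ⟨k, hk⟩ := key m h hcon.1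
      obtain ⟨k', hk'⟩ := key m' h' hcon.2
      have h1 := τ.depth_pos hm.1
      have h2 := τ.depth_pos hm'.1
      have h3 := τ.depth_parent m
      have h4 := τ.depth_parent m'
      rw [← h] at h3
      rw [← h'] at h4
      have h5 := τ.depth_iterate k u
      have h6 := τ.depth_iterate k' u
      rw [hk] at h5
      rw [hk'] at h6
      -- Both `m` and `m'` are now ancestors of `u`, and as children of `v` they have the same
      -- depth, so they coincide.
      have : k = k' := by omega
      subst this
      exact hne (hk.symm.trans hk')
    · exact (nearest_eq_of_edgeInStream h' hm h u).symm
  · obtain ⟨hm', h' | h'⟩ := h'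
    · exact nearest_eq_of_edgeInStream h hm' h' u
    · exact absurd (h.unique h') hne

/-- Every node of a tree with more than one node is in the range of a stream. -/
theorem exists_inRange (hV : 1 < V) (v : Fin V) : ∃ m, τ.InRange m v := by
  rcases eq_or_ne v τ.root with rfl | h
  · have : Nontrivial (Fin V) := Fin.nontrivial_iff_two_le.2 hV
    obtain ⟨w, hw⟩ := exists_ne τ.root
    have hd := τ.depth_pos hw
    have h1 : τ.parent^[τ.depth w] w = τ.root := by
      rw [← depth_eq_zero, depth_iterate]; omega
    have h2 : τ.parent^[τ.depth w - 1] w ≠ τ.root := by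
      rw [Ne, ← depth_eq_zero, depth_iterate]; omega
    have h3 : τ.parent (τ.parent^[τ.depth w - 1] w) = τ.root := by
      rw [← Function.iterate_succ_apply' τ.parent, Nat.succ_eq_add_one, Nat.sub_add_cancel hd, h1]
    exact ⟨_, ⟨h2, Or.inl h3⟩, Or.inl h3.symm⟩
  · obtain ⟨m, hm⟩ := exists_edgeInStream h
    exact ⟨m, hm.1, Or.inr hm⟩

theorem InRange.exists_mem_pathStreams (h : τ.InRange m v) : ∃ w, m ∈ τ.pathStreams w := by
  classical
  exact ⟨m, by simpa [pathStreams] using ⟨0, h.1.edgeInStream⟩⟩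

end RootedTree

/-! ### Clocks of multi-stream DIGEST -/

/-- The slots up to which the models of multi-stream DIGEST contain the updates of each node. -/
structure MultiClock (V : ℕ) where
  base : Fin V → Fin V → ℕ
  glob : Fin V → Fin V → ℕ
  last : Fin V → Fin V → Fin V → ℕ

/-- The effect of the global update of stream `m` at the node `o` in slot `now` on the clocks. -/
def clockStep {V : ℕ} (near : Fin V → Fin V → Fin V) (now : ℕ) (m : Fin V)
    (o : Option (Fin V)) (k : MultiClock V) : MultiClock V :=
  match o with
  | none => k
  | some v =>
    let n : Fin V → ℕ := fun u => if u = v then now else if near m u = v then k.base v u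
      else k.glob m u
    { base := Function.update k.base v n
      glob := Function.update k.glob m n
      last := Function.update k.last m (Function.update (k.last m) v n) }

/-- The clocks of multi-stream DIGEST. -/
def multiClock {V : ℕ} (near : Fin V → Fin V → Fin V) (visit : Fin V → ℕ → Option (Fin V)) :
    ℕ → MultiClock V
  | 0 => ⟨fun _ _ => 0, fun _ _ => 0, fun _ _ _ => 0⟩
  | t + 1 => (List.finRange V).foldl (fun k m => clockStep near (t + 1) m (visit m (t + 1)) k)
      (multiClock near visit t)

/-- The relations between the clocks. -/
structure MultiClock.Valid {V : ℕ} (τ : RootedTree V) (now : ℕ) (k : MultiClock V) : Prop where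
  base_le : ∀ v u, k.base v u ≤ now
  glob_le : ∀ m u, k.glob m u ≤ now
  last_le_base : ∀ m v u, k.last m v u ≤ k.base v u
  last_le_glob : ∀ m v u, k.last m v u ≤ k.glob m u
  glob_eq : ∀ m v u, τ.InRange m v → τ.nearest m u = v → k.glob m u = k.last m v u
  base_eq : ∀ m v u, τ.InRange m v → τ.nearest m u ≠ v → k.base v u = k.last m v u

theorem MultiClock.Valid.mono {V : ℕ} {τ : RootedTree V} {now now' : ℕ} {k : MultiClock V}
    (h : k.Valid τ now) (hn : now ≤ now') : k.Valid τ now' :=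
  { h with
    base_le := fun v u => (h.base_le v u).trans hn
    glob_le := fun v u => (h.glob_le v u).trans hn }

/-- The two equalities in `Valid` express that information flows one way: stream `m` hears of a node
`u` behind `v` only at `v` itself, while `v` hears of any other `u` only from `m`. A visit therefore
takes the entry of `u` from the side that is nearer to `u`, and this choice never moves a clock
back. -/
theorem clockStep_valid {V : ℕ} {τ : RootedTree V} {now : ℕ} {k : MultiClock V} {m : Fin V}
    {o : Option (Fin V)} (h : k.Valid τ now) (ho : ∀ v, o = some v → τ.InRange m v) :
    (clockStep τ.nearest now m o k).Valid τ now ∧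
    (∀ v u, k.base v u ≤ (clockStep τ.nearest now m o k).base v u) ∧
    ∀ n u, k.glob n u ≤ (clockStep τ.nearest now m o k).glob n u := by
  rcases o with _ | v
  · exact ⟨h, fun _ _ => le_rfl, fun _ _ => le_rfl⟩
  have hv := ho v rfl
  set n : Fin V → ℕ := fun u => if u = v then now else if τ.nearest m u = v then k.base v u
      else k.glob m u with hn
  have hstep : clockStep τ.nearest now m (some v) k = ⟨Function.update k.base v n,
    Function.update k.glob m n, Function.update k.last m (Function.update (k.last m) v n)⟩ := rfl
  have n_le : ∀ u, n u ≤ now := by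
    intro u
    simp only [hn]
    split_ifs
    exacts [le_rfl, h.base_le _ _, h.glob_le _ _]
  have base_n : ∀ u, k.base v u ≤ n u := by
    intro u
    simp only [hn]
    split_ifs with h1 h2
    · exact h.base_le _ _
    · exact le_rfl
    · rw [h.base_eq m v u hv h2]; exact h.last_le_glob _ _ _
  have glob_n : ∀ u, k.glob m u ≤ n u := by
    intro u
    simp only [hn]
    split_ifs with h1 h2
    · exact h.glob_le _ _
    · rw [h.glob_eq m v u hv h2]; exact h.last_le_base _ _ _
    · exact le_rfl
  rw [hstep]
  have mono_base : ∀ w u, k.base w u ≤ Function.update k.base v n w u := by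
    intro w u
    rcases eq_or_ne w v with rfl | hw
    · simpa using base_n u
    · simp [Function.update_of_ne hw]
  have mono_glob : ∀ w u, k.glob w u ≤ Function.update k.glob m n w u := by
    intro w u
    rcases eq_or_ne w m with rfl | hw
    · simpa using glob_n u
    · simp [Function.update_of_ne hw]
  refine ⟨⟨fun w u => ?_, fun w u => ?_, fun a w u => ?_, fun a w u => ?_, fun a w u ha hu => ?_,
    fun a w u ha hu => ?_⟩, mono_base, mono_glob⟩
  · rcases eq_or_ne w v with rfl | hw
    · simpa using n_le u
    · simpa [Function.update_of_ne hw] using h.base_le w u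
  · rcases eq_or_ne w m with rfl | hw
    · simpa using n_le u
    · simpa [Function.update_of_ne hw] using h.glob_le w u
  · rcases eq_or_ne a m with rfl | hm
    · rcases eq_or_ne w v with rfl | hw
      · simp
      · simpa [Function.update_of_ne hw] using h.last_le_base a w u
    · simpa only [Function.update_of_ne hm] using (h.last_le_base a w u).trans (mono_base w u)
  · rcases eq_or_ne a m with rfl | hm
    · rcases eq_or_ne w v with rfl | hw
      · simp
      · simpa [Function.update_of_ne hw] using (h.last_le_glob a w u).trans (glob_n u)
    · simpa only [Function.update_of_ne hm] using h.last_le_glob a w u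
  · rcases eq_or_ne a m with rfl | hm
    · rcases eq_or_ne w v with rfl | hw
      · simp
      · have huv : u ≠ v := by
          rintro rfl
          rw [RootedTree.nearest_of_inRange hv] at hu
          exact hw hu.symm
        have : n u = k.glob a u := by
          simp only [hn]
          rw [if_neg huv, if_neg (by rw [hu]; exact hw)]
        simpa [Function.update_of_ne hw, this] using h.glob_eq a w u ha hu
    · simpa only [Function.update_of_ne hm] using h.glob_eq a w u ha hu
  · rcases eq_or_ne a m with rfl | hm
    · rcases eq_or_ne w v with rfl | hw
      · simp
      · simpa [Function.update_of_ne hw] using h.base_eq a w u ha hu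
    · rcases eq_or_ne w v with rfl | hw
      · have huv : u ≠ w := by
          rintro rfl
          exact hu (RootedTree.nearest_of_inRange ha)
        -- The case where two streams interact. A visit of `m` must not bring to `w` news about a
        -- node that `w` is to hear of through `a`. Since `u` is not behind `w` for `a`, it is
        -- behind `w` for `m`, and its entry stays.
        have : n u = k.base w u := by
          simp only [hn]
          rw [if_neg huv, if_pos]
          exact (RootedTree.nearest_eq_or ha hv hm u).resolve_left hu
        simpa [Function.update_of_ne hm, this] using h.base_eq a w u ha hu
      · simpa [Function.update_of_ne hw, Function.update_of_ne hm] using h.base_eq a w u ha hu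

theorem foldl_clockStep_valid {V : ℕ} {τ : RootedTree V} {now : ℕ} {o : Fin V → Option (Fin V)}
    (ho : ∀ m v, o m = some v → τ.InRange m v) (l : List (Fin V)) {k : MultiClock V}
    (h : k.Valid τ now) :
    (l.foldl (fun k m => clockStep τ.nearest now m (o m) k) k).Valid τ now ∧
    (∀ v u, k.base v u ≤ (l.foldl (fun k m => clockStep τ.nearest now m (o m) k) k).base v u) ∧
    ∀ n u, k.glob n u ≤ (l.foldl (fun k m => clockStep τ.nearest now m (o m) k) k).glob n u := by
  induction l generalizing k with
  | nil => exact ⟨h, fun _ _ => le_rfl, fun _ _ => le_rfl⟩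
  | cons m l ih =>
    obtain ⟨h1, h2, h3⟩ := clockStep_valid h (ho m)
    obtain ⟨h4, h5, h6⟩ := ih h1
    exact ⟨h4, fun v u => (h2 v u).trans (h5 v u), fun v u => (h3 v u).trans (h6 v u)⟩

/-- Streams processed before or after `m` in the same slot can only advance the clocks, so the
transfer made by `m` survives as an inequality whatever the order of processing. -/
theorem foldl_clockStep_visit {V : ℕ} {τ : RootedTree V} {now : ℕ} {o : Fin V → Option (Fin V)}
    (ho : ∀ m v, o m = some v → τ.InRange m v) {l : List (Fin V)} {k : MultiClock V}
    (h : k.Valid τ now) {m v : Fin V} (hm : m ∈ l) (hv : o m = some v) (u : Fin V) :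
    let k' := l.foldl (fun k m => clockStep τ.nearest now m (o m) k) k
    (u = v → now ≤ k'.base v u ∧ now ≤ k'.glob m u) ∧
    (τ.nearest m u = v → k.base v u ≤ k'.glob m u) ∧
    (τ.nearest m u ≠ v → k.glob m u ≤ k'.base v u) := by
  obtain ⟨l₁, l₂, rfl⟩ := List.append_of_mem hm
  intro k'
  have hk' : k' = l₂.foldl (fun k m => clockStep τ.nearest now m (o m) k)
      (clockStep τ.nearest now m (o m)
        (l₁.foldl (fun k m => clockStep τ.nearest now m (o m) k) k)) := by
    simp [k', List.foldl_append]
  obtain ⟨a1, a2, a3⟩ := foldl_clockStep_valid ho l₁ h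
  set k₁ := l₁.foldl (fun k m => clockStep τ.nearest now m (o m) k) k
  obtain ⟨b1, -, -⟩ := clockStep_valid a1 (ho m)
  obtain ⟨-, c2, c3⟩ := foldl_clockStep_valid ho l₂ b1
  rw [← hk'] at c2 c3
  set n : ℕ := if u = v then now else if τ.nearest m u = v then k₁.base v u
      else k₁.glob m u with hn
  have e1 : n ≤ k'.base v u := by
    refine le_trans (le_of_eq ?_) (c2 v u)
    rw [hv]
    simp [clockStep, hn]
  have e2 : n ≤ k'.glob m u := by
    refine le_trans (le_of_eq ?_) (c3 m u)
    rw [hv]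
    simp [clockStep, hn]
  refine ⟨fun hu => ?_, fun hu => ?_, fun hu => ?_⟩
  · rw [hn, if_pos hu] at e1 e2
    exact ⟨e1, e2⟩
  · refine (a2 v u).trans (le_trans ?_ e2)
    rw [hn]
    split_ifs
    exacts [a1.base_le _ _, le_rfl]
  · refine (a3 m u).trans (le_trans ?_ e1)
    rw [hn]
    split_ifs
    exacts [a1.glob_le _ _, le_rfl]

/-! ### Monotonicity of the multi-stream clocks and the delay of a node's own updates -/

section Delay

variable {V : ℕ} {τ : RootedTree V} {visit : Fin V → ℕ → Option (Fin V)}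

theorem multiClock_valid (ho : ∀ m t v, visit m t = some v → τ.InRange m v) (t : ℕ) :
    (multiClock τ.nearest visit t).Valid τ t := by
  induction t with
  | zero => constructor <;> simp [multiClock]
  | succ t ih =>
    exact (foldl_clockStep_valid (fun m v => ho m (t + 1) v) _ (ih.mono (Nat.le_succ t))).1

theorem multiClock_base_mono (ho : ∀ m t v, visit m t = some v → τ.InRange m v) (v u : Fin V) :
    Monotone fun t => (multiClock τ.nearest visit t).base v u :=
  monotone_nat_of_le_succ fun t => (foldl_clockStep_valid (fun m v => ho m (t + 1) v) _
    ((multiClock_valid ho t).mono (Nat.le_succ t))).2.1 v u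

theorem multiClock_glob_mono (ho : ∀ m t v, visit m t = some v → τ.InRange m v) (m u : Fin V) :
    Monotone fun t => (multiClock τ.nearest visit t).glob m u :=
  monotone_nat_of_le_succ fun t => (foldl_clockStep_valid (fun m v => ho m (t + 1) v) _
    ((multiClock_valid ho t).mono (Nat.le_succ t))).2.2 m u

theorem multiClock_visit (ho : ∀ m t v, visit m t = some v → τ.InRange m v) {t : ℕ}
    {m v : Fin V} (hv : visit m (t + 1) = some v) (u : Fin V) :
    let k := multiClock τ.nearest visit t
    let k' := multiClock τ.nearest visit (t + 1)
    (u = v → t + 1 ≤ k'.base v u ∧ t + 1 ≤ k'.glob m u) ∧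
    (τ.nearest m u = v → k.base v u ≤ k'.glob m u) ∧
    (τ.nearest m u ≠ v → k.glob m u ≤ k'.base v u) :=
  foldl_clockStep_visit (fun m v => ho m (t + 1) v) ((multiClock_valid ho t).mono (Nat.le_succ t))
    (List.mem_finRange m) hv u

theorem multiClock_own_delay {T : ℕ} {H : Fin V → ℕ}
    (ho : ∀ m t v, visit m t = some v → τ.InRange m v)
    (hgap : ∀ m v, τ.InRange m v → GapLE T (H m) (fun t => visit m t = some v))
    {m v : Fin V} (hv : τ.InRange m v) {t : ℕ} (ht : t ≤ T) :
    t ≤ (multiClock τ.nearest visit t).base v v + H m := by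
  rcases le_total t (H m) with hH | hH
  · omega
  obtain ⟨s, h1, h2, h3, h4⟩ := (hgap m v hv).exists_visit ht hH
  obtain ⟨s, rfl⟩ := Nat.exists_eq_succ_of_ne_zero h3.ne'
  have := ((multiClock_visit ho h4 v).1 rfl).1
  have := multiClock_base_mono ho v v h2
  simp only [Nat.succ_eq_add_one] at *
  omega

end Delay

/-! ### Propagation of updates along the tree -/

section Delay

variable {V : ℕ} {τ : RootedTree V} {visit : Fin V → ℕ → Option (Fin V)} {T : ℕ} {H : Fin V → ℕ}

/-- The slot up to which the updates of `u` are known at `w` to the streams leaving `w` away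
from `u`. -/
noncomputable def known (τ : RootedTree V) (visit : Fin V → ℕ → Option (Fin V)) (t : ℕ)
    (w u : Fin V) : ℕ :=
  if u = w then t else (multiClock τ.nearest visit t).base w u

/-- Going back from `t`, stream `m` visited `v` within the last `H m` slots and, before that, `w`
within another `H m`; at `w` it took up what was known there about `u`. -/
theorem multiClock_delay_step (ho : ∀ m t v, visit m t = some v → τ.InRange m v)
    (hgap : ∀ m v, τ.InRange m v → GapLE T (H m) (fun t => visit m t = some v))
    {m v w u : Fin V} (hv : τ.InRange m v) (hw : τ.InRange m w) (hwu : τ.nearest m u = w)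
    (hne : w ≠ v) {N : ℕ} (hN : ∀ t ≤ T, t ≤ known τ visit t w u + N) {t : ℕ} (ht : t ≤ T) :
    t ≤ (multiClock τ.nearest visit t).base v u + (2 * H m + N) := by
  rcases le_total t (2 * H m) with hH | hH
  · omega
  obtain ⟨s, h1, h2, h3, h4⟩ := (hgap m v hv).exists_visit ht (by omega)
  obtain ⟨s, rfl⟩ := Nat.exists_eq_succ_of_ne_zero h3.ne'
  simp only [Nat.succ_eq_add_one] at *
  obtain ⟨r, g1, g2, g3, g4⟩ := (hgap m w hw).exists_visit (t := s) (by omega) (by omega)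
  obtain ⟨r, rfl⟩ := Nat.exists_eq_succ_of_ne_zero g3.ne'
  simp only [Nat.succ_eq_add_one] at *
  -- Each visit transfers the clocks of the preceding slot. The strict inequality in `exists_visit`
  -- pays for this slot, so no extra delay accumulates.
  have e1 := (multiClock_visit ho h4 u).2.2 (by rw [hwu]; exact hne)
  have e2 := multiClock_base_mono ho v u h2
  have e3 := multiClock_glob_mono ho m u g2
  obtain ⟨e4, e5, -⟩ := multiClock_visit ho g4 u
  have e6 := hN r (by omega)
  have e7 := e5 hwu
  simp only [known] at e1 e2 e3 e4 e6 e7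
  split_ifs at e6 with huw
  · have := (e4 huw).2
    omega
  · omega

open Classical in
/-- The streams on the first `k` edges of the tree path from `u` to the root. -/
noncomputable def RootedTree.firstStreams (τ : RootedTree V) (u : Fin V) (k : ℕ) :
    Finset (Fin V) :=
  univ.filter (fun m => ∃ j < k, τ.EdgeInStream m (τ.parent^[j] u))

theorem RootedTree.firstStreams_subset (u : Fin V) (k : ℕ) :
    τ.firstStreams u k ⊆ τ.pathStreams u := by
  classical
  intro m
  simp only [firstStreams, pathStreams, mem_filter, mem_univ, true_and]
  rintro ⟨j, _, h⟩
  exact ⟨j, h⟩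

theorem RootedTree.nearest_spec {m u : Fin V} (h : ∃ k : ℕ, τ.EdgeInStream m (τ.parent^[k] u)) :
    ∃ j, τ.nearest m u = τ.parent^[j] u ∧ τ.EdgeInStream m (τ.parent^[j] u) ∧
      ∀ i < j, ¬ τ.EdgeInStream m (τ.parent^[i] u) := by
  classical
  exact ⟨Nat.find h, by rw [nearest, dif_pos h], Nat.find_spec h, fun i hi => Nat.find_min h hi⟩

theorem sum_add_le_of_notMem {H : Fin V → ℕ} {s s' : Finset (Fin V)} {m : Fin V} (hs : s ⊆ s')
    (hm : m ∈ s') (hm' : m ∉ s) : H m + ∑ a ∈ s, H a ≤ ∑ a ∈ s', H a := by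
  rw [← sum_insert hm']
  exact sum_le_sum_of_subset (insert_subset hm hs)

/-- The way up from `u`. The stream of the last edge is followed back to the node where the path
entered it; from there to the `k`-th ancestor it costs `2 * H m` once, however many edges it covers,
and it does not occur earlier on the path. -/
theorem known_ancestor (ho : ∀ m t v, visit m t = some v → τ.InRange m v)
    (hgap : ∀ m v, τ.InRange m v → GapLE T (H m) (fun t => visit m t = some v)) (u : Fin V)
    (k : ℕ) : ∀ t ≤ T, t ≤ known τ visit t (τ.parent^[k] u) u
      + 2 * ∑ m ∈ τ.firstStreams u k, H m := by
  classical
  induction k using Nat.strong_induction_on with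
  | _ k ih =>
  intro t ht
  by_cases hu : u = τ.parent^[k] u
  · simp [known, ← hu]
  obtain _ | k := k
  · exact absurd rfl hu
  by_cases ha : τ.parent^[k] u = τ.root
  · have : τ.parent^[k + 1] u = τ.parent^[k] u := by
      rw [Function.iterate_succ_apply', ha, τ.parent_root]
    rw [this]
    refine (ih k (by omega) t ht).trans (Nat.add_le_add_left (Nat.mul_le_mul_left _ ?_) _)
    refine sum_le_sum_of_subset fun m => ?_
    simp only [RootedTree.firstStreams, mem_filter, mem_univ, true_and]
    rintro ⟨j, hj, h⟩
    exact ⟨j, by omega, h⟩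
  · obtain ⟨m, hm⟩ := RootedTree.exists_edgeInStream ha
    have hv := hm.inRange_parent
    rw [← Function.iterate_succ_apply' τ.parent] at hv
    obtain ⟨j, h1, h2, h3⟩ := τ.nearest_spec ⟨k, hm⟩
    have hjk : j ≤ k := by
      by_contra hlt
      exact h3 k (by omega) hm
    have hdepth := τ.depth_pos ha
    rw [τ.depth_iterate] at hdepth
    have hne : τ.parent^[j] u ≠ τ.parent^[k + 1] u := by
      intro h
      have := congrArg τ.depth h
      rw [τ.depth_iterate, τ.depth_iterate] at this
      omega
    have := multiClock_delay_step ho hgap hv ⟨h2.1, Or.inr h2⟩ h1 hne (ih j (by omega)) ht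
    rw [known, if_neg hu]
    refine this.trans (Nat.add_le_add_left ?_ _)
    rw [← mul_add]
    refine Nat.mul_le_mul_left _ (sum_add_le_of_notMem ?_ ?_ ?_)
    · intro m
      simp only [RootedTree.firstStreams, mem_filter, mem_univ, true_and]
      rintro ⟨i, hi, h⟩
      exact ⟨i, by omega, h⟩
    · simp only [RootedTree.firstStreams, mem_filter, mem_univ, true_and]
      exact ⟨k, by omega, hm⟩
    · simp only [RootedTree.firstStreams, mem_filter, mem_univ, true_and]
      rintro ⟨i, hi, h⟩
      exact h3 i hi h

/-- The way down, by induction on the depth of `v`. If `v` is an ancestor of `u`, the way up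
suffices. Otherwise the stream arriving at `v` from above either already passes through an ancestor
of `u`, or brings the update from its creator, which is nearer to the root and whose path to the
root avoids this stream. -/
theorem multiClock_delay (ho : ∀ m t v, visit m t = some v → τ.InRange m v)
    (hgap : ∀ m v, τ.InRange m v → GapLE T (H m) (fun t => visit m t = some v)) {B : ℕ}
    (hB : ∀ v, ∑ m ∈ τ.pathStreams v, H m ≤ B) (v u : Fin V) (hvu : u ≠ v) :
    ∀ t ≤ T, t ≤ (multiClock τ.nearest visit t).base v u
      + (2 * ∑ m ∈ τ.pathStreams v, H m + 2 * B) := by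
  classical
  have hanc : ∀ k, ∀ t ≤ T, t ≤ known τ visit t (τ.parent^[k] u) u + 2 * B := by
    intro k t ht
    refine (known_ancestor ho hgap u k t ht).trans (Nat.add_le_add_left
      (Nat.mul_le_mul_left _ ((sum_le_sum_of_subset (τ.firstStreams_subset u k)).trans (hB u))) _)
  generalize hn : τ.depth v = n
  induction n using Nat.strong_induction_on generalizing v with
  | _ n ih =>
  intro t ht
  by_cases hk : ∃ k, τ.parent^[k] u = v
  · obtain ⟨k, rfl⟩ := hk
    have := hanc k t ht
    rw [known, if_neg hvu] at this
    omega
  have hroot : v ≠ τ.root := by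
    rintro rfl
    exact hk ⟨τ.depth u, by rw [← τ.depth_eq_zero, τ.depth_iterate]; omega⟩
  obtain ⟨m, hm⟩ := RootedTree.exists_edgeInStream hroot
  have hmem : m ∈ τ.pathStreams v := by
    simp only [RootedTree.pathStreams, mem_filter, mem_univ, true_and]
    exact ⟨0, hm⟩
  have hHm : H m ≤ ∑ m ∈ τ.pathStreams v, H m :=
    single_le_sum (f := H) (fun _ _ => Nat.zero_le _) hmem
  by_cases hex : ∃ k : ℕ, τ.EdgeInStream m (τ.parent^[k] u)
  · obtain ⟨j, h1, h2, -⟩ := τ.nearest_spec hex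
    have := multiClock_delay_step ho hgap ⟨hm.1, Or.inr hm⟩ ⟨h2.1, Or.inr h2⟩ h1
      (fun h => hk ⟨j, h⟩) (hanc j) ht
    omega
  · have hnear : τ.nearest m u = τ.parent m := by rw [RootedTree.nearest, dif_neg hex]
    obtain ⟨i, hi⟩ : ∃ i, τ.parent^[i] v = m := ⟨_, hm.2.2.choose_spec.1⟩
    have hpar : τ.parent^[i + 1] v = τ.parent m := by rw [Function.iterate_succ_apply', hi]
    have hdepth := τ.depth_pos hroot
    have hdm : τ.depth (τ.parent m) < n := by
      rw [← hpar, τ.depth_iterate]; omega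
    have hne : τ.parent m ≠ v := by
      rintro h
      rw [h] at hdm
      omega
    have hsum : H m + ∑ a ∈ τ.pathStreams (τ.parent m), H a ≤ ∑ a ∈ τ.pathStreams v, H a := by
      refine sum_add_le_of_notMem ?_ hmem ?_
      · intro a
        simp only [RootedTree.pathStreams, mem_filter, mem_univ, true_and]
        rintro ⟨k, h⟩
        exact ⟨k + (i + 1), by rw [Function.iterate_add_apply, hpar]; exact h⟩
      · simp only [RootedTree.pathStreams, mem_filter, mem_univ, true_and]
        rintro ⟨k, h⟩
        exact RootedTree.not_edgeInStream_above hm.1 k h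
    have hN : ∀ t ≤ T, t ≤ known τ visit t (τ.parent m) u
        + (2 * ∑ a ∈ τ.pathStreams (τ.parent m), H a + 2 * B) := by
      intro t ht
      by_cases hum : u = τ.parent m
      · rw [known, if_pos hum]; omega
      · rw [known, if_neg hum]
        exact ih _ hdm _ hum rfl t ht
    have := multiClock_delay_step ho hgap ⟨hm.1, Or.inr hm⟩ ⟨hm.1, Or.inl rfl⟩ hnear hne hN ht
    omega

end Delay

/-! #### The models of multi-stream DIGEST -/

theorem streamStep_grad {d V : ℕ} (p : Fin V → ℝ) (m : Fin V) (o : Option (Fin V))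
    (s : MultiState d V) : (streamStep p m o s).grad = s.grad := by
  rcases o with _ | v <;> rfl

theorem foldl_streamStep_grad {d V : ℕ} (p : Fin V → ℝ) (o : Fin V → Option (Fin V))
    (l : List (Fin V)) (s : MultiState d V) :
    (l.foldl (fun s m => streamStep p m (o m) s) s).grad = s.grad := by
  induction l generalizing s with
  | nil => rfl
  | cons m l ih => rw [List.foldl_cons, ih, streamStep_grad]

theorem multiRun_grad {d V : ℕ} (p : Fin V → ℝ) (x₀ : Model d) (η : ℝ) (lag : Fin V → ℕ → ℕ)
    (visit : Fin V → ℕ → Option (Fin V)) (G : ℕ → Fin V → Model d → Model d) (t : ℕ)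
    (v : Fin V) : ∀ z < t, (multiRun p x₀ η lag visit G t).grad v z
      = G z v ((multiRun p x₀ η lag visit G z).x v) := by
  induction t with
  | zero => simp
  | succ t ih =>
    intro z hz
    have : (multiRun p x₀ η lag visit G (t + 1)).grad v z = Function.update
        ((multiRun p x₀ η lag visit G t).grad v) t
        (G t v ((multiRun p x₀ η lag visit G t).x v)) z := by
      rw [multiRun, foldl_streamStep_grad]
    rw [this]
    rcases eq_or_ne z t with rfl | h
    · simp
    · rw [Function.update_of_ne h, ih z (by omega)]

/-- The clocks describe the models within slot `now`, after the local updates. -/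
structure MultiState.Follows {d V : ℕ} (s : MultiState d V) (k : MultiClock V) (p : Fin V → ℝ)
    (x₀ : Model d) (Q : Fin V → ℕ → Model d) (now : ℕ) : Prop where
  base : ∀ v, s.base v = mix p x₀ Q (k.base v)
  glob : ∀ m, s.glob m = mix p x₀ Q (k.glob m)
  last : ∀ m v, s.last m v = mix p x₀ Q (k.last m v)
  x : ∀ v, s.x v = s.base v - (Q v now - Q v (k.base v v))

/-- The update formula read entry by entry. If `u` is behind `v`, the stream still agrees with its
last value at `v`, and `base - last` replaces its entry by that of `v`; otherwise the base agrees
with that value and the correction vanishes. The entry of `v` itself also receives the local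
updates. -/
theorem streamStep_follows {d V : ℕ} {τ : RootedTree V} {s : MultiState d V} {k : MultiClock V}
    {p : Fin V → ℝ} {x₀ : Model d} {Q : Fin V → ℕ → Model d} {now : ℕ} {m : Fin V}
    {o : Option (Fin V)} (hk : k.Valid τ now) (h : s.Follows k p x₀ Q now)
    (ho : ∀ v, o = some v → τ.InRange m v) :
    (streamStep p m o s).Follows (clockStep τ.nearest now m o k) p x₀ Q now := by
  rcases o with _ | v
  · exact h
  have hv := ho v rfl
  set n : Fin V → ℕ := fun u => if u = v then now else if τ.nearest m u = v then k.base v u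
      else k.glob m u with hn
  have hg : s.glob m + p v • (s.x v - s.base v) + (s.base v - s.last m v) = mix p x₀ Q n := by
    have hsum : ∑ u, p u • Q u (n u) = ∑ u, p u • Q u (k.glob m u)
        + p v • (Q v now - Q v (k.base v v))
        + (∑ u, p u • Q u (k.base v u) - ∑ u, p u • Q u (k.last m v u)) := by
      have : p v • (Q v now - Q v (k.base v v))
          = ∑ u, if u = v then p u • (Q u now - Q u (k.base v u)) else 0 := by simp
      rw [this, ← sum_sub_distrib, ← sum_add_distrib, ← sum_add_distrib]
      refine sum_congr rfl fun u _ => ?_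
      by_cases huv : u = v
      · subst huv
        have := hk.glob_eq m u u hv (RootedTree.nearest_of_inRange hv)
        simp only [hn, if_true, this]
        module
      · simp only [hn, if_neg huv, add_zero]
        by_cases hu : τ.nearest m u = v
        · rw [if_pos hu, hk.glob_eq m v u hv hu]; abel
        · rw [if_neg hu, hk.base_eq m v u hv hu]; abel
    rw [h.x, h.base, h.glob, h.last]
    unfold mix
    rw [hsum]
    module
  have hs : streamStep p m (some v) s = ⟨Function.update s.x v (mix p x₀ Q n),
      Function.update s.base v (mix p x₀ Q n), Function.update s.glob m (mix p x₀ Q n),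
      Function.update s.last m (Function.update (s.last m) v (mix p x₀ Q n)), s.grad⟩ := by
    rw [← hg]; rfl
  have hc : clockStep τ.nearest now m (some v) k = ⟨Function.update k.base v n,
    Function.update k.glob m n, Function.update k.last m (Function.update (k.last m) v n)⟩ := rfl
  rw [hs, hc]
  refine ⟨fun w => ?_, fun w => ?_, fun a w => ?_, fun w => ?_⟩
  · rcases eq_or_ne w v with rfl | hw
    · simp
    · simpa [Function.update_of_ne hw] using h.base w
  · rcases eq_or_ne w m with rfl | hw
    · simp
    · simpa [Function.update_of_ne hw] using h.glob w
  · rcases eq_or_ne a m with rfl | hm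
    · rcases eq_or_ne w v with rfl | hw
      · simp
      · simpa [Function.update_of_ne hw] using h.last a w
    · simpa [Function.update_of_ne hm] using h.last a w
  · rcases eq_or_ne w v with rfl | hw
    · simp [hn]
    · simpa [Function.update_of_ne hw] using h.x w

theorem foldl_streamStep_follows {d V : ℕ} {τ : RootedTree V} {p : Fin V → ℝ} {x₀ : Model d}
    {Q : Fin V → ℕ → Model d} {now : ℕ} {o : Fin V → Option (Fin V)}
    (ho : ∀ m v, o m = some v → τ.InRange m v) (l : List (Fin V)) {s : MultiState d V}
    {k : MultiClock V} (hk : k.Valid τ now) (h : s.Follows k p x₀ Q now) :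
    (l.foldl (fun s m => streamStep p m (o m) s) s).Follows
      (l.foldl (fun k m => clockStep τ.nearest now m (o m) k) k) p x₀ Q now := by
  induction l generalizing s k with
  | nil => exact h
  | cons m l ih => exact ih (clockStep_valid hk (ho m)).1 (streamStep_follows hk h (ho m))

theorem multiRun_follows {d V : ℕ} (p : Fin V → ℝ) (x₀ : Model d) (η : ℝ)
    (lag : Fin V → ℕ → ℕ) {τ : RootedTree V} {visit : Fin V → ℕ → Option (Fin V)}
    (ho : ∀ m t v, visit m t = some v → τ.InRange m v)
    (G : ℕ → Fin V → Model d → Model d) (Q : Fin V → ℕ → Model d)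
    (hQ : ∀ v, Q v = progress η (lag v) fun z => G z v ((multiRun p x₀ η lag visit G z).x v))
    (t : ℕ) :
    (multiRun p x₀ η lag visit G t).Follows (multiClock τ.nearest visit t) p x₀ Q t := by
  induction t with
  | zero =>
    have h0 : ∀ v, Q v 0 = 0 := fun v => by rw [hQ]; simp [progress]
    constructor <;> simp [multiRun, multiClock, mix, h0]
  | succ t ih =>
    refine foldl_streamStep_follows (fun m v => ho m (t + 1) v) _
      ((multiClock_valid ho t).mono (Nat.le_succ t)) ⟨ih.base, ih.glob, ih.last, fun v => ?_⟩
    simp only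
    rw [localStep_congr (g' := fun z => G z v ((multiRun p x₀ η lag visit G z).x v)),
      localStep_eq_sub, ← hQ, ih.x v]
    · abel
    · intro z hz
      rcases eq_or_ne z t with rfl | h
      · simp
      · rw [Function.update_of_ne h, multiRun_grad _ _ _ _ _ _ _ _ _ (by omega)]

/-! #### Both variants -/

theorem weight_nonneg {V : ℕ} (D : Fin V → ℕ) (v : Fin V) : 0 ≤ weight D v := by
  unfold weight totalData; positivity

theorem totalData_pos {V : ℕ} {D : Fin V → ℕ} (hD : ∀ v, 0 < D v) (hV : 0 < V) :
    0 < totalData D := by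
  have : Nonempty (Fin V) := ⟨⟨0, hV⟩⟩
  exact sum_pos (fun v _ => by exact_mod_cast hD v) univ_nonempty

theorem sum_weight {V : ℕ} {D : Fin V → ℕ} (hD : ∀ v, 0 < D v) (hV : 0 < V) :
    ∑ v, weight D v = 1 := by
  unfold weight
  rw [← sum_div]
  exact div_self (totalData_pos hD hV).ne'

/-- The local models are combinations of the updates of all nodes, with delays that do not depend on
the samples. -/
theorem Instance.exists_clock {d V T : ℕ} {D : Fin V → ℕ} (S : Instance d V T D)
    (hD : ∀ v, 0 < D v) (hV : 0 < V) (hgap : S.schedule.Bounded T) :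
    ∃ c : ℕ → Fin V → Fin V → ℕ, (∀ t v u, c t v u ≤ t) ∧
      (∀ t ≤ T, ∀ v u, t ≤ c t v u + 4 * S.schedule.interval) ∧
      (∀ t ≤ T, ∀ v, t ≤ c t v v + S.schedule.interval) ∧
      ∀ η ω t v, S.iterate η ω t v = mix (weight D) S.x₀
        (fun u => progress η (S.lag u) fun z => stochGrad S.loss ω z u (S.iterate η ω z u)) (c t v)
        - (progress η (S.lag v) (fun z => stochGrad S.loss ω z v (S.iterate η ω z v)) t
          - progress η (S.lag v) (fun z => stochGrad S.loss ω z v (S.iterate η ω z v))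
            (c t v v)) := by
  obtain ⟨loss, x₀, lag, E, sched⟩ := S
  rcases sched with ⟨H, visit⟩ | ⟨τ, H, visit⟩
  · refine ⟨fun t => (singleClock visit t).1, fun t => (singleClock_le visit t).1,
      fun t ht v u => ?_, fun t ht v => ?_, fun η ω t v => ?_⟩
    · have := (singleClock_delay hgap ht v u).1
      simp only [Schedule.interval]; omega
    · exact (singleClock_delay hgap ht v v).2
    · obtain ⟨h1, -, h3, -⟩ := singleRun_invariant (weight D) x₀ η lag visit (stochGrad loss ω)
        _ (fun v => rfl) t
      have := h3 v
      rw [h1 v] at this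
      exact this
  · obtain ⟨ho, hg⟩ := hgap
    have hB : ∀ v, ∑ m ∈ τ.pathStreams v, H m ≤ (Schedule.multi τ H visit).interval := fun v =>
      le_sup (f := fun v => ∑ m ∈ τ.pathStreams v, H m) (mem_univ v)
    have key : ∀ η (ω : Sampling T D) t v,
        (multiRun (weight D) x₀ η lag visit (stochGrad loss ω) t).x v = mix (weight D) x₀
          (fun u => progress η (lag u) fun z => stochGrad loss ω z u
            ((multiRun (weight D) x₀ η lag visit (stochGrad loss ω) z).x u))
          ((multiClock τ.nearest visit t).base v)
        - (progress η (lag v) (fun z => stochGrad loss ω z v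
            ((multiRun (weight D) x₀ η lag visit (stochGrad loss ω) z).x v)) t
          - progress η (lag v) (fun z => stochGrad loss ω z v
            ((multiRun (weight D) x₀ η lag visit (stochGrad loss ω) z).x v))
            ((multiClock τ.nearest visit t).base v v)) := by
      intro η ω t v
      have h := multiRun_follows (weight D) x₀ η lag ho (stochGrad loss ω) _ (fun v => rfl) t
      rw [h.x v, h.base v]
    by_cases hV1 : 1 < V
    · refine ⟨fun t => (multiClock τ.nearest visit t).base,
        fun t => (multiClock_valid ho t).base_le, fun t ht v u => ?_, fun t ht v => ?_,
        fun η ω t v => ?_⟩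
      · by_cases huv : u = v
        · subst huv
          obtain ⟨m, hm⟩ := RootedTree.exists_inRange (τ := τ) hV1 u
          obtain ⟨w, hw⟩ := hm.exists_mem_pathStreams
          have h1 := multiClock_own_delay ho hg hm ht
          have h2 : H m ≤ _ := single_le_sum (f := H) (fun _ _ => Nat.zero_le _) hw
          have := hB w
          simp only at *
          omega
        · have := multiClock_delay ho hg hB v u huv t ht
          have := hB v
          simp only at *
          omega
      · obtain ⟨m, hm⟩ := RootedTree.exists_inRange (τ := τ) hV1 v
        obtain ⟨w, hw⟩ := hm.exists_mem_pathStreams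
        have h1 := multiClock_own_delay ho hg hm ht
        have h2 : H m ≤ _ := single_le_sum (f := H) (fun _ _ => Nat.zero_le _) hw
        have := hB w
        simp only at *
        omega
      · exact key η ω t v
    -- A single node has no stream to synchronize it, and `interval` vanishes. Its weight is `1`, so
    -- its own updates may be counted as shared at once and the clock may be set to `t`.
    · obtain rfl : V = 1 := by omega
      have hp : weight D 0 = 1 := by simpa using sum_weight hD hV
      refine ⟨fun t _ _ => t, fun _ _ _ => le_rfl, fun _ _ _ _ => Nat.le_add_right _ _,
        fun _ _ _ => Nat.le_add_right _ _, fun η ω t v => ?_⟩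
      obtain rfl : v = 0 := Subsingleton.elim _ _
      refine (key η ω t 0).trans ?_
      simp [mix, hp, Instance.iterate]

/-! ### Deviation of the local models from the virtual average -/

/-- The stochastic gradient of node `v` at iteration `z`, along the run. -/
noncomputable def Instance.sg {d V T : ℕ} {D : Fin V → ℕ} (S : Instance d V T D) (η : ℝ)
    (ω : Sampling T D) (z : ℕ) (v : Fin V) : Model d :=
  stochGrad S.loss ω z v (S.iterate η ω z v)

/-- The virtual average model, to which all gradients are applied at once. -/
noncomputable def Instance.virtual {d V T : ℕ} {D : Fin V → ℕ} (S : Instance d V T D) (η : ℝ)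
    (ω : Sampling T D) (t : ℕ) : Model d :=
  S.x₀ - η • ∑ z ∈ range t, ∑ v, weight D v • S.sg η ω z v

theorem Instance.virtual_succ {d V T : ℕ} {D : Fin V → ℕ} (S : Instance d V T D) (η : ℝ)
    (ω : Sampling T D) (t : ℕ) :
    S.virtual η ω (t + 1) = S.virtual η ω t - η • ∑ v, weight D v • S.sg η ω t v := by
  simp only [virtual, sum_range_succ, smul_add]
  abel

/-- The bound on the weight of a gradient of node `u` at iteration `z` in the deviation of node `v`
at slot `t`. -/
noncomputable def window {V : ℕ} (D : Fin V → ℕ) (A t : ℕ) (v u : Fin V) (z : ℕ) : ℝ :=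
  (if t ≤ z + 4 * A then weight D u else 0) + if u = v ∧ t ≤ z + A then 1 else 0

theorem weight_le_one {V : ℕ} {D : Fin V → ℕ} (hD : ∀ v, 0 < D v) (v : Fin V) :
    weight D v ≤ 1 := by
  rw [← sum_weight hD v.pos]
  exact single_le_sum (f := weight D) (fun u _ => weight_nonneg D u) (mem_univ v)

/-- Only gradients that are missing from the mix or applied locally without being shared matter, and
both kinds are recent: `c ≤ lag` forces `t ≤ z + 4H' + E`, and `t ≤ z + H' + E` for the node's own.
The coefficients do not depend on `ω` or `η`, which later permits the use of orthogonality. -/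
theorem Instance.exists_deviation {d V T : ℕ} {D : Fin V → ℕ} (S : Instance d V T D)
    (hD : ∀ v, 0 < D v) (hV : 0 < V) (hgap : S.schedule.Bounded T)
    (hlag : ∀ v t, t < T → t ≤ S.lag v t ∧ S.lag v t ≤ t + S.E) :
    ∃ κ : ℕ → Fin V → Fin V → ℕ → ℝ,
      (∀ t v u z, |κ t v u z| ≤ 1) ∧
      (∀ t ≤ T, ∀ v u, ∀ z < t, |κ t v u z| ≤ window D S.A t v u z) ∧
      ∀ η ω, ∀ t ≤ T, ∀ v, S.iterate η ω t v - S.virtual η ω t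
        = η • ∑ u, ∑ z ∈ range t, κ t v u z • S.sg η ω z u := by
  obtain ⟨c, hc, h4, h1, heq⟩ := S.exists_clock hD hV hgap
  -- The first term counts gradients in the virtual average but not yet in the mix, with weight
  -- `weight D u`; the second, with full weight, the node's own gradients applied since its base was
  -- formed.
  refine ⟨fun t v u z => (if c t v u ≤ S.lag u z then weight D u else 0)
      - if u = v ∧ c t v u ≤ S.lag u z ∧ S.lag u z < t then 1 else 0, fun t v u z => ?_,
      fun t ht v u z hz => ?_, fun η ω t ht v => ?_⟩
  · have := weight_nonneg D u
    have := weight_le_one hD u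
    rw [abs_le]
    beta_reduce
    split_ifs <;> constructor <;> linarith
  · have h0 := weight_nonneg D u
    have hE := (hlag u z (by omega)).2
    refine (abs_sub _ _).trans (add_le_add ?_ ?_)
    · by_cases h : c t v u ≤ S.lag u z
      · have := h4 t ht v u
        rw [if_pos h, if_pos (by unfold Instance.A; omega), abs_of_nonneg h0]
      · rw [if_neg h, abs_zero]
        split_ifs <;> linarith
    · by_cases h : u = v ∧ c t v u ≤ S.lag u z ∧ S.lag u z < t
      · obtain ⟨rfl, h⟩ := h
        have := h1 t ht u
        rw [if_pos ⟨rfl, h⟩, if_pos ⟨rfl, by unfold Instance.A; omega⟩, abs_one]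
      · rw [if_neg h, abs_zero]
        split_ifs <;> norm_num
  · have hp : ∀ u, ∀ b ≤ t, progress η (S.lag u) (fun z => S.sg η ω z u) b
        = ∑ z ∈ range t, if S.lag u z < b then η • S.sg η ω z u else 0 := fun u b hb =>
      progress_eq_sum η _ (fun z hz => (hlag u z hz).1) ht hb
    have e1 : S.iterate η ω t v = S.x₀
        - ∑ u, weight D u • (∑ z ∈ range t, if S.lag u z < c t v u then η • S.sg η ω z u else 0)
        - ((∑ z ∈ range t, if S.lag v z < t then η • S.sg η ω z v else 0)
          - ∑ z ∈ range t, if S.lag v z < c t v v then η • S.sg η ω z v else 0) := by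
      rw [heq, mix]
      change _ - ∑ u, weight D u • progress η (S.lag u) (fun z => S.sg η ω z u) _
        - (progress η (S.lag v) (fun z => S.sg η ω z v) _
          - progress η (S.lag v) (fun z => S.sg η ω z v) _) = _
      rw [hp v t le_rfl, hp v _ (hc t v v)]
      simp only [hp _ _ (hc t v _)]
    have e2 : (∑ z ∈ range t, if S.lag v z < t then η • S.sg η ω z v else 0)
          - ∑ z ∈ range t, (if S.lag v z < c t v v then η • S.sg η ω z v else 0)
        = η • ∑ u, ∑ z ∈ range t, (if u = v ∧ c t v u ≤ S.lag u z ∧ S.lag u z < t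
            then (1 : ℝ) else 0) • S.sg η ω z u := by
      rw [sum_eq_single v, ← sum_sub_distrib, smul_sum]
      · refine sum_congr rfl fun z _ => ?_
        have := hc t v v
        by_cases h : c t v v ≤ S.lag v z
        · by_cases h' : S.lag v z < t
          · simp [h, h', h.not_gt]
          · simp [h', h.not_gt]
        · simp [h, not_le.1 h, (not_le.1 h).trans_le this]
      · intro u _ hu
        simp [hu]
      · simp
    rw [e1, e2, virtual, sum_comm (s := range t)]
    simp only [sub_smul, sum_sub_distrib, smul_sub]
    have e3 : η • ∑ u, ∑ z ∈ range t, weight D u • S.sg η ω z u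
        - ∑ u, weight D u • (∑ z ∈ range t, if S.lag u z < c t v u then η • S.sg η ω z u else 0)
        = η • ∑ u, ∑ z ∈ range t, (if c t v u ≤ S.lag u z then weight D u else 0)
            • S.sg η ω z u := by
      rw [smul_sum, smul_sum, ← sum_sub_distrib]
      refine sum_congr rfl fun u _ => ?_
      rw [smul_sum, smul_sum, smul_sum, ← sum_sub_distrib]
      refine sum_congr rfl fun z _ => ?_
      by_cases h : c t v u ≤ S.lag u z
      · simp [h, h.not_gt]
      · simp [h, not_le.1 h, smul_comm η (weight D u)]
    rw [← e3]
    abel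

/-! ### Smooth functions -/

section Smooth

variable {E : Type*} [NormedAddCommGroup E] [InnerProductSpace ℝ E] [CompleteSpace E]

/-- On the segment from `x` to `y`, the difference between `f` and the quadratic model has
nonpositive derivative by the Lipschitz bound and Cauchy-Schwarz. -/
theorem le_add_inner_gradient_add {f : E → ℝ} {L : ℝ} (hf : Differentiable ℝ f)
    (hL : ∀ x y, ‖gradient f y - gradient f x‖ ≤ L * ‖y - x‖) (x y : E) :
    f y ≤ f x + ⟪gradient f x, y - x⟫ + L / 2 * ‖y - x‖ ^ 2 := by
  set e := y - x with he
  let φ : ℝ → ℝ := fun s => f (x + s • e) - s * ⟪gradient f x, e⟫ - s ^ 2 * (L / 2 * ‖e‖ ^ 2)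
  have hφ : ∀ s, HasDerivAt φ (⟪gradient f (x + s • e), e⟫ - ⟪gradient f x, e⟫
      - 2 * s * (L / 2 * ‖e‖ ^ 2)) s := by
    intro s
    have h1 : HasDerivAt (fun s : ℝ => x + s • e) e s := by
      simpa using ((hasDerivAt_id s).smul_const e).const_add x
    have h2 := (hf (x + s • e)).hasGradientAt.hasFDerivAt.comp_hasDerivAt s h1
    rw [InnerProductSpace.toDual_apply_apply] at h2
    have h3 : HasDerivAt (fun s : ℝ => s * ⟪gradient f x, e⟫) ⟪gradient f x, e⟫ s := by
      simpa using (hasDerivAt_id s).mul_const ⟪gradient f x, e⟫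
    have h4 : HasDerivAt (fun s : ℝ => s ^ 2 * (L / 2 * ‖e‖ ^ 2))
        (2 * s * (L / 2 * ‖e‖ ^ 2)) s := by
      simpa using (hasDerivAt_pow 2 s).mul_const (L / 2 * ‖e‖ ^ 2)
    exact (h2.sub h3).sub h4
  have hanti : AntitoneOn φ (Set.Icc 0 1) := by
    refine antitoneOn_of_deriv_nonpos (convex_Icc 0 1)
      (fun s _ => (hφ s).continuousAt.continuousWithinAt)
      (fun s _ => (hφ s).differentiableAt.differentiableWithinAt) fun s hs => ?_
    rw [interior_Icc] at hs
    rw [(hφ s).deriv, ← inner_sub_left]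
    have h1 := real_inner_le_norm (gradient f (x + s • e) - gradient f x) e
    have h2 := hL x (x + s • e)
    rw [add_sub_cancel_left, norm_smul, Real.norm_of_nonneg hs.1.le] at h2
    have h3 := mul_le_mul_of_nonneg_right h2 (norm_nonneg e)
    nlinarith
  have := hanti (Set.left_mem_Icc.2 zero_le_one) (Set.right_mem_Icc.2 zero_le_one) zero_le_one
  simp only [φ, one_smul, zero_smul, add_zero, one_pow, zero_mul, sub_zero, one_mul, ne_eq,
    OfNat.ofNat_ne_zero, not_false_eq_true, zero_pow] at this
  rw [he, add_sub_cancel] at this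
  linarith

/-- A gradient step of length `1/L` lowers `f` by at least `‖∇f‖²/(2L)`, and cannot lead below `m`.
-/
theorem norm_gradient_sq_le {f : E → ℝ} {L m : ℝ} (hf : Differentiable ℝ f) (hLpos : 0 < L)
    (hL : ∀ x y, ‖gradient f y - gradient f x‖ ≤ L * ‖y - x‖) (hm : ∀ x, m ≤ f x) (x : E) :
    ‖gradient f x‖ ^ 2 ≤ 2 * L * (f x - m) := by
  have h := le_add_inner_gradient_add hf hL x (x - L⁻¹ • gradient f x)
  have h2 := hm (x - L⁻¹ • gradient f x)
  rw [sub_sub_cancel_left, inner_neg_right, inner_smul_right, real_inner_self_eq_norm_sq,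
    norm_neg, norm_smul, Real.norm_of_nonneg (inv_nonneg.2 hLpos.le)] at h
  have h3 : L / 2 * (L⁻¹ * ‖gradient f x‖) ^ 2 = L⁻¹ * ‖gradient f x‖ ^ 2 / 2 := by
    field_simp
  rw [h3] at h
  have h4 : L⁻¹ * ‖gradient f x‖ ^ 2 ≤ 2 * (f x - m) := by linarith
  have h5 := mul_le_mul_of_nonneg_left h4 hLpos.le
  rw [← mul_assoc, mul_inv_cancel₀ hLpos.ne', one_mul] at h5
  linarith

/-- Moving away from a point costs at most a constant factor and the squared distance. -/
theorem sub_le_two_mul_sub_add {f : E → ℝ} {L m : ℝ} (hf : Differentiable ℝ f) (hLpos : 0 < L)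
    (hL : ∀ x y, ‖gradient f y - gradient f x‖ ≤ L * ‖y - x‖) (hm : ∀ x, m ≤ f x) (x y : E) :
    f y - m ≤ 2 * (f x - m) + L * ‖y - x‖ ^ 2 := by
  have h1 := le_add_inner_gradient_add hf hL x y
  have h2 := norm_gradient_sq_le hf hLpos hL hm x
  have h3 := real_inner_le_norm (gradient f x) (y - x)
  have h4 : ‖gradient f x‖ * ‖y - x‖ ≤ (f x - m) + L / 2 * ‖y - x‖ ^ 2 := by
    have h5 := sq_nonneg (‖gradient f x‖ - L * ‖y - x‖)
    have h6 : 2 * L * (‖gradient f x‖ * ‖y - x‖)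
        ≤ 2 * L * ((f x - m) + L / 2 * ‖y - x‖ ^ 2) := by nlinarith
    exact le_of_mul_le_mul_left h6 (by positivity)
  linarith

end Smooth

/-! ### The local and global losses -/

namespace Instance

variable {d V T : ℕ} {D : Fin V → ℕ} {S : Instance d V T D} {L σ ζ η : ℝ}

theorem Assumptions.differentiable_localLoss (h : S.Assumptions L σ ζ η) (v : Fin V) :
    Differentiable ℝ (localLoss S.loss v) := by
  unfold localLoss
  exact (Differentiable.fun_sum fun i _ => h.differentiable v i).const_mul _

theorem f_eq_sum (S : Instance d V T D) (hD : ∀ v, 0 < D v) (x : Model d) :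
    S.f x = ∑ v, weight D v * localLoss S.loss v x := by
  unfold f globalLoss localLoss weight
  rw [mul_sum]
  refine sum_congr rfl fun v _ => ?_
  have : (D v : ℝ) ≠ 0 := by exact_mod_cast (hD v).ne'
  field_simp

theorem Assumptions.differentiable_f (h : S.Assumptions L σ ζ η) : Differentiable ℝ S.f := by
  unfold f globalLoss
  exact (Differentiable.fun_sum fun v _ => Differentiable.fun_sum fun i _ =>
    h.differentiable v i).const_mul _

theorem Assumptions.gradient_f (h : S.Assumptions L σ ζ η) (hD : ∀ v, 0 < D v) (x : Model d) :
    gradient S.f x = ∑ v, weight D v • gradient (localLoss S.loss v) x := by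
  have : HasGradientAt S.f (∑ v, weight D v • gradient (localLoss S.loss v) x) x := by
    rw [hasGradientAt_iff_hasFDerivAt, funext (S.f_eq_sum hD)]
    simp only [map_sum, map_smul]
    refine HasFDerivAt.fun_sum fun v _ => ?_
    exact ((h.differentiable_localLoss v x).hasGradientAt.hasFDerivAt).const_mul _
  exact this.gradient

theorem Assumptions.smooth_f (h : S.Assumptions L σ ζ η) (hD : ∀ v, 0 < D v) (hV : 0 < V)
    (x y : Model d) : ‖gradient S.f y - gradient S.f x‖ ≤ L * ‖y - x‖ := by
  rw [h.gradient_f hD, h.gradient_f hD, ← sum_sub_distrib]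
  calc ‖∑ v, (weight D v • gradient (localLoss S.loss v) y
        - weight D v • gradient (localLoss S.loss v) x)‖
      ≤ ∑ v, weight D v * (L * ‖y - x‖) := by
        refine norm_sum_le_of_le _ fun v _ => ?_
        rw [← smul_sub, norm_smul, Real.norm_of_nonneg (weight_nonneg D v)]
        exact mul_le_mul_of_nonneg_left (h.smooth v x y) (weight_nonneg D v)
    _ = L * ‖y - x‖ := by rw [← sum_mul, sum_weight hD hV, one_mul]

end Instance

/-- Jensen's inequality for the squared norm. -/
theorem norm_sum_smul_sq_le {ι E : Type*} [NormedAddCommGroup E] [InnerProductSpace ℝ E]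
    (s : Finset ι) (a : ι → ℝ) (b : ι → E) :
    ‖∑ i ∈ s, a i • b i‖ ^ 2 ≤ (∑ i ∈ s, |a i|) * ∑ i ∈ s, |a i| * ‖b i‖ ^ 2 := by
  have h1 : ‖∑ i ∈ s, a i • b i‖ ≤ ∑ i ∈ s, |a i| * ‖b i‖ :=
    norm_sum_le_of_le _ fun i _ => by rw [norm_smul, Real.norm_eq_abs]
  calc ‖∑ i ∈ s, a i • b i‖ ^ 2 ≤ (∑ i ∈ s, |a i| * ‖b i‖) ^ 2 := by gcongr
    _ ≤ _ := sum_sq_le_sum_mul_sum_of_sq_le_mul s (fun i _ => abs_nonneg _)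
        (fun i _ => by positivity) (fun i _ => le_of_eq (by ring))

/-! ### Dependence on the samples -/

theorem singleRun_congr {d V : ℕ} (p : Fin V → ℝ) (x₀ : Model d) (η : ℝ) (lag : Fin V → ℕ → ℕ)
    (visit : ℕ → Option (Fin V)) {G G' : ℕ → Fin V → Model d → Model d} {t : ℕ}
    (h : ∀ s < t, G s = G' s) :
    singleRun p x₀ η lag visit G t = singleRun p x₀ η lag visit G' t := by
  induction t with
  | zero => rfl
  | succ t ih => rw [singleRun, singleRun, ih fun s hs => h s (by omega), h t (by omega)]

theorem multiRun_congr {d V : ℕ} (p : Fin V → ℝ) (x₀ : Model d) (η : ℝ) (lag : Fin V → ℕ → ℕ)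
    (visit : Fin V → ℕ → Option (Fin V)) {G G' : ℕ → Fin V → Model d → Model d} {t : ℕ}
    (h : ∀ s < t, G s = G' s) :
    multiRun p x₀ η lag visit G t = multiRun p x₀ η lag visit G' t := by
  induction t with
  | zero => rfl
  | succ t ih => rw [multiRun, multiRun, ih fun s hs => h s (by omega), h t (by omega)]

/-- The sample path `ω` with the sample of node `u` at iteration `z` replaced by `i`. -/
def resample {V T : ℕ} {D : Fin V → ℕ} (ω : Sampling T D) (z : Fin T) (u : Fin V)
    (i : Fin (D u)) : Sampling T D :=
  Function.update ω z (Function.update (ω z) u i)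

section Resample

variable {d V T : ℕ} {D : Fin V → ℕ} {z : Fin T} {u : Fin V}

@[simp] theorem resample_self (ω : Sampling T D) (i : Fin (D u)) : resample ω z u i z u = i := by
  simp [resample]

theorem resample_of_ne (ω : Sampling T D) (i : Fin (D u)) {z' : Fin T} {u' : Fin V}
    (h : ¬ (z' = z ∧ u' = u)) : resample ω z u i z' u' = ω z' u' := by
  rcases eq_or_ne z' z with rfl | hz
  · have : u' ≠ u := fun hu => h ⟨rfl, hu⟩
    simp [resample, this]
  · simp [resample, hz]

/-- Drawing one sample anew does not change the expectation. -/
theorem expect_resample (z : Fin T) (u : Fin V) (F : Sampling T D → ℝ) :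
    𝔼 ω, F ω = 𝔼 ω, 𝔼 i, F (resample ω z u i) := by
  rcases isEmpty_or_nonempty (Fin (D u)) with hD | hD
  · have : IsEmpty (Sampling T D) := ⟨fun ω => hD.elim (ω z u)⟩
    simp [univ_eq_empty]
  -- Exchanging the recorded sample with the fresh one is an involution of the product space and
  -- thus preserves the uniform law.
  let φ : Sampling T D × Fin (D u) → Sampling T D × Fin (D u) :=
    fun p => (resample p.1 z u p.2, p.1 z u)
  have hφ : Function.Involutive φ := by
    rintro ⟨ω, i⟩
    simp only [φ, resample_self, Prod.mk.injEq, and_true]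
    simp [resample]
  have h1 : 𝔼 p : Sampling T D × Fin (D u), F (φ p).1
      = 𝔼 p : Sampling T D × Fin (D u), F p.1 :=
    Fintype.expect_equiv hφ.toPerm _ _ fun p => rfl
  rw [← univ_product_univ, expect_product, expect_product] at h1
  simp only [φ, Fintype.expect_const] at h1
  exact h1.symm

/-! ### Iterates and gradient noise under resampling -/

namespace Instance

variable (S : Instance d V T D) (η : ℝ)

theorem iterate_congr {ω ω' : Sampling T D} {t : ℕ} (h : ∀ s : Fin T, s < t → ω s = ω' s)
    (v : Fin V) : S.iterate η ω t v = S.iterate η ω' t v := by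
  have hG : ∀ s < t, stochGrad S.loss ω s = stochGrad S.loss ω' s := by
    intro s hs
    funext v x
    unfold stochGrad
    split_ifs with hsT
    · rw [h ⟨s, hsT⟩ hs]
    · rfl
  unfold iterate
  rcases S.schedule with ⟨H, visit⟩ | ⟨τ, H, visit⟩
  · simp only [singleRun_congr _ _ _ _ _ hG]
  · simp only [multiRun_congr _ _ _ _ _ hG]

theorem iterate_resample (ω : Sampling T D) (i : Fin (D u)) {t : ℕ} (ht : t ≤ z) (v : Fin V) :
    S.iterate η (resample ω z u i) t v = S.iterate η ω t v := by
  refine S.iterate_congr η (fun s hs => ?_) v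
  have : s ≠ z := by
    rintro rfl
    omega
  funext w
  exact resample_of_ne ω i fun h => this h.1

/-- The deviation of the stochastic gradient from the gradient of the local loss. -/
noncomputable def noise (ω : Sampling T D) (z : ℕ) (v : Fin V) : Model d :=
  S.sg η ω z v - gradient (localLoss S.loss v) (S.iterate η ω z v)

theorem noise_resample_self (ω : Sampling T D) (i : Fin (D u)) :
    S.noise η (resample ω z u i) z u = gradient (S.loss u i) (S.iterate η ω z u)
      - gradient (localLoss S.loss u) (S.iterate η ω z u) := by
  unfold noise sg stochGrad
  rw [S.iterate_resample η ω i le_rfl, dif_pos z.isLt]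
  simp

theorem sg_resample_of_ne (ω : Sampling T D) (i : Fin (D u)) {z' : ℕ} {u' : Fin V}
    (hz : z' ≤ z) (h : ¬ (z' = z ∧ u' = u)) :
    S.sg η (resample ω z u i) z' u' = S.sg η ω z' u' := by
  unfold sg stochGrad
  rw [S.iterate_resample η ω i hz]
  split_ifs with hT
  · rw [resample_of_ne ω i fun h' => h ⟨congrArg Fin.val h'.1, h'.2⟩]
  · rfl

theorem noise_resample_of_ne (ω : Sampling T D) (i : Fin (D u)) {z' : ℕ} {u' : Fin V}
    (hz : z' ≤ z) (h : ¬ (z' = z ∧ u' = u)) :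
    S.noise η (resample ω z u i) z' u' = S.noise η ω z' u' := by
  unfold noise
  rw [S.sg_resample_of_ne η ω i hz h, S.iterate_resample η ω i hz]

theorem virtual_resample (ω : Sampling T D) (i : Fin (D u)) {t : ℕ} (ht : t ≤ z) :
    S.virtual η (resample ω z u i) t = S.virtual η ω t := by
  unfold virtual
  congr 2
  refine sum_congr rfl fun s hs => sum_congr rfl fun v _ => ?_
  rw [mem_range] at hs
  rw [S.sg_resample_of_ne η ω i (by omega) (by omega)]

variable {S η} {L σ ζ : ℝ}

theorem Assumptions.gradient_localLoss (h : S.Assumptions L σ ζ η) (v : Fin V) (x : Model d) :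
    gradient (localLoss S.loss v) x = (1 / (D v : ℝ)) • ∑ i, gradient (S.loss v i) x := by
  have : HasGradientAt (localLoss S.loss v) ((1 / (D v : ℝ)) • ∑ i, gradient (S.loss v i) x) x := by
    rw [hasGradientAt_iff_hasFDerivAt]
    simp only [map_sum, map_smul]
    refine (HasFDerivAt.fun_sum fun i _ => ?_).const_mul _
    exact (h.differentiable v i x).hasGradientAt.hasFDerivAt
  exact this.gradient

/-- The noise is orthogonal to what does not depend on the sample. -/
theorem Assumptions.expect_inner_noise (h : S.Assumptions L σ ζ η) (hD : ∀ v, 0 < D v)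
    (z : Fin T) (u : Fin V) (X : Sampling T D → Model d)
    (hX : ∀ ω i, X (resample ω z u i) = X ω) :
    𝔼 ω, ⟪X ω, S.noise η ω z u⟫ = 0 := by
  rw [expect_resample z u]
  refine expect_eq_zero fun ω _ => ?_
  simp only [hX, noise_resample_self]
  have hDu : (D u : ℝ) ≠ 0 := by exact_mod_cast (hD u).ne'
  rw [Fintype.expect_eq_sum_div_card, ← inner_sum, sum_sub_distrib, h.gradient_localLoss]
  simp only [sum_const, card_univ, Fintype.card_fin]
  rw [← Nat.cast_smul_eq_nsmul ℝ, smul_smul, mul_one_div_cancel hDu, one_smul, sub_self,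
    inner_zero_right, zero_div]

/-- The noise of the earlier iteration does not depend on the sample behind the later one; in the
same iteration the samples of different nodes are independent. -/
theorem Assumptions.expect_inner_noise_noise (h : S.Assumptions L σ ζ η) (hD : ∀ v, 0 < D v)
    {z z' : ℕ} (hz : z < T) (hz' : z' < T) {u u' : Fin V} (hne : ¬ (z' = z ∧ u' = u)) :
    𝔼 ω, ⟪S.noise η ω z' u', S.noise η ω z u⟫ = 0 := by
  rcases le_total z' z with hle | hle
  · exact h.expect_inner_noise hD ⟨z, hz⟩ u _ fun ω i =>
      S.noise_resample_of_ne η ω i hle hne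
  · simp_rw [real_inner_comm]
    exact h.expect_inner_noise hD ⟨z', hz'⟩ u' _ fun ω i =>
      S.noise_resample_of_ne η ω i hle fun h => hne ⟨h.1.symm, h.2.symm⟩

theorem Assumptions.expect_norm_noise_sq_le (h : S.Assumptions L σ ζ η) (hD : ∀ v, 0 < D v)
    {z : ℕ} (hz : z < T) (u : Fin V) : 𝔼 ω, ‖S.noise η ω z u‖ ^ 2 ≤ σ ^ 2 := by
  have : ∀ v, Nonempty (Fin (D v)) := fun v => ⟨⟨0, hD v⟩⟩
  have : Nonempty (Sampling T D) := inferInstanceAs (Nonempty (Fin T → (v : Fin V) → Fin (D v)))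
  rw [expect_resample ⟨z, hz⟩ u]
  refine expect_le univ_nonempty fun ω _ => ?_
  have e : ∀ i, S.noise η (resample ω ⟨z, hz⟩ u i) z u = _ := fun i =>
    S.noise_resample_self (z := ⟨z, hz⟩) η ω i
  simp only [e, Fintype.expect_eq_sum_div_card, Fintype.card_fin]
  rw [div_eq_inv_mul, ← one_div]
  exact h.variance ω z u hz

end Instance

end Resample

theorem expect_norm_sum_sq {Ω ι E : Type*} [Fintype Ω] [NormedAddCommGroup E]
    [InnerProductSpace ℝ E] [DecidableEq ι] (s : Finset ι) (Y : ι → Ω → E)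
    (h : ∀ i ∈ s, ∀ j ∈ s, i ≠ j → 𝔼 ω, ⟪Y i ω, Y j ω⟫ = 0) :
    𝔼 ω, ‖∑ i ∈ s, Y i ω‖ ^ 2 = ∑ i ∈ s, 𝔼 ω, ‖Y i ω‖ ^ 2 := by
  simp_rw [← real_inner_self_eq_norm_sq, sum_inner, inner_sum, expect_sum_comm]
  refine sum_congr rfl fun i hi => ?_
  rw [sum_eq_single i]
  · intro j hj hne
    exact h i hi j hj hne.symm
  · exact fun h => absurd hi h

/-- The variance of a combination of the stochastic gradients. -/
theorem Instance.Assumptions.expect_norm_sum_noise_sq_le {d V T : ℕ} {D : Fin V → ℕ}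
    {S : Instance d V T D} {L σ ζ η : ℝ} (h : S.Assumptions L σ ζ η) (hD : ∀ v, 0 < D v)
    (s : Finset (Fin V × ℕ)) (hs : ∀ i ∈ s, i.2 < T) (a : Fin V × ℕ → ℝ) :
    𝔼 ω, ‖∑ i ∈ s, a i • S.noise η ω i.2 i.1‖ ^ 2 ≤ (∑ i ∈ s, a i ^ 2) * σ ^ 2 := by
  rw [expect_norm_sum_sq, sum_mul]
  · refine sum_le_sum fun i hi => ?_
    simp_rw [norm_smul, mul_pow, Real.norm_eq_abs, sq_abs]
    rw [← mul_expect]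
    exact mul_le_mul_of_nonneg_left (h.expect_norm_noise_sq_le hD (hs i hi) _) (sq_nonneg _)
  · intro i hi j hj hne
    simp_rw [real_inner_smul_left, real_inner_smul_right]
    rw [← mul_expect, ← mul_expect, h.expect_inner_noise_noise hD (hs j hj) (hs i hi), mul_zero,
      mul_zero]
    rintro ⟨h1, h2⟩
    exact hne (Prod.ext h2 h1)

/-! ### The consensus error -/

/-- The number of the windows of length `4 * A` and `A` before `t` that contain `z`. -/
noncomputable def windowCount (A t z : ℕ) : ℝ :=
  (if t ≤ z + 4 * A then 1 else 0) + if t ≤ z + A then 1 else 0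

theorem windowCount_nonneg (A t z : ℕ) : 0 ≤ windowCount A t z := by
  unfold windowCount; positivity

theorem sum_window_le (B t : ℕ) : ∑ z ∈ range t, (if t ≤ z + B then (1 : ℝ) else 0) ≤ B := by
  rw [sum_boole]
  have : (range t).filter (fun z => t ≤ z + B) ⊆ Ico (t - B) t := by
    intro z
    simp only [mem_filter, mem_range, mem_Ico]
    omega
  have h := card_le_card this
  rw [Nat.card_Ico] at h
  exact_mod_cast h.trans (by omega)

theorem sum_window_le' (B T z : ℕ) :
    ∑ t ∈ range T, (if z < t ∧ t ≤ z + B then (1 : ℝ) else 0) ≤ B := by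
  rw [sum_boole]
  have : (range T).filter (fun t => z < t ∧ t ≤ z + B) ⊆ Ioc z (z + B) := by
    intro t
    simp only [mem_filter, mem_range, mem_Ioc]
    omega
  have h := card_le_card this
  rw [Nat.card_Ioc] at h
  exact_mod_cast h.trans (by omega)

theorem sum_windowCount_le (A t : ℕ) : ∑ z ∈ range t, windowCount A t z ≤ 5 * A := by
  unfold windowCount
  rw [sum_add_distrib]
  have h1 := sum_window_le (4 * A) t
  have h2 := sum_window_le A t
  push_cast at h1
  linarith

theorem sum_window_mul {V : ℕ} (D : Fin V → ℕ) (A t : ℕ) (v : Fin V) (q : Fin V → ℕ → ℝ) :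
    ∑ u, ∑ z ∈ range t, window D A t v u z * q u z
      = ∑ z ∈ range t, (if t ≤ z + 4 * A then 1 else 0) * ∑ u, weight D u * q u z
        + ∑ z ∈ range t, (if t ≤ z + A then 1 else 0) * q v z := by
  rw [sum_comm, ← sum_add_distrib]
  refine sum_congr rfl fun z _ => ?_
  simp only [window, add_mul, sum_add_distrib, ite_mul, zero_mul, one_mul]
  congr 1
  · split_ifs <;> simp
  · rw [sum_eq_single v]
    · simp
    · intro u _ hu
      simp [hu]
    · simp

/-- Averaging over `v` gives the node's own window the weight `weight D u` as well, so both windows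
act on the same weighted mean over `u`. -/
theorem sum_weight_mul_sum_window {V : ℕ} {D : Fin V → ℕ} (hD : ∀ v, 0 < D v) (hV : 0 < V)
    (A t : ℕ) (q : Fin V → ℕ → ℝ) :
    ∑ v, weight D v * ∑ u, ∑ z ∈ range t, window D A t v u z * q u z
      = ∑ z ∈ range t, windowCount A t z * ∑ u, weight D u * q u z := by
  simp only [sum_window_mul, mul_add, sum_add_distrib]
  rw [← sum_mul, sum_weight hD hV, one_mul]
  simp only [mul_sum (s := range t)]
  rw [sum_comm (s := univ), ← sum_add_distrib]
  refine sum_congr rfl fun z _ => ?_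
  rw [windowCount, add_mul]
  congr 1
  rw [mul_sum]
  exact sum_congr rfl fun v _ => by ring

theorem sum_window_one_le {V : ℕ} {D : Fin V → ℕ} (hD : ∀ v, 0 < D v) (hV : 0 < V)
    (A t : ℕ) (v : Fin V) : ∑ u, ∑ z ∈ range t, window D A t v u z ≤ 5 * A := by
  have h := sum_window_mul D A t v fun _ _ => 1
  simp only [mul_one, sum_weight hD hV] at h
  rw [h]
  have h1 := sum_window_le (4 * A) t
  have h2 := sum_window_le A t
  push_cast at h1
  linarith

/-- After exchanging the sums, each `z` lies in at most `4A + A` windows, across which the weight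
grows by a factor of at most `15/13`. -/
theorem sum_windowCount_mul_le {A T : ℕ} {w y : ℕ → ℝ} (hw : ∀ t, 0 ≤ w t) (hy : ∀ t, 0 ≤ y t)
    (hwin : ∀ z t, z < t → t ≤ z + 4 * A → w t ≤ 15 / 13 * w z) :
    ∑ t ∈ range T, w t * ∑ z ∈ range t, windowCount A t z * y z
      ≤ 15 / 13 * (5 * A) * ∑ z ∈ range T, w z * y z := by
  calc ∑ t ∈ range T, w t * ∑ z ∈ range t, windowCount A t z * y z
      ≤ ∑ t ∈ range T, ∑ z ∈ range T, ((if z < t ∧ t ≤ z + 4 * A then 1 else 0)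
          + (if z < t ∧ t ≤ z + A then 1 else 0)) * (15 / 13 * (w z * y z)) := by
        refine sum_le_sum fun t ht => ?_
        rw [mem_range] at ht
        rw [mul_sum]
        have hsub : range t ⊆ range T := range_subset_range.2 ht.le
        refine le_trans (sum_le_sum fun z hz => ?_) (sum_le_sum_of_subset_of_nonneg hsub
          fun z _ _ => mul_nonneg (by positivity)
            (mul_nonneg (by norm_num) (mul_nonneg (hw z) (hy z))))
        rw [mem_range] at hz
        simp only [hz, true_and]
        change _ ≤ windowCount A t z * _
        by_cases h : t ≤ z + 4 * A
        · have h1 := mul_le_mul_of_nonneg_right (hwin z t hz h)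
            (mul_nonneg (windowCount_nonneg A t z) (hy z))
          linarith
        · have : windowCount A t z = 0 := by
            unfold windowCount
            rw [if_neg h, if_neg (by omega), add_zero]
          simp [this]
    _ = ∑ z ∈ range T, (∑ t ∈ range T, (if z < t ∧ t ≤ z + 4 * A then (1 : ℝ) else 0)
          + ∑ t ∈ range T, (if z < t ∧ t ≤ z + A then (1 : ℝ) else 0))
            * (15 / 13 * (w z * y z)) := by
        rw [sum_comm]
        refine sum_congr rfl fun z _ => ?_
        rw [← sum_mul, sum_add_distrib]
    _ ≤ ∑ z ∈ range T, 5 * A * (15 / 13 * (w z * y z)) := by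
        refine sum_le_sum fun z _ => mul_le_mul_of_nonneg_right ?_
          (mul_nonneg (by norm_num) (mul_nonneg (hw z) (hy z)))
        have h1 := sum_window_le' (4 * A) T z
        have h2 := sum_window_le' A T z
        push_cast at h1
        linarith
    _ = _ := by rw [mul_sum]; exact sum_congr rfl fun z _ => by ring

theorem norm_add₄_sq_le {E : Type*} [NormedAddCommGroup E] (a b c d : E) :
    ‖a + b + c + d‖ ^ 2 ≤ 4 * (‖a‖ ^ 2 + ‖b‖ ^ 2 + ‖c‖ ^ 2 + ‖d‖ ^ 2) := by
  have h : ‖a + b + c + d‖ ≤ ‖a‖ + ‖b‖ + ‖c‖ + ‖d‖ :=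
    (norm_add_le _ _).trans (add_le_add_left (norm_add₃_le) _)
  have h2 : ‖a + b + c + d‖ ^ 2 ≤ (‖a‖ + ‖b‖ + ‖c‖ + ‖d‖) ^ 2 := by gcongr
  nlinarith [sq_nonneg (‖a‖ - ‖b‖), sq_nonneg (‖a‖ - ‖c‖), sq_nonneg (‖a‖ - ‖d‖),
    sq_nonneg (‖b‖ - ‖c‖), sq_nonneg (‖b‖ - ‖d‖), sq_nonneg (‖c‖ - ‖d‖)]

namespace Instance

variable {d V T : ℕ} {D : Fin V → ℕ}

/-- The expected squared distance of the local model of node `v` to the virtual average. -/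
noncomputable def deviation (S : Instance d V T D) (η : ℝ) (t : ℕ) (v : Fin V) : ℝ :=
  𝔼 ω, ‖S.iterate η ω t v - S.virtual η ω t‖ ^ 2

/-- The consensus error. -/
noncomputable def consensus (S : Instance d V T D) (η : ℝ) (t : ℕ) : ℝ :=
  ∑ v, weight D v * S.deviation η t v

/-- The expected squared norm of the gradient at the virtual average. -/
noncomputable def gradSq (S : Instance d V T D) (η : ℝ) (t : ℕ) : ℝ :=
  𝔼 ω, ‖gradient S.f (S.virtual η ω t)‖ ^ 2

theorem deviation_nonneg (S : Instance d V T D) (η : ℝ) (t : ℕ) (v : Fin V) :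
    0 ≤ S.deviation η t v := expect_nonneg fun _ _ => by positivity

theorem consensus_nonneg (S : Instance d V T D) (η : ℝ) (t : ℕ) : 0 ≤ S.consensus η t :=
  sum_nonneg fun v _ => mul_nonneg (weight_nonneg D v) (S.deviation_nonneg η t v)

theorem gradSq_nonneg (S : Instance d V T D) (η : ℝ) (t : ℕ) : 0 ≤ S.gradSq η t :=
  expect_nonneg fun _ _ => by positivity

variable {S : Instance d V T D} {L σ ζ η : ℝ}

/-- Jensen with the total weight `B`. It needs no orthogonality and pays for this with the extra
factor `B`. -/
theorem expect_norm_sum_smul_sq_le {t : ℕ} {κ : Fin V → ℕ → ℝ} {W : Fin V → ℕ → ℝ}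
    {B : ℝ} (hκ : ∀ u, ∀ z < t, |κ u z| ≤ W u z) (hB : ∑ u, ∑ z ∈ range t, W u z ≤ B)
    (b : Sampling T D → Fin V → ℕ → Model d) (q : Fin V → ℕ → ℝ)
    (hq : ∀ u, ∀ z < t, 𝔼 ω, ‖b ω u z‖ ^ 2 ≤ q u z) :
    𝔼 ω, ‖∑ i ∈ univ ×ˢ range t, κ i.1 i.2 • b ω i.1 i.2‖ ^ 2
      ≤ B * ∑ u, ∑ z ∈ range t, W u z * q u z := by
  have hW : ∀ u, ∀ z < t, 0 ≤ W u z := fun u z hz => (abs_nonneg _).trans (hκ u z hz)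
  have hq0 : ∀ u, ∀ z < t, 0 ≤ q u z := fun u z hz =>
    (expect_nonneg fun _ _ => by positivity).trans (hq u z hz)
  have hs : ∑ i ∈ univ ×ˢ range t, |κ i.1 i.2| ≤ B := by
    rw [sum_product]
    exact (sum_le_sum fun u _ => sum_le_sum fun z hz => hκ u z (mem_range.1 hz)).trans hB
  calc 𝔼 ω, ‖∑ i ∈ univ ×ˢ range t, κ i.1 i.2 • b ω i.1 i.2‖ ^ 2
      ≤ 𝔼 ω, B * ∑ i ∈ univ ×ˢ range t, |κ i.1 i.2| * ‖b ω i.1 i.2‖ ^ 2 := by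
        refine expect_le_expect fun ω _ => (norm_sum_smul_sq_le _ _ _).trans ?_
        exact mul_le_mul_of_nonneg_right hs (sum_nonneg fun _ _ => by positivity)
    _ = B * ∑ i ∈ univ ×ˢ range t, |κ i.1 i.2| * 𝔼 ω, ‖b ω i.1 i.2‖ ^ 2 := by
        rw [← mul_expect, expect_sum_comm]
        simp only [mul_expect]
    _ ≤ B * ∑ u, ∑ z ∈ range t, W u z * q u z := by
        refine mul_le_mul_of_nonneg_left ?_ ((sum_nonneg fun _ _ => abs_nonneg _).trans hs)
        rw [sum_product]
        refine sum_le_sum fun u _ => sum_le_sum fun z hz => ?_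
        rw [mem_range] at hz
        exact mul_le_mul (hκ u z hz) (hq u z hz) (expect_nonneg fun _ _ => by positivity)
          (hW u z hz)

/-- Each stochastic gradient splits into its noise, the diversity at the local model, the change of
`∇f` from the local to the virtual model, and `∇f` at the virtual model. Orthogonality makes the
noise linear in `A`; the other three parts go through Jensen with total weight `5A`. -/
theorem Assumptions.consensus_le (h : S.Assumptions L σ ζ η) (hD : ∀ v, 0 < D v) (hV : 0 < V)
    {t : ℕ} (ht : t ≤ T) :
    S.consensus η t ≤ 4 * η ^ 2 * (5 * S.A * σ ^ 2 + 25 * S.A ^ 2 * ζ ^ 2)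
      + 20 * S.A * η ^ 2 * ∑ z ∈ range t, windowCount S.A t z
        * (L ^ 2 * S.consensus η z + S.gradSq η z) := by
  have : ∀ v, Nonempty (Fin (D v)) := fun v => ⟨⟨0, hD v⟩⟩
  have : Nonempty (Sampling T D) := inferInstanceAs (Nonempty (Fin T → (v : Fin V) → Fin (D v)))
  obtain ⟨κ, hκ1, hκ2, hdev⟩ := S.exists_deviation hD hV h.gap h.lag
  set A : ℝ := (S.A : ℝ) with hA
  let q : Fin V → ℕ → ℝ := fun u z => ζ ^ 2 + L ^ 2 * S.deviation η z u + S.gradSq η z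
  have hv : ∀ v, S.deviation η t v ≤ 4 * η ^ 2 * (5 * A * σ ^ 2
      + 5 * A * ∑ u, ∑ z ∈ range t, window D S.A t v u z * q u z) := by
    intro v
    have hK := sum_window_one_le hD hV S.A t v
    have hκ := hκ2 t ht v
    let b₁ : Sampling T D → Fin V → ℕ → Model d := fun ω u z =>
      gradient (localLoss S.loss u) (S.iterate η ω z u) - gradient S.f (S.iterate η ω z u)
    let b₂ : Sampling T D → Fin V → ℕ → Model d := fun ω u z =>
      gradient S.f (S.iterate η ω z u) - gradient S.f (S.virtual η ω z)
    let b₃ : Sampling T D → Fin V → ℕ → Model d := fun ω _ z => gradient S.f (S.virtual η ω z)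
    have hsplit : ∀ ω, S.iterate η ω t v - S.virtual η ω t
        = η • (∑ i ∈ univ ×ˢ range t, κ t v i.1 i.2 • S.noise η ω i.2 i.1
          + ∑ i ∈ univ ×ˢ range t, κ t v i.1 i.2 • b₁ ω i.1 i.2
          + ∑ i ∈ univ ×ˢ range t, κ t v i.1 i.2 • b₂ ω i.1 i.2
          + ∑ i ∈ univ ×ˢ range t, κ t v i.1 i.2 • b₃ ω i.1 i.2) := by
      intro ω
      rw [hdev η ω t ht v, ← sum_product', ← sum_add_distrib, ← sum_add_distrib,
        ← sum_add_distrib]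
      congr 1
      refine sum_congr rfl fun i _ => ?_
      rw [← smul_add, ← smul_add, ← smul_add]
      congr 1
      simp only [b₁, b₂, b₃, noise]
      abel
    have e0 : 𝔼 ω, ‖∑ i ∈ univ ×ˢ range t, κ t v i.1 i.2 • S.noise η ω i.2 i.1‖ ^ 2
        ≤ 5 * A * σ ^ 2 := by
      refine (h.expect_norm_sum_noise_sq_le hD _ (fun i hi => ?_) _).trans
        (mul_le_mul_of_nonneg_right ?_ (sq_nonneg σ))
      · simp only [mem_product, mem_univ, mem_range, true_and] at hi
        omega
      · rw [sum_product]
        refine (sum_le_sum fun u _ => sum_le_sum fun z hz => ?_).trans hK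
        refine le_trans ?_ (hκ u z (mem_range.1 hz))
        -- As `|κ| ≤ 1`, the sum of the squares is at most the sum of the absolute values, one
        -- factor `5A` instead of two.
        rw [← sq_abs, sq]
        exact mul_le_of_le_one_left (abs_nonneg _) (hκ1 t v u z)
    have e1 := expect_norm_sum_smul_sq_le hκ hK b₁ (fun _ _ => ζ ^ 2) fun u z hz =>
      expect_le univ_nonempty fun ω _ => h.diversity ω z u (by omega)
    have e2 := expect_norm_sum_smul_sq_le hκ hK b₂ (fun u z => L ^ 2 * S.deviation η z u)
      fun u z hz => by
        rw [deviation, mul_expect]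
        refine expect_le_expect fun ω _ => ?_
        rw [← mul_pow]
        have := h.smooth_f hD hV (S.virtual η ω z) (S.iterate η ω z u)
        gcongr
    have e3 := expect_norm_sum_smul_sq_le hκ hK b₃ (fun _ z => S.gradSq η z) fun u z hz => le_rfl
    have e4 : S.deviation η t v ≤ 4 * η ^ 2 * (
        𝔼 ω, ‖∑ i ∈ univ ×ˢ range t, κ t v i.1 i.2 • S.noise η ω i.2 i.1‖ ^ 2
        + 𝔼 ω, ‖∑ i ∈ univ ×ˢ range t, κ t v i.1 i.2 • b₁ ω i.1 i.2‖ ^ 2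
        + 𝔼 ω, ‖∑ i ∈ univ ×ˢ range t, κ t v i.1 i.2 • b₂ ω i.1 i.2‖ ^ 2
        + 𝔼 ω, ‖∑ i ∈ univ ×ˢ range t, κ t v i.1 i.2 • b₃ ω i.1 i.2‖ ^ 2) := by
      rw [deviation, ← expect_add_distrib, ← expect_add_distrib, ← expect_add_distrib,
        mul_expect]
      refine expect_le_expect fun ω _ => ?_
      rw [hsplit, norm_smul, mul_pow, Real.norm_eq_abs, sq_abs]
      have := mul_le_mul_of_nonneg_left (norm_add₄_sq_le
        (∑ i ∈ univ ×ˢ range t, κ t v i.1 i.2 • S.noise η ω i.2 i.1)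
        (∑ i ∈ univ ×ˢ range t, κ t v i.1 i.2 • b₁ ω i.1 i.2)
        (∑ i ∈ univ ×ˢ range t, κ t v i.1 i.2 • b₂ ω i.1 i.2)
        (∑ i ∈ univ ×ˢ range t, κ t v i.1 i.2 • b₃ ω i.1 i.2)) (sq_nonneg η)
      linarith
    refine e4.trans (mul_le_mul_of_nonneg_left ?_ (by positivity))
    have e5 : ∑ u, ∑ z ∈ range t, window D S.A t v u z * q u z
        = ∑ u, ∑ z ∈ range t, window D S.A t v u z * ζ ^ 2
          + ∑ u, ∑ z ∈ range t, window D S.A t v u z * (L ^ 2 * S.deviation η z u)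
          + ∑ u, ∑ z ∈ range t, window D S.A t v u z * S.gradSq η z := by
      simp only [q, mul_add, sum_add_distrib]
    rw [e5]
    linarith
  have hsum : S.consensus η t ≤ ∑ v, weight D v * (4 * η ^ 2 * (5 * A * σ ^ 2
      + 5 * A * ∑ u, ∑ z ∈ range t, window D S.A t v u z * q u z)) :=
    sum_le_sum fun v _ => mul_le_mul_of_nonneg_left (hv v) (weight_nonneg D v)
  have hexp : ∑ v, weight D v * (4 * η ^ 2 * (5 * A * σ ^ 2
      + 5 * A * ∑ u, ∑ z ∈ range t, window D S.A t v u z * q u z))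
      = 4 * η ^ 2 * (5 * A * σ ^ 2 + 5 * A * ∑ z ∈ range t, windowCount S.A t z
        * ∑ u, weight D u * q u z) := by
    rw [← sum_weight_mul_sum_window hD hV]
    have : ∀ v, weight D v * (4 * η ^ 2 * (5 * A * σ ^ 2
      + 5 * A * ∑ u, ∑ z ∈ range t, window D S.A t v u z * q u z))
      = weight D v * (4 * η ^ 2 * (5 * A * σ ^ 2)) + 4 * η ^ 2 * (5 * A) * (weight D v
        * ∑ u, ∑ z ∈ range t, window D S.A t v u z * q u z) := fun v => by ring
    simp only [this, sum_add_distrib, ← sum_mul, ← mul_sum, sum_weight hD hV]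
    ring
  have hq : ∀ z, ∑ u, weight D u * q u z
      = ζ ^ 2 + (L ^ 2 * S.consensus η z + S.gradSq η z) := by
    intro z
    simp only [q, mul_add, sum_add_distrib, ← sum_mul, sum_weight hD hV, consensus, mul_sum]
    rw [one_mul, one_mul, add_assoc]
    congr 2
    exact sum_congr rfl fun u _ => by ring
  rw [hexp] at hsum
  simp only [hq, mul_add (windowCount _ _ _) (ζ ^ 2), sum_add_distrib, ← sum_mul] at hsum
  have hcount := sum_windowCount_le S.A t
  have hA0 : 0 ≤ A := Nat.cast_nonneg _
  have h1 : 4 * η ^ 2 * (5 * A * ((∑ z ∈ range t, windowCount S.A t z) * ζ ^ 2))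
      ≤ 4 * η ^ 2 * (5 * A * ((5 * A) * ζ ^ 2)) := by gcongr
  linarith

/-- The weighted consensus error is controlled by the gradients along the virtual average. -/
theorem Assumptions.sum_consensus_le (h : S.Assumptions L σ ζ η) (hD : ∀ v, 0 < D v) (hV : 0 < V)
    (hL : 0 < L) (hη : 0 < η) (hηL : η * L * S.A ≤ 1 / 30) {w : ℕ → ℝ} (hw : ∀ t, 0 ≤ w t)
    (hwin : ∀ z t, z < t → t ≤ z + 4 * S.A → w t ≤ 15 / 13 * w z) :
    ∑ t ∈ range T, w t * (L ^ 2 * S.consensus η t)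
      ≤ 5 / 34 * ∑ t ∈ range T, w t * S.gradSq η t
        + 125 * η ^ 2 * L ^ 2 * (σ ^ 2 * S.A + ζ ^ 2 * S.A ^ 2) * ∑ t ∈ range T, w t := by
  set A : ℝ := (S.A : ℝ) with hA
  have hA0 : 0 ≤ A := Nat.cast_nonneg _
  set P := ∑ t ∈ range T, w t * (L ^ 2 * S.consensus η t) with hP
  set Q := ∑ t ∈ range T, w t * S.gradSq η t with hQ
  set W := ∑ t ∈ range T, w t with hW
  have hP0 : 0 ≤ P := sum_nonneg fun t _ =>
    mul_nonneg (hw t) (mul_nonneg (sq_nonneg L) (S.consensus_nonneg η t))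
  have hQ0 : 0 ≤ Q := sum_nonneg fun t _ => mul_nonneg (hw t) (S.gradSq_nonneg η t)
  have hW0 : 0 ≤ W := sum_nonneg fun t _ => hw t
  have h1 : P ≤ L ^ 2 * (4 * η ^ 2 * (5 * A * σ ^ 2 + 25 * A ^ 2 * ζ ^ 2)) * W
      + L ^ 2 * (20 * A * η ^ 2) * ∑ t ∈ range T, w t * ∑ z ∈ range t, windowCount S.A t z
        * (L ^ 2 * S.consensus η z + S.gradSq η z) := by
    rw [hP, hW, mul_sum, mul_sum, ← sum_add_distrib]
    refine sum_le_sum fun t ht => ?_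
    have h2 := mul_le_mul_of_nonneg_left (h.consensus_le hD hV (mem_range.1 ht).le)
      (mul_nonneg (hw t) (sq_nonneg L))
    linarith
  have h2 := sum_windowCount_mul_le (T := T) hw (fun z => add_nonneg
    (mul_nonneg (sq_nonneg L) (S.consensus_nonneg η z)) (S.gradSq_nonneg η z)) hwin
  have h3 : ∑ z ∈ range T, w z * (L ^ 2 * S.consensus η z + S.gradSq η z) = P + Q := by
    simp only [mul_add, sum_add_distrib, hP, hQ]
  rw [h3] at h2
  have h4 := h1.trans (add_le_add_right (mul_le_mul_of_nonneg_left h2 (by positivity)) _)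
  -- The feedback factor is at most `20 * 5 * (15/13) / 900 = 5/39`. Moving `5/39 * P` to the left
  -- gives `5/34` in front of `Q`, and `100 * 39/34 ≤ 125` covers the constant term.
  have h5 : (η * L * A) ^ 2 ≤ (1 / 30) ^ 2 := by gcongr
  have h6 := mul_le_mul_of_nonneg_right h5 (add_nonneg hP0 hQ0)
  have h7 : 0 ≤ η ^ 2 * L ^ 2 * (σ ^ 2 * A) * W := by positivity
  have h8 : 0 ≤ η ^ 2 * L ^ 2 * (ζ ^ 2 * A ^ 2) * W := by positivity
  nlinarith

end Instance

/-! ### One step of the virtual average -/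

theorem concentration_nonneg {V : ℕ} (D : Fin V → ℕ) : 0 ≤ concentration D :=
  sum_nonneg fun _ _ => sq_nonneg _

namespace Instance

variable {d V T : ℕ} {D : Fin V → ℕ}

/-- The weighted average of the gradients of the local losses at the local models. -/
noncomputable def meanGrad (S : Instance d V T D) (η : ℝ) (ω : Sampling T D) (t : ℕ) : Model d :=
  ∑ v, weight D v • gradient (localLoss S.loss v) (S.iterate η ω t v)

/-- The weighted average of the noise of the stochastic gradients. -/
noncomputable def meanNoise (S : Instance d V T D) (η : ℝ) (ω : Sampling T D) (t : ℕ) : Model d :=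
  ∑ v, weight D v • S.noise η ω t v

/-- The weighted average of the squared distances of the local models to the virtual average. -/
noncomputable def spread (S : Instance d V T D) (η : ℝ) (ω : Sampling T D) (t : ℕ) : ℝ :=
  ∑ v, weight D v * ‖S.iterate η ω t v - S.virtual η ω t‖ ^ 2

theorem virtual_succ' (S : Instance d V T D) (η : ℝ) (ω : Sampling T D) (t : ℕ) :
    S.virtual η ω (t + 1) = S.virtual η ω t - η • (S.meanGrad η ω t + S.meanNoise η ω t) := by
  rw [virtual_succ, meanGrad, meanNoise, ← sum_add_distrib]
  congr 2
  refine sum_congr rfl fun v _ => ?_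
  rw [← smul_add, noise, add_sub_cancel]

theorem expect_spread (S : Instance d V T D) (η : ℝ) (t : ℕ) :
    𝔼 ω, S.spread η ω t = S.consensus η t := by
  simp only [spread, consensus, deviation, expect_sum_comm, mul_expect]

theorem norm_sum_weight_smul_sq_le (hD : ∀ v, 0 < D v) (hV : 0 < V) {E : Type*}
    [NormedAddCommGroup E] [InnerProductSpace ℝ E] (b : Fin V → E) :
    ‖∑ v, weight D v • b v‖ ^ 2 ≤ ∑ v, weight D v * ‖b v‖ ^ 2 := by
  have := norm_sum_smul_sq_le univ (weight D) b
  simpa only [abs_of_nonneg (weight_nonneg D _), sum_weight hD hV, one_mul] using this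

theorem norm_nodeAverage_sub_sq_le (S : Instance d V T D) (hD : ∀ v, 0 < D v) (hV : 0 < V) (η : ℝ)
    (ω : Sampling T D) (t : ℕ) :
    ‖S.nodeAverage η ω t - S.virtual η ω t‖ ^ 2 ≤ S.spread η ω t := by
  have : S.nodeAverage η ω t - S.virtual η ω t
      = ∑ v, weight D v • (S.iterate η ω t v - S.virtual η ω t) := by
    simp only [smul_sub, sum_sub_distrib, ← sum_smul, sum_weight hD hV, one_smul, nodeAverage]
  rw [this]
  exact norm_sum_weight_smul_sq_le hD hV _

variable {S : Instance d V T D} {L σ ζ η μ : ℝ}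

theorem Assumptions.norm_gradient_sub_meanGrad_sq_le (h : S.Assumptions L σ ζ η)
    (hD : ∀ v, 0 < D v) (hV : 0 < V) (ω : Sampling T D) (t : ℕ) :
    ‖gradient S.f (S.virtual η ω t) - S.meanGrad η ω t‖ ^ 2 ≤ L ^ 2 * S.spread η ω t := by
  rw [h.gradient_f hD, meanGrad, ← sum_sub_distrib, spread, mul_sum]
  simp only [← smul_sub]
  refine (norm_sum_weight_smul_sq_le hD hV _).trans (sum_le_sum fun v _ => ?_)
  rw [mul_left_comm, ← mul_pow, norm_sub_rev]
  have := h.smooth v (S.virtual η ω t) (S.iterate η ω t v)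
  have := weight_nonneg D v
  gcongr

theorem Assumptions.expect_inner_meanNoise (h : S.Assumptions L σ ζ η) (hD : ∀ v, 0 < D v)
    {t : ℕ} (ht : t < T) (X : Sampling T D → Model d)
    (hX : ∀ u ω i, X (resample ω ⟨t, ht⟩ u i) = X ω) :
    𝔼 ω, ⟪X ω, S.meanNoise η ω t⟫ = 0 := by
  simp only [meanNoise, inner_sum, real_inner_smul_right, expect_sum_comm]
  refine sum_eq_zero fun u _ => ?_
  rw [← mul_expect, h.expect_inner_noise hD ⟨t, ht⟩ u X (hX u), mul_zero]

theorem meanGrad_resample (S : Instance d V T D) (η : ℝ) {t : ℕ} (ht : t < T) (u : Fin V)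
    (ω : Sampling T D) (i : Fin (D u)) :
    S.meanGrad η (resample ω ⟨t, ht⟩ u i) t = S.meanGrad η ω t := by
  unfold meanGrad
  refine sum_congr rfl fun v _ => ?_
  rw [S.iterate_resample (z := ⟨t, ht⟩) η ω i le_rfl]

theorem Assumptions.expect_norm_meanNoise_sq_le (h : S.Assumptions L σ ζ η) (hD : ∀ v, 0 < D v)
    {t : ℕ} (ht : t < T) : 𝔼 ω, ‖S.meanNoise η ω t‖ ^ 2 ≤ concentration D * σ ^ 2 := by
  have h1 := h.expect_norm_sum_noise_sq_le hD (univ ×ˢ {t})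
    (fun i hi => by simp only [mem_product, mem_univ, mem_singleton, true_and] at hi; omega)
    fun i => weight D i.1
  simpa only [sum_product, sum_singleton, meanNoise, concentration] using h1

/-- The second moment of a stochastic gradient step. -/
theorem Assumptions.expect_norm_add_sq_le (h : S.Assumptions L σ ζ η) (hD : ∀ v, 0 < D v)
    {t : ℕ} (ht : t < T) :
    𝔼 ω, ‖S.meanGrad η ω t + S.meanNoise η ω t‖ ^ 2
      ≤ 𝔼 ω, ‖S.meanGrad η ω t‖ ^ 2 + concentration D * σ ^ 2 := by
  simp only [norm_add_sq_real, expect_add_distrib, ← mul_expect]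
  rw [h.expect_inner_meanNoise hD ht (fun ω => S.meanGrad η ω t)
    fun u ω i => S.meanGrad_resample η ht u ω i]
  linarith [h.expect_norm_meanNoise_sq_le hD ht]

/-- The smoothness inequality along the virtual step. Polarizing the inner product of `∇f` with the
mean gradient produces the bias and a term `-η/2 * ‖meanGrad‖²`, which absorbs the quadratic
remainder when `ηL ≤ 1`. -/
theorem Assumptions.descent (h : S.Assumptions L σ ζ η) (hD : ∀ v, 0 < D v) (hV : 0 < V)
    (hL : 0 < L) (hη : 0 < η) (hηL : η * L ≤ 1) {t : ℕ} (ht : t < T) :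
    𝔼 ω, S.f (S.virtual η ω (t + 1)) ≤ 𝔼 ω, S.f (S.virtual η ω t) - η / 2 * S.gradSq η t
      + η / 2 * (L ^ 2 * S.consensus η t) + L * η ^ 2 / 2 * (concentration D * σ ^ 2) := by
  have hpt : ∀ ω, S.f (S.virtual η ω (t + 1)) ≤ S.f (S.virtual η ω t)
      - η / 2 * ‖gradient S.f (S.virtual η ω t)‖ ^ 2 + η / 2 * (L ^ 2 * S.spread η ω t)
      - η / 2 * ‖S.meanGrad η ω t‖ ^ 2
      - η * ⟪gradient S.f (S.virtual η ω t), S.meanNoise η ω t⟫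
      + L * η ^ 2 / 2 * ‖S.meanGrad η ω t + S.meanNoise η ω t‖ ^ 2 := by
    intro ω
    have h1 := le_add_inner_gradient_add h.differentiable_f (h.smooth_f hD hV)
      (S.virtual η ω t) (S.virtual η ω (t + 1))
    rw [virtual_succ', sub_sub_cancel_left, inner_neg_right, real_inner_smul_right, norm_neg,
      norm_smul, Real.norm_of_nonneg hη.le, mul_pow, inner_add_right] at h1
    have h2 := h.norm_gradient_sub_meanGrad_sq_le hD hV ω t
    rw [norm_sub_sq_real] at h2
    have h3 := mul_le_mul_of_nonneg_left h2 hη.le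
    rw [virtual_succ']
    linarith
  have h1 := expect_le_expect (s := univ) fun ω _ => hpt ω
  simp only [expect_add_distrib, expect_sub_distrib, ← mul_expect] at h1
  rw [h.expect_inner_meanNoise hD ht (fun ω => gradient S.f (S.virtual η ω t))
    fun u ω i => by rw [S.virtual_resample (z := ⟨t, ht⟩) η ω i le_rfl], expect_spread] at h1
  have h2 := h.expect_norm_add_sq_le hD ht
  have h3 := mul_le_mul_of_nonneg_left h2 (by positivity : 0 ≤ L * η ^ 2 / 2)
  have h4 : 0 ≤ 𝔼 ω, ‖S.meanGrad η ω t‖ ^ 2 := expect_nonneg fun _ _ => by positivity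
  have h5 : (η * L) * (η / 2 * 𝔼 ω, ‖S.meanGrad η ω t‖ ^ 2)
      ≤ 1 * (η / 2 * 𝔼 ω, ‖S.meanGrad η ω t‖ ^ 2) :=
    mul_le_mul_of_nonneg_right hηL (by positivity)
  unfold gradSq
  nlinarith

theorem Convex.global (hc : S.Convex μ) (h : S.Assumptions L σ ζ η) (hD : ∀ v, 0 < D v)
    (hV : 0 < V) (x y : Model d) :
    S.f x + ⟪gradient S.f x, y - x⟫ + μ / 2 * ‖y - x‖ ^ 2 ≤ S.f y := by
  rw [S.f_eq_sum hD, S.f_eq_sum hD, h.gradient_f hD, sum_inner]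
  calc _ = ∑ v, weight D v * (localLoss S.loss v x + ⟪gradient (localLoss S.loss v) x, y - x⟫
        + μ / 2 * ‖y - x‖ ^ 2) := by
        simp only [mul_add, sum_add_distrib, ← sum_mul, sum_weight hD hV, one_mul,
          real_inner_smul_left]
    _ ≤ _ := sum_le_sum fun v _ => mul_le_mul_of_nonneg_left (hc v x y) (weight_nonneg D v)

theorem gradient_eq_zero_of_min {E : Type*} [NormedAddCommGroup E] [InnerProductSpace ℝ E]
    [CompleteSpace E] {f : E → ℝ} {x : E} (hx : ∀ y, f x ≤ f y) : gradient f x = 0 := by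
  have : IsLocalMin f x := Filter.Eventually.of_forall hx
  rw [gradient, this.fderiv_eq_zero, map_zero]

/-- Progress towards a minimizer of the mean of a stochastic gradient step. -/
theorem Convex.le_inner_meanGrad (hc : S.Convex μ) (h : S.Assumptions L σ ζ η)
    (hD : ∀ v, 0 < D v) (hV : 0 < V) (hμ : 0 ≤ μ) (y : Model d) (ω : Sampling T D) (t : ℕ) :
    S.f (S.virtual η ω t) - S.f y - (L + μ) / 2 * S.spread η ω t
      + μ / 4 * ‖S.virtual η ω t - y‖ ^ 2 ≤ ⟪S.meanGrad η ω t, S.virtual η ω t - y⟫ := by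
  have hv : ∀ v, localLoss S.loss v (S.virtual η ω t) - localLoss S.loss v y
      - (L + μ) / 2 * ‖S.iterate η ω t v - S.virtual η ω t‖ ^ 2
      + μ / 4 * ‖S.virtual η ω t - y‖ ^ 2
      ≤ ⟪gradient (localLoss S.loss v) (S.iterate η ω t v), S.virtual η ω t - y⟫ := by
    intro v
    set x := S.iterate η ω t v
    set a := S.virtual η ω t
    have h1 := hc v x y
    -- The vector `a - y` is split at the local model `x`: smoothness handles the part from `x` to
    -- `a`, and convexity at `x` the part towards `y`.
    have h2 := le_add_inner_gradient_add (h.differentiable_localLoss v) (h.smooth v) x a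
    have h3 : ⟪gradient (localLoss S.loss v) x, a - y⟫
        = ⟪gradient (localLoss S.loss v) x, a - x⟫ - ⟪gradient (localLoss S.loss v) x, y - x⟫ := by
      rw [← inner_sub_right]; congr 1; abel
    have h4 : ‖a - y‖ ^ 2 ≤ 2 * (‖x - a‖ ^ 2 + ‖y - x‖ ^ 2) := by
      have : a - y = -((x - a) + (y - x)) := by abel
      rw [this, norm_neg]
      exact (by gcongr; exact norm_add_le _ _ : ‖(x - a) + (y - x)‖ ^ 2
        ≤ (‖x - a‖ + ‖y - x‖) ^ 2).trans (add_sq_le)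
    have h5 := mul_le_mul_of_nonneg_left h4 (by positivity : 0 ≤ μ / 4)
    rw [norm_sub_rev a x] at h2
    rw [h3]
    linarith
  have := sum_le_sum fun v (_ : v ∈ univ) => mul_le_mul_of_nonneg_left (hv v) (weight_nonneg D v)
  refine le_trans (le_of_eq ?_) (this.trans (le_of_eq ?_))
  · simp only [mul_add, mul_sub, sum_add_distrib, sum_sub_distrib, ← sum_mul, sum_weight hD hV,
      one_mul, S.f_eq_sum hD, spread, mul_sum]
    congr 2
    exact sum_congr rfl fun v _ => by ring
  · simp only [meanGrad, sum_inner, real_inner_smul_left]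

/-- Expansion of the square. Of the gain `2η * e`, where `e` is the gap `f - f(y)` at the virtual
model, one half buys the missing half of the factor `1 - μη` by quadratic growth, and `2/15` of `η *
e` pays for the squared mean gradient, so `13/15` is left. -/
theorem Convex.contraction (hc : S.Convex μ) (h : S.Assumptions L σ ζ η)
    (hD : ∀ v, 0 < D v) (hV : 0 < V) (hμ : 0 ≤ μ) (hμL : μ ≤ L) (hL : 0 < L) (hη : 0 < η)
    (hηL : η * L ≤ 1 / 30) {y : Model d} (hy : ∀ x, S.f y ≤ S.f x) {t : ℕ} (ht : t < T) :
    𝔼 ω, ‖S.virtual η ω (t + 1) - y‖ ^ 2 ≤ (1 - μ * η) * 𝔼 ω, ‖S.virtual η ω t - y‖ ^ 2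
      - 13 / 15 * η * 𝔼 ω, (S.f (S.virtual η ω t) - S.f y)
      + 31 / 15 * η * (L * S.consensus η t) + η ^ 2 * (concentration D * σ ^ 2) := by
  have hpt : ∀ ω, ‖S.virtual η ω (t + 1) - y‖ ^ 2 ≤ (1 - μ * η) * ‖S.virtual η ω t - y‖ ^ 2
      - 13 / 15 * η * (S.f (S.virtual η ω t) - S.f y)
      + 31 / 15 * η * (L * S.spread η ω t) - η ^ 2 * ‖S.meanGrad η ω t‖ ^ 2
      - 2 * η * ⟪S.virtual η ω t - y, S.meanNoise η ω t⟫
      + η ^ 2 * ‖S.meanGrad η ω t + S.meanNoise η ω t‖ ^ 2 := by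
    intro ω
    set a := S.virtual η ω t with ha
    set e := S.f a - S.f y with he
    set δ := S.spread η ω t with hδ
    have hδ0 : 0 ≤ δ := sum_nonneg fun v _ => mul_nonneg (weight_nonneg D v) (sq_nonneg _)
    have he0 : 0 ≤ e := sub_nonneg.2 (hy a)
    have h1 : ‖S.virtual η ω (t + 1) - y‖ ^ 2 = ‖a - y‖ ^ 2
        - 2 * η * ⟪S.meanGrad η ω t, a - y⟫ - 2 * η * ⟪a - y, S.meanNoise η ω t⟫
        + η ^ 2 * ‖S.meanGrad η ω t + S.meanNoise η ω t‖ ^ 2 := by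
      rw [virtual_succ', sub_right_comm, norm_sub_sq_real, real_inner_smul_right, inner_add_right,
        norm_smul, Real.norm_of_nonneg hη.le, mul_pow, real_inner_comm (S.meanGrad η ω t)]
      ring
    have h2 := hc.le_inner_meanGrad h hD hV hμ y ω t
    have h3 : ‖S.meanGrad η ω t‖ ^ 2 ≤ 4 * L * e + 2 * (L ^ 2 * δ) := by
      have e1 := norm_gradient_sq_le h.differentiable_f hL (h.smooth_f hD hV) hy a
      have e2 := h.norm_gradient_sub_meanGrad_sq_le hD hV ω t
      have e3 : ‖S.meanGrad η ω t‖ ≤ ‖gradient S.f a‖ + ‖gradient S.f a - S.meanGrad η ω t‖ := by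
        have := norm_sub_le (gradient S.f a) (gradient S.f a - S.meanGrad η ω t)
        rwa [sub_sub_cancel] at this
      have e4 : ‖S.meanGrad η ω t‖ ^ 2
          ≤ (‖gradient S.f a‖ + ‖gradient S.f a - S.meanGrad η ω t‖) ^ 2 := by gcongr
      have e5 := e4.trans add_sq_le
      linarith
    have h4 : μ / 2 * ‖a - y‖ ^ 2 ≤ e := by
      have := hc.global h hD hV y a
      rw [gradient_eq_zero_of_min hy, inner_zero_left] at this
      linarith
    have h5 := mul_le_mul_of_nonneg_left h2 hη.le
    have h6 := mul_le_mul_of_nonneg_left h3 (sq_nonneg η)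
    have h7 := mul_le_mul_of_nonneg_left h4 hη.le
    have h8 := mul_le_mul_of_nonneg_right hηL (mul_nonneg hη.le he0)
    have h9 := mul_le_mul_of_nonneg_right hηL (mul_nonneg (mul_nonneg hη.le hL.le) hδ0)
    have h10 := mul_le_mul_of_nonneg_right hμL (mul_nonneg hη.le hδ0)
    rw [h1]
    simp only [← ha, ← he, ← hδ] at h5
    have h11 : η ^ 2 * ‖S.meanGrad η ω t‖ ^ 2 ≤ 2 / 15 * (η * e) + 1 / 15 * (η * L * δ) := by
      nlinarith
    linarith
  have h1 := expect_le_expect (s := univ) fun ω _ => hpt ω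
  simp only [expect_add_distrib, expect_sub_distrib, ← mul_expect] at h1
  rw [h.expect_inner_meanNoise hD ht (fun ω => S.virtual η ω t - y)
    fun u ω i => by rw [S.virtual_resample (z := ⟨t, ht⟩) η ω i le_rfl], expect_spread] at h1
  have h2 := mul_le_mul_of_nonneg_left (h.expect_norm_add_sq_le hD ht) (sq_nonneg η)
  rw [expect_sub_distrib]
  linarith

end Instance

namespace Instance

variable {d V T : ℕ} {D : Fin V → ℕ} {S : Instance d V T D} {L σ ζ η μ : ℝ}

/-! ### Bounds for a given learning rate -/

@[simp] theorem virtual_zero (S : Instance d V T D) (η : ℝ) (ω : Sampling T D) :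
    S.virtual η ω 0 = S.x₀ := by
  simp [virtual]

theorem nonempty_sampling (hD : ∀ v, 0 < D v) : Nonempty (Sampling T D) :=
  ⟨fun _ v => ⟨0, hD v⟩⟩

/-- Telescoped descent bounds the gradients along the virtual average by the consensus error, which
in turn is at most `5/34` of them plus a constant term. Smoothness then passes from the virtual
average to the node average. -/
theorem Assumptions.sum_norm_gradient_sq_le (h : S.Assumptions L σ ζ η) (hD : ∀ v, 0 < D v)
    (hV : 0 < V) (hT : 0 < T) (hL : 0 < L) (hA : 0 < S.A) (hη : 0 < η)
    (hηL : η * L * S.A ≤ 1 / 30) {F m : ℝ} (hm : ∀ x, m ≤ S.f x) (hF : S.f S.x₀ - m ≤ F) :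
    (1 / (T : ℝ)) * ∑ t ∈ range T, (𝔼 ω, ‖gradient S.f (S.nodeAverage η ω t)‖ ^ 2)
      ≤ 600 * (F / T / η + L * (concentration D * σ ^ 2) * η
        + L ^ 2 * (σ ^ 2 * S.A + ζ ^ 2 * S.A ^ 2) * η ^ 2) := by
  have hne := nonempty_sampling (T := T) hD
  have hA1 : (1 : ℝ) ≤ S.A := by exact_mod_cast hA
  have hηL1 : η * L ≤ 1 / 30 := (le_mul_of_one_le_right (by positivity) hA1).trans hηL
  set Γ : ℝ := σ ^ 2 * S.A + ζ ^ 2 * S.A ^ 2 with hΓ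
  set N : ℝ := concentration D * σ ^ 2 with hN
  have hN0 : 0 ≤ N := mul_nonneg (concentration_nonneg D) (sq_nonneg σ)
  have hΓ0 : 0 ≤ Γ := by positivity
  set Q := ∑ t ∈ range T, S.gradSq η t with hQ
  set P := ∑ t ∈ range T, L ^ 2 * S.consensus η t with hP
  have hQ0 : 0 ≤ Q := sum_nonneg fun t _ => S.gradSq_nonneg η t
  have hPQ : P ≤ 5 / 34 * Q + 125 * η ^ 2 * L ^ 2 * Γ * T := by
    have := h.sum_consensus_le hD hV hL hη hηL (w := fun _ => 1) (fun _ => zero_le_one)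
      (fun _ _ _ _ => by norm_num)
    simpa using this
  have htel : ∀ n ≤ T, 𝔼 ω, S.f (S.virtual η ω n) + η / 2 * ∑ t ∈ range n, S.gradSq η t
      ≤ S.f S.x₀ + η / 2 * ∑ t ∈ range n, L ^ 2 * S.consensus η t
        + n * (L * η ^ 2 / 2 * N) := by
    intro n
    induction n with
    | zero => simp
    | succ n ih =>
      intro hn
      have h1 := ih (by omega)
      have h2 := h.descent hD hV hL hη (by linarith) (t := n) (by omega)
      rw [sum_range_succ, sum_range_succ]
      push_cast
      linarith
  have h1 := htel T le_rfl
  have h2 : m ≤ 𝔼 ω, S.f (S.virtual η ω T) := le_expect univ_nonempty fun ω _ => hm _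
  have h3 : η / 2 * Q ≤ F + η / 2 * P + T * (L * η ^ 2 / 2 * N) := by linarith
  have h4 : Q ≤ 2 * (F / η) + P + T * (L * η * N) := by
    have : η / 2 * Q ≤ η / 2 * (2 * (F / η) + P + T * (L * η * N)) := by
      refine h3.trans (le_of_eq ?_)
      field_simp
    exact le_of_mul_le_mul_left this (by positivity)
  have h5 : ∑ t ∈ range T, (𝔼 ω, ‖gradient S.f (S.nodeAverage η ω t)‖ ^ 2) ≤ 2 * Q + 2 * P := by
    rw [hQ, hP, mul_sum, mul_sum, ← sum_add_distrib]
    refine sum_le_sum fun t _ => ?_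
    rw [gradSq, ← expect_spread, mul_expect, mul_expect, mul_expect, ← expect_add_distrib]
    refine expect_le_expect fun ω _ => ?_
    have e1 := h.smooth_f hD hV (S.virtual η ω t) (S.nodeAverage η ω t)
    have e2 : ‖gradient S.f (S.nodeAverage η ω t) - gradient S.f (S.virtual η ω t)‖ ^ 2
        ≤ L ^ 2 * S.spread η ω t := by
      calc _ ≤ (L * ‖S.nodeAverage η ω t - S.virtual η ω t‖) ^ 2 := by gcongr
        _ = L ^ 2 * ‖S.nodeAverage η ω t - S.virtual η ω t‖ ^ 2 := by ring
        _ ≤ _ := mul_le_mul_of_nonneg_left (S.norm_nodeAverage_sub_sq_le hD hV η ω t)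
          (sq_nonneg L)
    have e3 := norm_add_le (gradient S.f (S.virtual η ω t))
      (gradient S.f (S.nodeAverage η ω t) - gradient S.f (S.virtual η ω t))
    rw [add_sub_cancel] at e3
    have e4 : ‖gradient S.f (S.nodeAverage η ω t)‖ ^ 2 ≤ (‖gradient S.f (S.virtual η ω t)‖
      + ‖gradient S.f (S.nodeAverage η ω t) - gradient S.f (S.virtual η ω t)‖) ^ 2 := by gcongr
    have e5 := e4.trans add_sq_le
    linarith
  have hT' : (0 : ℝ) < T := by exact_mod_cast hT
  have hF0 : 0 ≤ F := by linarith [hm S.x₀]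
  have k1 : 0 ≤ F / η := by positivity
  have k2 : 0 ≤ T * (L * η * N) := by positivity
  have k3 : 0 ≤ η ^ 2 * L ^ 2 * Γ * T := by positivity
  have h6 : ∑ t ∈ range T, (𝔼 ω, ‖gradient S.f (S.nodeAverage η ω t)‖ ^ 2)
      ≤ 600 * (F / η + T * (L * η * N) + η ^ 2 * L ^ 2 * Γ * T) := by linarith
  calc _ ≤ 1 / (T : ℝ) * (600 * (F / η + T * (L * η * N) + η ^ 2 * L ^ 2 * Γ * T)) := by gcongr
    _ = _ := by field_simp

/-- Jensen by way of the tangent plane at the average, where the linear terms cancel. -/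
theorem Convex.f_timeAverage_le (hc : S.Convex μ) (hμ : 0 ≤ μ) (h : S.Assumptions L σ ζ η)
    (hD : ∀ v, 0 < D v) (hV : 0 < V) {w : ℕ → ℝ} (hW : 0 < ∑ t ∈ range T, w t)
    (hw : ∀ t, 0 ≤ w t) (ω : Sampling T D) :
    (∑ t ∈ range T, w t) * S.f (S.timeAverage w η ω)
      ≤ ∑ t ∈ range T, w t * S.f (S.nodeAverage η ω t) := by
  set x := S.timeAverage w η ω with hx
  have h1 : ∀ t, w t * S.f x + w t * ⟪gradient S.f x, S.nodeAverage η ω t - x⟫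
      ≤ w t * S.f (S.nodeAverage η ω t) := by
    intro t
    rw [← mul_add]
    refine mul_le_mul_of_nonneg_left ?_ (hw t)
    have := hc.global h hD hV x (S.nodeAverage η ω t)
    have : 0 ≤ μ / 2 * ‖S.nodeAverage η ω t - x‖ ^ 2 := by positivity
    linarith
  have h2 := sum_le_sum fun t (_ : t ∈ range T) => h1 t
  rw [sum_add_distrib, ← sum_mul] at h2
  have h3 : ∑ t ∈ range T, w t * ⟪gradient S.f x, S.nodeAverage η ω t - x⟫ = 0 := by
    simp_rw [← real_inner_smul_right]
    rw [← inner_sum]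
    simp only [smul_sub, sum_sub_distrib, ← sum_smul]
    rw [hx, timeAverage, smul_smul, mul_one_div_cancel hW.ne', one_smul, sub_self,
      inner_zero_right]
  linarith

theorem inv_pow_le_of_window {θ : ℝ} {A : ℕ} (hθ : 0 < θ) (hθA : (1 - θ) * A ≤ 1 / 30) {z t : ℕ}
    (hθ1 : θ ≤ 1) (hz : z < t) (ht : t ≤ z + 4 * A) :
    (θ ^ (t + 1))⁻¹ ≤ 15 / 13 * (θ ^ (z + 1))⁻¹ := by
  obtain ⟨k, rfl⟩ := Nat.exists_eq_add_of_lt hz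
  have h1 : 13 / 15 ≤ θ ^ (k + 1) := by
    -- Bernoulli: over at most `4A` steps the power loses at most `4A(1 - θ) ≤ 4/30`, whence
    -- `13/15`.
    have h2 := one_add_mul_le_pow (a := θ - 1) (by linarith) (k + 1)
    rw [add_sub_cancel] at h2
    refine le_trans ?_ h2
    have h3 : ((k + 1 : ℕ) : ℝ) ≤ 4 * A := by exact_mod_cast (by omega : k + 1 ≤ 4 * A)
    have h4 := mul_le_mul_of_nonneg_right h3 (sub_nonneg.2 hθ1)
    linarith
  rw [show z + k + 1 + 1 = (z + 1) + (k + 1) by ring, pow_add, mul_inv, mul_comm]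
  refine mul_le_mul_of_nonneg_right ?_ (by positivity)
  rw [inv_le_comm₀ (by positivity) (by norm_num)]
  linarith

/-- The weights `(1 - μη)^{-(t+1)}` make the contraction telescope. They are `1` when `μ = 0`, so
the convex and the strongly convex case are treated together. -/
theorem Convex.f_timeAverage_sub_le (hc : S.Convex μ) (h : S.Assumptions L σ ζ η)
    (hD : ∀ v, 0 < D v) (hV : 0 < V) (hT : 0 < T) (hμ : 0 ≤ μ) (hμL : μ ≤ L) (hL : 0 < L)
    (hA : 0 < S.A) (hη : 0 < η) (hηL : η * L * S.A ≤ 1 / 30) {y : Model d}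
    (hy : ∀ x, S.f y ≤ S.f x) {R : ℝ} (hR : ‖S.x₀ - y‖ ^ 2 ≤ R) :
    (𝔼 ω, S.f (S.timeAverage (fun t => ((1 - μ * η) ^ (t + 1))⁻¹) η ω)) - S.f y
      ≤ 2600 * (R / (η * ∑ t ∈ range T, ((1 - μ * η) ^ (t + 1))⁻¹)
        + concentration D * σ ^ 2 * η + L * (σ ^ 2 * S.A + ζ ^ 2 * S.A ^ 2) * η ^ 2) := by
  have hne := nonempty_sampling (T := T) hD
  have hA1 : (1 : ℝ) ≤ S.A := by exact_mod_cast hA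
  have hηL1 : η * L ≤ 1 / 30 := (le_mul_of_one_le_right (by positivity) hA1).trans hηL
  have hμη : μ * η ≤ η * L := by rw [mul_comm]; gcongr
  set θ := 1 - μ * η with hθ
  have hθ0 : 0 < θ := by linarith
  have hθ1 : θ ≤ 1 := by rw [hθ]; linarith [mul_nonneg hμ hη.le]
  set w : ℕ → ℝ := fun t => (θ ^ (t + 1))⁻¹ with hw
  have hw0 : ∀ t, 0 ≤ w t := fun t => by positivity
  set Γ : ℝ := σ ^ 2 * S.A + ζ ^ 2 * S.A ^ 2 with hΓ
  set N : ℝ := concentration D * σ ^ 2 with hN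
  have hN0 : 0 ≤ N := mul_nonneg (concentration_nonneg D) (sq_nonneg σ)
  have hΓ0 : 0 ≤ Γ := by positivity
  set W := ∑ t ∈ range T, w t with hW
  have hWpos : 0 < W := sum_pos (fun t _ => by positivity) ⟨0, mem_range.2 hT⟩
  let e : ℕ → ℝ := fun t => 𝔼 ω, (S.f (S.virtual η ω t) - S.f y)
  set Q := ∑ t ∈ range T, w t * e t with hQ
  set P := ∑ t ∈ range T, w t * (L * S.consensus η t) with hP
  have hPQ : P ≤ 5 / 17 * Q + 125 * η ^ 2 * L * Γ * W := by
    have h1 := h.sum_consensus_le hD hV hL hη hηL hw0 (fun z t hz ht =>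
      inv_pow_le_of_window hθ0 (by
        have := mul_le_mul_of_nonneg_right hμη (Nat.cast_nonneg (α := ℝ) S.A)
        rw [hθ]; linarith) hθ1 hz ht)
    have h2 : ∑ t ∈ range T, w t * S.gradSq η t ≤ 2 * L * Q := by
      rw [hQ, mul_sum]
      refine sum_le_sum fun t _ => ?_
      have : S.gradSq η t ≤ 2 * L * e t := by
        simp only [gradSq, e, mul_expect]
        exact expect_le_expect fun ω _ =>
          norm_gradient_sq_le h.differentiable_f hL (h.smooth_f hD hV) hy _
      have := mul_le_mul_of_nonneg_left this (hw0 t)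
      linarith
    have h3 : ∑ t ∈ range T, w t * (L ^ 2 * S.consensus η t) = L * P := by
      rw [hP, mul_sum]
      exact sum_congr rfl fun t _ => by ring
    rw [h3] at h1
    have h4 : L * P ≤ L * (5 / 17 * Q + 125 * η ^ 2 * L * Γ * W) := by linarith
    exact le_of_mul_le_mul_left h4 hL
  have htel : ∀ n ≤ T, (θ ^ n)⁻¹ * 𝔼 ω, ‖S.virtual η ω n - y‖ ^ 2
      + 13 / 15 * η * ∑ t ∈ range n, w t * e t
      ≤ R + 31 / 15 * η * ∑ t ∈ range n, w t * (L * S.consensus η t)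
        + η ^ 2 * N * ∑ t ∈ range n, w t := by
    intro n
    induction n with
    | zero => simpa [Fintype.expect_const] using hR
    | succ n ih =>
      intro hn
      have h1 := ih (by omega)
      have h2 := mul_le_mul_of_nonneg_left (hc.contraction h hD hV hμ hμL hL hη hηL1 hy (t := n)
        (by omega)) (hw0 n)
      have h3 : w n * θ = (θ ^ n)⁻¹ := by
        simp only [hw]
        rw [pow_succ, mul_inv, mul_assoc, inv_mul_cancel₀ hθ0.ne', mul_one]
      rw [sum_range_succ, sum_range_succ, sum_range_succ]
      rw [← hθ] at h2
      have h4 : w n * (θ * 𝔼 ω, ‖S.virtual η ω n - y‖ ^ 2)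
          = (θ ^ n)⁻¹ * 𝔼 ω, ‖S.virtual η ω n - y‖ ^ 2 := by rw [← h3]; ring
      change w n * _ + _ ≤ _
      simp only [e] at h1 ⊢
      linarith
  have h1 := htel T le_rfl
  have h2 : 0 ≤ (θ ^ T)⁻¹ * 𝔼 ω, ‖S.virtual η ω T - y‖ ^ 2 :=
    mul_nonneg (by positivity) (expect_nonneg fun _ _ => by positivity)
  -- Inserting `hPQ` leaves `13/15 - (31/15) * (5/17) = 22/85 > 1/4` in front of `η * Q`, and
  -- `(31/15) * 125 < 259`.
  have h3 : Q ≤ 4 * (R / η + 259 * (η ^ 2 * L * Γ * W) + η * N * W) := by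
    have h4 := mul_le_mul_of_nonneg_left hPQ hη.le
    have k1 : 0 ≤ η * (η ^ 2 * L * Γ * W) := by positivity
    have k2 : 0 ≤ η * (η * N * W) := by positivity
    have k3 : 0 ≤ R := (sq_nonneg _).trans hR
    have h5 : η * Q ≤ η * (4 * (R / η + 259 * (η ^ 2 * L * Γ * W) + η * N * W)) := by
      have : η * (4 * (R / η + 259 * (η ^ 2 * L * Γ * W) + η * N * W))
          = 4 * R + 1036 * (η * (η ^ 2 * L * Γ * W)) + 4 * (η * (η * N * W)) := by
        field_simp
        ring
      rw [this]
      have h6 : 0 ≤ η * Q := mul_nonneg hη.le (sum_nonneg fun t _ => mul_nonneg (hw0 t)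
        (expect_nonneg fun ω _ => sub_nonneg.2 (hy _)))
      linarith
    exact le_of_mul_le_mul_left h5 hη
  have h4 : W * ((𝔼 ω, S.f (S.timeAverage w η ω)) - S.f y) ≤ 2 * Q + P := by
    have e1 : W * ((𝔼 ω, S.f (S.timeAverage w η ω)) - S.f y)
        = 𝔼 ω, (W * S.f (S.timeAverage w η ω) - W * S.f y) := by
      rw [expect_sub_distrib, Fintype.expect_const, ← mul_expect, mul_sub]
    have e2 : 2 * Q + P = 𝔼 ω, ∑ t ∈ range T, w t * (2 * (S.f (S.virtual η ω t) - S.f y)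
        + L * S.spread η ω t) := by
      rw [expect_sum_comm, hQ, hP, mul_sum, ← sum_add_distrib]
      refine sum_congr rfl fun t _ => ?_
      rw [← mul_expect, expect_add_distrib, ← mul_expect, ← mul_expect, expect_spread]
      simp only [e]
      ring
    rw [e1, e2]
    refine expect_le_expect fun ω _ => ?_
    have e3 := hc.f_timeAverage_le hμ h hD hV hWpos hw0 ω
    have e4 : ∑ t ∈ range T, w t * S.f (S.nodeAverage η ω t) - W * S.f y
        = ∑ t ∈ range T, w t * (S.f (S.nodeAverage η ω t) - S.f y) := by
      rw [hW, sum_mul, ← sum_sub_distrib]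
      exact sum_congr rfl fun t _ => by ring
    refine (sub_le_sub_right e3 _).trans (e4.le.trans (sum_le_sum fun t _ => ?_))
    refine mul_le_mul_of_nonneg_left ?_ (hw0 t)
    refine (sub_le_two_mul_sub_add h.differentiable_f hL (h.smooth_f hD hV) hy
      (S.virtual η ω t) _).trans ?_
    have := mul_le_mul_of_nonneg_left (S.norm_nodeAverage_sub_sq_le hD hV η ω t) hL.le
    linarith
  have h5 : W * ((𝔼 ω, S.f (S.timeAverage w η ω)) - S.f y)
      ≤ W * (2600 * (R / (η * W) + N * η + L * Γ * η ^ 2)) := by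
    have e1 : W * (2600 * (R / (η * W) + N * η + L * Γ * η ^ 2))
        = 2600 * (R / η) + 2600 * (η * N * W) + 2600 * (η ^ 2 * L * Γ * W) := by
      field_simp
    have k1 : 0 ≤ η ^ 2 * L * Γ * W := by positivity
    have k2 : 0 ≤ η * N * W := by positivity
    have k3 : 0 ≤ R / η := div_nonneg ((sq_nonneg _).trans hR) hη.le
    rw [e1]
    linarith
  exact le_of_mul_le_mul_left h5 hWpos

theorem Convex.le_of_pos (hc : S.Convex μ) (h : S.Assumptions L σ ζ η)
    (hD : ∀ v, 0 < D v) (hV : 0 < V) (hd : 0 < d) : μ ≤ L := by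
  have : Nonempty (Fin d) := ⟨⟨0, hd⟩⟩
  obtain ⟨x, hx⟩ := exists_ne (0 : Model d)
  have hpos : 0 < ‖x‖ := norm_pos_iff.2 hx
  have h1 := hc.global h hD hV 0 x
  have h2 := hc.global h hD hV x 0
  have h3 := h.smooth_f hD hV 0 x
  have h4 := real_inner_le_norm (gradient S.f x - gradient S.f 0) x
  have h5 := mul_le_mul_of_nonneg_right h3 hpos.le
  rw [sub_zero] at h1 h3 h5
  rw [zero_sub, inner_neg_right, norm_neg] at h2
  rw [inner_sub_left] at h4
  have h6 : μ * ‖x‖ ^ 2 ≤ L * ‖x‖ ^ 2 := by nlinarith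
  exact le_of_mul_le_mul_right h6 (by positivity)

end Instance

/-! ### The choice of the learning rate -/

/-- The rate is `1/(M + s + r)`, a smooth substitute for the minimum of `1/M`, `1/s` and `1/r`. Here
`1/s` balances `q/η` with `bη`, and `1/r` balances it with `cη²`. -/
theorem exists_rate {q M b c : ℝ} (hq : 0 < q) (hM : 0 < M) (hb : 0 ≤ b) (hc : 0 ≤ c) :
    ∃ η : ℝ, 0 < η ∧ η ≤ 1 / M ∧ q / η + b * η + c * η ^ 2
      ≤ q * M + 2 * √(b * q) + 2 * (q * √c) ^ (2 / 3 : ℝ) := by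
  set s := √(b / q) with hs
  set r := (c / q) ^ (1 / 3 : ℝ) with hr
  have hs0 : 0 ≤ s := Real.sqrt_nonneg _
  have hr0 : 0 ≤ r := by positivity
  have hs2 : q * s ^ 2 = b := by rw [hs, Real.sq_sqrt (by positivity)]; field_simp
  have hr3 : q * r ^ 3 = c := by
    rw [hr, ← Real.rpow_natCast, ← Real.rpow_mul (by positivity)]
    norm_num
    field_simp
  have hX : 0 < M + s + r := by positivity
  refine ⟨1 / (M + s + r), by positivity, one_div_le_one_div_of_le hM (by linarith), ?_⟩
  have e1 : √(b * q) = q * s := by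
    rw [Real.sqrt_eq_iff_mul_self_eq (by positivity) (by positivity), ← hs2]
    ring
  have e2 : (q * √c) ^ (2 / 3 : ℝ) = q * r := by
    have h1 : q * √c = (q * r) ^ (3 / 2 : ℝ) := by
      have h2 : q * √c = √((q * r) ^ 3) := by
        rw [← hr3, eq_comm, Real.sqrt_eq_iff_mul_self_eq (by positivity) (by positivity),
          mul_mul_mul_comm, Real.mul_self_sqrt (by positivity)]
        ring
      rw [h2, Real.sqrt_eq_rpow, ← Real.rpow_natCast, ← Real.rpow_mul (by positivity)]
      norm_num
    rw [h1, ← Real.rpow_mul (by positivity)]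
    norm_num
  rw [e1, e2, ← hs2, ← hr3]
  have f1 : q / (1 / (M + s + r)) = q * (M + s + r) := by field_simp
  have f2 : q * s ^ 2 * (1 / (M + s + r)) ≤ q * s := by
    rw [mul_one_div, div_le_iff₀ hX]
    have : 0 ≤ q * s * (M + r) := by positivity
    linarith
  have f3 : q * r ^ 3 * (1 / (M + s + r)) ^ 2 ≤ q * r := by
    rw [one_div, inv_pow, ← div_eq_mul_inv, div_le_iff₀ (by positivity)]
    have : r ^ 2 ≤ (M + s + r) ^ 2 := by gcongr; linarith
    have := mul_le_mul_of_nonneg_left this (by positivity : 0 ≤ q * r)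
    linarith
  rw [f1]
  linarith

/-- The rate is the minimum of `1/M` and `l/τ`. At `l/τ` the exponential is at most the inverse of
the quotient inside the logarithm, which brings the first term down to the size of the other two. If
`b = c = 0`, only `1/M` is needed. -/
theorem exists_rate_exp {R M b c τ : ℝ} (hR : 0 ≤ R) (hM : 0 < M) (hτ : 0 < τ) (hb : 0 ≤ b)
    (hc : 0 ≤ c) {l : ℝ} (hl : l = Real.log (max 2 (R / (b / τ ^ 2 + c / τ ^ 3)))) :
    ∃ η : ℝ, 0 < η ∧ η ≤ 1 / M ∧ R * Real.exp (-(τ * η)) / η + b * η + c * η ^ 2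
      ≤ 5 * (R * M * Real.exp (-(τ / M)) + b / τ * l + c / τ ^ 2 * l ^ 2) := by
  have hl0 : 0.69 ≤ l := by
    have h1 : Real.log 2 ≤ l := by
      rw [hl]
      exact Real.log_le_log (by norm_num) (le_max_left _ _)
    linarith [Real.log_two_gt_d9]
  have hlpos : 0 < l := by linarith
  have k1 : 0 ≤ R * M * Real.exp (-(τ / M)) := by positivity
  have k2 : 0 ≤ b / τ * l := by positivity
  have k3 : 0 ≤ c / τ ^ 2 * l ^ 2 := by positivity
  have main : R * Real.exp (-(τ * (1 / M))) / (1 / M) = R * M * Real.exp (-(τ / M)) := by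
    rw [mul_one_div]
    field_simp
  set X := b / τ ^ 2 + c / τ ^ 3 with hX
  have hb' : 0 ≤ b / τ ^ 2 := by positivity
  have hc' : 0 ≤ c / τ ^ 3 := by positivity
  rcases eq_or_lt_of_le (add_nonneg hb' hc' : 0 ≤ X) with h0 | hXpos
  · have hb0 : b = 0 := by
      have : b / τ ^ 2 = 0 := by linarith
      simpa [hτ.ne'] using this
    have hc0 : c = 0 := by
      have : c / τ ^ 3 = 0 := by linarith
      simpa [hτ.ne'] using this
    refine ⟨1 / M, by positivity, le_rfl, ?_⟩
    rw [main, hb0, hc0]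
    simp only [zero_mul, zero_div, add_zero]
    linarith
  rcases le_total (1 / M) (l / τ) with hle | hle
  · refine ⟨1 / M, by positivity, le_rfl, ?_⟩
    rw [main]
    have h1 : b * (1 / M) ≤ b / τ * l := by
      calc b * (1 / M) ≤ b * (l / τ) := by gcongr
        _ = _ := by ring
    have h2 : c * (1 / M) ^ 2 ≤ c / τ ^ 2 * l ^ 2 := by
      calc c * (1 / M) ^ 2 ≤ c * (l / τ) ^ 2 := by gcongr
        _ = _ := by ring
    linarith
  · refine ⟨l / τ, by positivity, hle, ?_⟩
    have h1 : b * (l / τ) = b / τ * l := by ring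
    have h2 : c * (l / τ) ^ 2 = c / τ ^ 2 * l ^ 2 := by ring
    have h3 : R * Real.exp (-(τ * (l / τ))) ≤ X := by
      rw [mul_div_cancel₀ _ hτ.ne', Real.exp_neg, hl, Real.exp_log (by positivity),
        ← div_eq_mul_inv, div_le_iff₀ (by positivity), ← div_le_iff₀' hXpos]
      exact le_max_right _ _
    have h4 : R * Real.exp (-(τ * (l / τ))) / (l / τ) ≤ 4 * (b / τ * l) + 4 * (c / τ ^ 2 * l ^ 2) := by
      rw [div_le_iff₀ (by positivity)]
      refine h3.trans ?_
      have e1 : (4 * (b / τ * l) + 4 * (c / τ ^ 2 * l ^ 2)) * (l / τ)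
          = (4 * l ^ 2) * (b / τ ^ 2) + (4 * l ^ 3) * (c / τ ^ 3) := by
        field_simp
      -- The `2` inside the maximum keeps `l` above `0.69`; this makes the factor `4` sufficient.
      have e2 : 1 ≤ 4 * l ^ 2 := by nlinarith
      have e3 : 1 ≤ 4 * l ^ 3 := by nlinarith [pow_pos hlpos 2]
      rw [e1, hX]
      nlinarith
    rw [h1, h2]
    linarith

/-! ### The rates -/

theorem nonconvexRate_nonneg {F L A σ ζ ρ T : ℝ} (hF : 0 ≤ F) (hL : 0 ≤ L) (hA : 0 ≤ A)
    (hσ : 0 ≤ σ) (hT : 0 ≤ T) : 0 ≤ nonconvexRate F L A σ ζ ρ T := by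
  unfold nonconvexRate; positivity

theorem convexRate_nonneg {R L A σ ζ ρ T : ℝ} (hR : 0 ≤ R) (hL : 0 ≤ L) (hA : 0 ≤ A)
    (hσ : 0 ≤ σ) (hT : 0 ≤ T) : 0 ≤ convexRate R L A σ ζ ρ T := by
  unfold convexRate; positivity

theorem stronglyConvexRate_nonneg {R L A σ ζ ρ μ T : ℝ} (hR : 0 ≤ R) (hL : 0 ≤ L) (hA : 0 ≤ A)
    (hρ : 0 ≤ ρ) (hμ : 0 ≤ μ) (hT : 0 ≤ T) : 0 ≤ stronglyConvexRate R L A σ ζ ρ μ T := by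
  have h : 0 ≤ logFactor R L A σ ζ ρ μ T :=
    Real.log_nonneg (one_le_two.trans (le_max_left _ _))
  unfold stronglyConvexRate; positivity

theorem Instance.f_eq_zero {d T : ℕ} {D : Fin 0 → ℕ} (S : Instance d 0 T D) :
    S.f = fun _ => 0 := by
  funext x
  simp [Instance.f, globalLoss]

theorem mul_mul_le_of_le_one_div {η L A : ℝ} (hL : 0 < L) (hA : 0 < A)
    (h : η ≤ 1 / (30 * L * A)) : η * L * A ≤ 1 / 30 := by
  rw [le_div_iff₀ (by positivity)] at h
  linarith

theorem exists_rate_nonconvex {d V T A : ℕ} {D : Fin V → ℕ} {L σ ζ F : ℝ} (hD : ∀ v, 0 < D v)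
    (hT : 0 < T) (hA : 0 < A) (hL : 0 < L) (hσ : 0 ≤ σ) (hF : 0 < F) :
    ∃ η : ℝ, 0 < η ∧ η ≤ 1 / (30 * L * A) ∧
      ∀ S : Instance d V T D, S.A = A → S.Assumptions L σ ζ η →
      ∀ fstar : ℝ, IsGLB (Set.range S.f) fstar → S.f S.x₀ - fstar ≤ F →
        (1 / (T : ℝ)) * ∑ t ∈ range T, (𝔼 ω, ‖gradient S.f (S.nodeAverage η ω t)‖ ^ 2)
          ≤ 390000 * nonconvexRate F L A σ ζ (concentration D) T := by
  have hA' : (0 : ℝ) < A := by exact_mod_cast hA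
  have hT' : (0 : ℝ) < T := by exact_mod_cast hT
  have hρ := concentration_nonneg D
  obtain ⟨η, h0, h1, h2⟩ := exists_rate (q := F / T) (M := 30 * L * A)
    (b := L * (concentration D * σ ^ 2)) (c := L ^ 2 * (σ ^ 2 * A + ζ ^ 2 * A ^ 2))
    (by positivity) (by positivity) (by positivity) (by positivity)
  refine ⟨η, h0, h1, fun S hSA hS m hm hF' => ?_⟩
  have hrate := nonconvexRate_nonneg (ζ := ζ) (ρ := concentration D) hF.le hL.le hA'.le hσ hT'.le
  -- Without nodes the weights do not sum to `1`, but `f` vanishes.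
  rcases Nat.eq_zero_or_pos V with rfl | hV
  · have : ∀ x, gradient S.f x = 0 := fun x => by rw [S.f_eq_zero, gradient_fun_const]
    simp only [this, norm_zero]
    simpa using hrate
  have h3 := hS.sum_norm_gradient_sq_le hD hV hT hL (by omega) h0
    (by rw [hSA]; exact mul_mul_le_of_le_one_div hL hA' h1) (fun x => hm.1 ⟨x, rfl⟩) hF'
  rw [hSA] at h3
  refine h3.trans ((mul_le_mul_of_nonneg_left h2 (by norm_num)).trans ?_)
  have e1 : √(L * (concentration D * σ ^ 2) * (F / T)) = σ * √(concentration D * L * F / T) := by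
    rw [show L * (concentration D * σ ^ 2) * (F / T) = σ ^ 2 * (concentration D * L * F / T) by ring,
      Real.sqrt_mul (sq_nonneg σ), Real.sqrt_sq hσ]
  have e2 : F / T * √(L ^ 2 * (σ ^ 2 * A + ζ ^ 2 * A ^ 2))
      = L * F * √(σ ^ 2 * A + ζ ^ 2 * A ^ 2) / T := by
    rw [Real.sqrt_mul (sq_nonneg L), Real.sqrt_sq hL.le]
    ring
  rw [e1, e2]
  have k1 : 0 ≤ F * L * A / T := by positivity
  have k2 : 0 ≤ σ * √(concentration D * L * F / T) := by positivity
  have k3 : 0 ≤ (L * F * √(σ ^ 2 * A + ζ ^ 2 * A ^ 2) / T) ^ (2 / 3 : ℝ) := by positivity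
  have e3 : F / T * (30 * L * A) = 30 * (F * L * A / T) := by ring
  rw [e3]
  unfold nonconvexRate
  linarith

theorem exists_rate_convex {d V T A : ℕ} {D : Fin V → ℕ} {L σ ζ R : ℝ} (hD : ∀ v, 0 < D v)
    (hT : 0 < T) (hA : 0 < A) (hL : 0 < L) (hσ : 0 ≤ σ) (hR : 0 < R) :
    ∃ η : ℝ, 0 < η ∧ η ≤ 1 / (30 * L * A) ∧
      ∀ S : Instance d V T D, S.A = A → S.Assumptions L σ ζ η → S.Convex 0 →
      ∀ xstar : Model d, (∀ x, S.f xstar ≤ S.f x) → ‖S.x₀ - xstar‖ ^ 2 ≤ R →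
        (𝔼 ω, S.f (S.timeAverage (fun _ => 1) η ω)) - S.f xstar
          ≤ 390000 * convexRate R L A σ ζ (concentration D) T := by
  have hA' : (0 : ℝ) < A := by exact_mod_cast hA
  have hT' : (0 : ℝ) < T := by exact_mod_cast hT
  have hρ := concentration_nonneg D
  obtain ⟨η, h0, h1, h2⟩ := exists_rate (q := R / T) (M := 30 * L * A)
    (b := concentration D * σ ^ 2) (c := L * (σ ^ 2 * A + ζ ^ 2 * A ^ 2))
    (by positivity) (by positivity) (by positivity) (by positivity)
  refine ⟨η, h0, h1, fun S hSA hS hc y hy hR' => ?_⟩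
  have hrate := convexRate_nonneg (ζ := ζ) (ρ := concentration D) hR.le hL.le hA'.le hσ hT'.le
  rcases Nat.eq_zero_or_pos V with rfl | hV
  · simp only [S.f_eq_zero, expect_const_zero, sub_zero]
    positivity
  have h3 := hc.f_timeAverage_sub_le hS hD hV hT le_rfl hL.le hL (by omega) h0
    (by rw [hSA]; exact mul_mul_le_of_le_one_div hL hA' h1) hy hR'
  simp only [zero_mul, sub_zero, one_pow, inv_one, sum_const, card_range, nsmul_eq_mul,
    mul_one] at h3
  have e0 : R / (η * T) = R / T / η := by rw [div_div, mul_comm η]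
  rw [hSA, e0] at h3
  refine h3.trans ((mul_le_mul_of_nonneg_left h2 (by norm_num)).trans ?_)
  have e1 : √(concentration D * σ ^ 2 * (R / T)) = σ * √(concentration D * R / T) := by
    rw [show concentration D * σ ^ 2 * (R / T) = σ ^ 2 * (concentration D * R / T) by ring,
      Real.sqrt_mul (sq_nonneg σ), Real.sqrt_sq hσ]
  have e2 : R / T * √(L * (σ ^ 2 * A + ζ ^ 2 * A ^ 2))
      = R * √(L * (σ ^ 2 * A + ζ ^ 2 * A ^ 2)) / T := by ring
  rw [e1, e2]
  have k1 : 0 ≤ R * L * A / T := by positivity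
  have k2 : 0 ≤ σ * √(concentration D * R / T) := by positivity
  have k3 : 0 ≤ (R * √(L * (σ ^ 2 * A + ζ ^ 2 * A ^ 2)) / T) ^ (2 / 3 : ℝ) := by positivity
  have e3 : R / T * (30 * L * A) = 30 * (R * L * A / T) := by ring
  rw [e3]
  unfold convexRate
  linarith

theorem exists_rate_stronglyConvex {d V T A : ℕ} {D : Fin V → ℕ} {L σ ζ R μ : ℝ}
    (hD : ∀ v, 0 < D v) (hT : 0 < T) (hA : 0 < A) (hL : 0 < L) (hR : 0 ≤ R) (hμ : 0 < μ) :
    ∃ η : ℝ, 0 < η ∧ η ≤ 1 / (30 * L * A) ∧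
      ∀ S : Instance d V T D, S.A = A → S.Assumptions L σ ζ η → S.Convex μ →
      ∀ xstar : Model d, (∀ x, S.f xstar ≤ S.f x) → ‖S.x₀ - xstar‖ ^ 2 ≤ R →
        (𝔼 ω, S.f (S.timeAverage (fun t => ((1 - μ * η) ^ (t + 1))⁻¹) η ω)) - S.f xstar
          ≤ 390000 * stronglyConvexRate R L A σ ζ (concentration D) μ T := by
  have hA' : (0 : ℝ) < A := by exact_mod_cast hA
  have hA1 : (1 : ℝ) ≤ A := by exact_mod_cast hA
  have hT' : (0 : ℝ) < T := by exact_mod_cast hT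
  have hρ := concentration_nonneg D
  obtain ⟨η, h0, h1, h2⟩ := exists_rate_exp (R := R) (M := 30 * L * A) (τ := μ * T)
    (b := concentration D * σ ^ 2) (c := L * (σ ^ 2 * A + ζ ^ 2 * A ^ 2)) hR (by positivity)
    (by positivity) (by positivity) (by positivity) rfl
  refine ⟨η, h0, h1, fun S hSA hS hc y hy hR' => ?_⟩
  have hrate := stronglyConvexRate_nonneg (σ := σ) (ζ := ζ) hR hL.le hA'.le hρ hμ.le hT'.le
  rcases Nat.eq_zero_or_pos V with rfl | hV
  · simp only [S.f_eq_zero, expect_const_zero, sub_zero]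
    positivity
  -- In dimension zero `μ ≤ L` may fail, but all models coincide.
  rcases Nat.eq_zero_or_pos d with rfl | hd
  · have hne := Instance.nonempty_sampling (T := T) hD
    have : ∀ x, S.f x = S.f y := fun x => by rw [Subsingleton.elim x y]
    simp only [this, Fintype.expect_const, sub_self]
    positivity
  have hηL := mul_mul_le_of_le_one_div hL hA' h1
  have hμL := hc.le_of_pos hS hD hV hd
  have h3 := hc.f_timeAverage_sub_le hS hD hV hT hμ.le hμL hL (by omega) h0
    (by rw [hSA]; exact hηL) hy hR'
  rw [hSA] at h3
  have hθ : 0 < 1 - μ * η := by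
    have e1 : μ * η ≤ L * η := by gcongr
    have e2 : η * L ≤ η * L * A := le_mul_of_one_le_right (by positivity) hA1
    linarith
  have hW : Real.exp (μ * T * η) ≤ ∑ t ∈ range T, ((1 - μ * η) ^ (t + 1))⁻¹ := by
    -- The last weight alone already gives the exponential decay.
    have e1 : ((1 - μ * η) ^ (T - 1 + 1))⁻¹ ≤ ∑ t ∈ range T, ((1 - μ * η) ^ (t + 1))⁻¹ :=
      single_le_sum (f := fun t => ((1 - μ * η) ^ (t + 1))⁻¹) (fun t _ => by positivity)
        (mem_range.2 (by omega))
    rw [Nat.sub_add_cancel hT] at e1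
    refine le_trans ?_ e1
    rw [le_inv_comm₀ (Real.exp_pos _) (by positivity), ← Real.exp_neg]
    calc (1 - μ * η) ^ T ≤ Real.exp (-(μ * η)) ^ T := by
          gcongr
          linarith [Real.add_one_le_exp (-(μ * η))]
      _ = _ := by rw [← Real.exp_nat_mul]; ring_nf
  have h4 : R / (η * ∑ t ∈ range T, ((1 - μ * η) ^ (t + 1))⁻¹)
      ≤ R * Real.exp (-(μ * T * η)) / η := by
    rw [Real.exp_neg, ← div_eq_mul_inv, div_div, mul_comm (Real.exp _)]
    gcongr
  have h5 := h3.trans (mul_le_mul_of_nonneg_left (add_le_add_left (add_le_add_left h4 _) _)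
    (by norm_num))
  refine h5.trans ((mul_le_mul_of_nonneg_left h2 (by norm_num)).trans ?_)
  change _ * (5 * (_ + _ * logFactor R L A σ ζ (concentration D) μ T
    + _ * logFactor R L A σ ζ (concentration D) μ T ^ 2)) ≤ _
  have hlog : 0 ≤ logFactor R L A σ ζ (concentration D) μ T :=
    Real.log_nonneg (one_le_two.trans (le_max_left _ _))
  have e3 : R * (30 * L * A) * Real.exp (-(μ * T / (30 * L * A)))
      = 30 * (R * L * A * Real.exp (-(μ * T / (30 * L * A)))) := by ring
  rw [e3]
  unfold stronglyConvexRate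
  have k1 : 0 ≤ R * L * A * Real.exp (-(μ * T / (30 * L * A))) := by positivity
  have k2 : 0 ≤ concentration D * σ ^ 2 / (μ * T) * logFactor R L A σ ζ (concentration D) μ T := by
    positivity
  have k3 : 0 ≤ L * (σ ^ 2 * A + ζ ^ 2 * A ^ 2) / (μ * T) ^ 2
      * logFactor R L A σ ζ (concentration D) μ T ^ 2 := by positivity
  rw [← mul_pow μ]
  linarith

end Digest

open Digest in
theorem theorem1 :
    ∃ C : ℝ, 0 < C ∧
      ∀ (d V T A : ℕ) (D : Fin V → ℕ) (L σ ζ : ℝ),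
        (∀ v, 0 < D v) → 0 < T → 0 < A → 0 < L → 0 ≤ σ → 0 ≤ ζ →
        -- non-convex losses
        (∀ F : ℝ, 0 < F → ∃ η : ℝ, 0 < η ∧ η ≤ 1 / (30 * L * A) ∧
          ∀ S : Instance d V T D, S.A = A → S.Assumptions L σ ζ η →
          ∀ fstar : ℝ, IsGLB (Set.range S.f) fstar → S.f S.x₀ - fstar ≤ F →
            (1 / (T : ℝ)) * ∑ t ∈ Finset.range T,
                (𝔼 ω : Sampling T D, ‖gradient S.f (S.nodeAverage η ω t)‖ ^ 2)
              ≤ C * nonconvexRate F L A σ ζ (concentration D) T) ∧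
        -- convex losses
        (∀ R : ℝ, 0 < R → ∃ η : ℝ, 0 < η ∧ η ≤ 1 / (30 * L * A) ∧
          ∀ S : Instance d V T D, S.A = A → S.Assumptions L σ ζ η → S.Convex 0 →
          ∀ xstar : Model d, (∀ x, S.f xstar ≤ S.f x) → ‖S.x₀ - xstar‖ ^ 2 ≤ R →
            (𝔼 ω : Sampling T D, S.f (S.timeAverage (fun _ => 1) η ω)) - S.f xstar
              ≤ C * convexRate R L A σ ζ (concentration D) T) ∧
        -- strongly convex losses
        (∀ R μ : ℝ, 0 ≤ R → 0 < μ → ∃ η : ℝ, 0 < η ∧ η ≤ 1 / (30 * L * A) ∧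
          ∀ S : Instance d V T D, S.A = A → S.Assumptions L σ ζ η → S.Convex μ →
          ∀ xstar : Model d, (∀ x, S.f xstar ≤ S.f x) → ‖S.x₀ - xstar‖ ^ 2 ≤ R →
            (𝔼 ω : Sampling T D,
                S.f (S.timeAverage (fun t => ((1 - μ * η) ^ (t + 1))⁻¹) η ω)) - S.f xstar
              ≤ C * stronglyConvexRate R L A σ ζ (concentration D) μ T) := by
  -- The strongly convex case is the most expensive: `2600` from `f_timeAverage_sub_le`, `5` from
  -- `exists_rate_exp` and `30` from `M = 30 * L * A`.
  refine ⟨390000, by norm_num, fun d V T A D L σ ζ hD hT hA hL hσ _ => ⟨fun F hF => ?_,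
    fun R hR => ?_, fun R μ hR hμ => ?_⟩⟩
  · exact exists_rate_nonconvex hD hT hA hL hσ hF
  · exact exists_rate_convex hD hT hA hL hσ hR
  · exact exists_rate_stronglyConvex hD hT hA hL hR hμ
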